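/- Let $k,d\ge 1$, $n\ge1$ be integers such that $k\mid 2dn$, and let $m=2dn/k$. A formula $\Phi$ is a bijection $[m]\times[k]\to\{x_1,\dots,x_n\}\times[d]\times\{\pm1\}$; write $\partial(i,j)$ and $\mathrm{sign}(i,j)$ for the first and the last component of $\Phi[i,j]$ (the variable and its sign in the $j$th slot of the $i$th clause). Let $\boldsymbol\Phi$ be a uniformly random formula, and let $q=q(k)\in(0,1)$ be the unique solution in $(0,1)$ of $2q=1-(1-q)^k$ (which exists for $k\ge 3$). *Tilting.* Let $\Sigma=\{\pm1\}^k\setminus\{(-1,\dots,-1)\}$, and let $\mathcal M$ be the set of probability distributions $\mu$ on $\Sigma$ such that $m\mu(\sigma)\in\mathbb Z$ for all $\sigma\in\Sigma$ and $\sum_{\sigma\in\Sigma}\mu(\sigma)\sum_{j=1}^k\sigma_j=0$. For $\mu\in\mathcal M$ let $Z_\mu=Z_\mu(\Phi)$ be the number of assignments $\tau:\{x_1,\dots,x_n\}\to\{\pm1\}$ such that $\mu(\sigma)=\frac1m\,|\{i\in[m]:\mathrm{sign}(i,j)\,\tau(\partial(i,j))=\sigma_j\text{ for all }j\in[k]\}|$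 for every $\sigma\in\Sigma$. Let $$\bar\mu(\sigma)=\frac{(q(1-q))^{k/2}}{1-(1-q)^k}\Big(\frac q{1-q}\Big)^{\frac12\sum_{j=1}^k\sigma_j}\quad(\sigma\in\Sigma),$$ and for $\omega>0$ let $\mathcal M_\omega=\{\mu\in\mathcal M:\|\mu-\bar\mu\|_2\le\omega m^{-1/2}\}$. *Cycles.* A sign pattern of half-length $l\ge1$ is a sequence $s=(s_2,\dots,s_{2l+1})\in\{\pm1\}^{2l}$. Let $C_s=C_s(\Phi)$ be the number of sequences $(i_2,j_2),\dots,(i_{2l+1},j_{2l+1})\in[m]\times[k]$ such that: $i_2=i_{2l+1}=\min\{i_2,i_4,\dots,i_{2l}\}$, and $i_2,i_4,\dots,i_{2l}$ are pairwise distinct; $i_{t+1}=i_t$ for each odd $t$ with $3\le t\le 2l-1$; $\partial(i_t,j_t)=\partial(i_{t+1},j_{t+1})$ for each even $t$ with $2\le t\le 2l$, and $\partial(i_2,j_2),\partial(i_4,j_4),\dots,\partial(i_{2l},j_{2l})$ are pairwise distinct; $j_2<j_{2l+1}$; and $\mathrm{sign}(i_t,j_t)=s_t$ for all $2\le t\le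 2l+1$. *Parameters.* For $s\in\{\pm1\}^{2l}$ let $a$ be the number of $i\in[l]$ with $s_{2i}s_{2i+1}=1$, and put (with $0^0=1$) $$\lambda_s=\frac1{2l}\Big(\frac{k-1}2\Big)^l(d-1)^{a}d^{\,l-a},\qquad \delta_s=-1+\mathrm{tr}\prod_{i=1}^lM_{s_{2i}s_{2i+1}},$$ $$M_1=\frac1q\begin{pmatrix}q^2&(1-q)^2\\q^2&q^2\end{pmatrix},\qquad M_{-1}=\frac1{1-q}\begin{pmatrix}(1-q)^2&(1-q)^2\\q^2&(1-q)^2\end{pmatrix}.$$ **Proposition.** There is a constant $k_0$ such that the following holds for all integers $k\ge k_0$ and $d\ge1$ with $2d/k\le 2^k\ln2-\tfrac12k\ln2-4$. For every finite set $S$ of sign patterns, every family $(c_s)_{s\in S}$ of non-negative integers and every $\omega>0$, $$\lim_{n\to\infty}\ \max_{\mu\in\mathcal M_\omega}\left|\frac{\mathbb E\big[Z_\mu\mathbf 1\{\forall s\in S:C_s=c_s\}\big]}{\mathbb E[Z_\mu]}-\prod_{s\in S}\mathbb P\big[\mathrm{Po}((1+\delta_s)\lambda_s)=c_s\big]\right|=0,$$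 where the limit is along those $n$ for which $k\mid 2dn$. Moreover, $\delta_s>-1$ for all sign patterns $s$, $(2d-1)(k-1)(1-4q(1-q))<1$, and $$\sum_{l\ge1}\ \sum_{s\in\{\pm1\}^{2l}}\lambda_s\delta_s^2=-\tfrac12\ln\big(1-(2d-1)(k-1)(1-4q(1-q))\big).$$ -/

import Mathlib

namespace RegSAT

open scoped BigOperators

/-! The signs and truth values `1` and `-1` are the elements of `ℤˣ`. -/

/-- A regular formula with `n` variables and `m` clauses of length `k`, in which each of the `2 * n`
literals has `d` clones: a bijection from the clause slots onto the literal clones. -/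
abbrev Formula (n m d k : ℕ) : Type := (Fin m × Fin k) ≃ (Fin n × Fin d × ℤˣ)

/-- The variable `∂(i, j)` in a slot. -/
def Formula.var {n m d k : ℕ} (Φ : Formula n m d k) (p : Fin m × Fin k) : Fin n := (Φ p).1

/-- The sign with which the variable occurs in a slot. -/
def Formula.sgn {n m d k : ℕ} (Φ : Formula n m d k) (p : Fin m × Fin k) : ℤˣ := (Φ p).2.2

/-- Expectation with respect to the uniformly random formula. -/
noncomputable def expectation {n m d k : ℕ} (f : Formula n m d k → ℝ) : ℝ :=
  (∑ Φ : Formula n m d k, f Φ) / (Fintype.card (Formula n m d k) : ℝ)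

/-- The truth value patterns that satisfy a clause: all but the all-false one. -/
abbrev ClausePattern (k : ℕ) : Type := {σ : Fin k → ℤˣ // σ ≠ fun _ => -1}

/-- The sum of the entries of a truth value pattern. -/
def entrySum {k : ℕ} (σ : Fin k → ℤˣ) : ℤ := ∑ j, ((σ j : ℤˣ) : ℤ)

/-- The set `M(d, k, n)`: probability distributions on the satisfying clause patterns with
probabilities in `(1/m) ℤ`, under which the expected sum of the entries vanishes. -/
structure IsClauseMarginal {k : ℕ} (m : ℕ) (μ : ClausePattern k → ℝ) : Prop where
  nonneg : ∀ σ, 0 ≤ μ σ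
  sum_eq_one : ∑ σ, μ σ = 1
  integral : ∀ σ, ∃ z : ℤ, (m : ℝ) * μ σ = z
  balanced : ∑ σ, μ σ * (entrySum σ.1 : ℝ) = 0

/-- The number `Z_μ` of truth assignments `τ` under which, for every satisfying pattern `σ`, the
fraction of the clauses whose literals have truth values `σ` is `μ σ`. -/
noncomputable def Zmu {n m d k : ℕ} (μ : ClausePattern k → ℝ) (Φ : Formula n m d k) : ℕ :=
  open Classical in
  (Finset.univ.filter fun τ : Fin n → ℤˣ =>
    ∀ σ : ClausePattern k, μ σ = (1 / (m : ℝ)) *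
      ∑ i : Fin m, ∏ j : Fin k,
        if Φ.sgn (i, j) * τ (Φ.var (i, j)) = σ.1 j then (1 : ℝ) else 0).card

/-- `q` is a solution in `(0, 1)` of `2 q = 1 - (1 - q) ^ k`; for `k ≥ 3` there is exactly one, see
`existsUnique_isMarginalParam`. -/
def IsMarginalParam (k : ℕ) (q : ℝ) : Prop :=
  0 < q ∧ q < 1 ∧ 2 * q = 1 - (1 - q) ^ k

theorem existsUnique_isMarginalParam (k : ℕ) (hk : 3 ≤ k) : ∃! q : ℝ, IsMarginalParam k q := by
  have hex : ∃ q : ℝ, IsMarginalParam k q := by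
    have hc : ContinuousOn (fun q : ℝ => 1 - (1 - q) ^ k - 2 * q) (Set.Icc (1 / 4) 1) := by
      fun_prop
    have h1 : (3 / 4 : ℝ) ^ k ≤ (3 / 4 : ℝ) ^ 3 :=
      pow_le_pow_of_le_one (by norm_num) (by norm_num) hk
    have hz : (0 : ℝ) ∈ Set.Icc ((1 : ℝ) - (1 - 1) ^ k - 2 * 1)
        (1 - (1 - 1 / 4) ^ k - 2 * (1 / 4)) := by
      constructor
      · rw [sub_self, zero_pow (by omega)]; norm_num
      · have : (1 - 1 / 4 : ℝ) = 3 / 4 := by norm_num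
        rw [this]
        norm_num at h1 ⊢
        linarith
    obtain ⟨q, hq, hq0⟩ := intermediate_value_Icc' (by norm_num) hc hz
    have hq0' : 1 - (1 - q) ^ k - 2 * q = 0 := hq0
    have hne : q ≠ 1 := by
      rintro rfl
      rw [sub_self, zero_pow (by omega)] at hq0'
      norm_num at hq0'
    exact ⟨q, by linarith [hq.1], lt_of_le_of_ne hq.2 hne, by linarith⟩
  have key : ∀ a b : ℝ, IsMarginalParam k a → IsMarginalParam k b → ¬ a < b := by
    rintro a b ⟨ha0, ha1, ha⟩ ⟨hb0, hb1, hb⟩ hab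
    have hs := (strictConvexOn_pow (n := k) (by omega)).2
      (show (1 - b) ∈ Set.Ici (0 : ℝ) by simp; linarith)
      (show (1 : ℝ) ∈ Set.Ici (0 : ℝ) by simp) (by linarith)
      (show 0 < a / b by positivity)
      (show 0 < 1 - a / b by rw [sub_pos, div_lt_one hb0]; exact hab) (by ring)
    simp only [smul_eq_mul, one_pow, mul_one] at hs
    have e : a / b * (1 - b) + (1 - a / b) = 1 - a := by field_simp; ring
    rw [e] at hs
    have hb' : (1 - b) ^ k = 1 - 2 * b := by linarith
    rw [hb'] at hs
    have e2 : a / b * (1 - 2 * b) + (1 - a / b) = 1 - 2 * a := by field_simp; ring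
    rw [e2] at hs
    linarith
  obtain ⟨q, hq⟩ := hex
  refine ⟨q, hq, fun r hr => ?_⟩
  exact le_antisymm (not_lt.1 (key q r hq hr)) (not_lt.1 (key r q hr hq))

/-- The distribution `μ̄`: the product measure with parameter `q` given that not all entries
are `-1`. -/
noncomputable def muBar (k : ℕ) (q : ℝ) (σ : ClausePattern k) : ℝ :=
  (q * (1 - q)) ^ ((k : ℝ) / 2) / (1 - (1 - q) ^ k) *
    (q / (1 - q)) ^ ((1 / 2 : ℝ) * (entrySum σ.1 : ℝ))

/-- The set `M_ω(d, k, n)`: the elements of `M(d, k, n)` at Euclidean distance at most `ω / √m`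
from `μ̄`. -/
def nearMarginals (k m : ℕ) (q ω : ℝ) : Set (ClausePattern k → ℝ) :=
  {μ | IsClauseMarginal m μ ∧ √(∑ σ, (μ σ - muBar k q σ) ^ 2) ≤ ω / √(m : ℝ)}

/-- Sign patterns. The pattern `s = ⟨r, s⟩` belongs to cycles through `l = r + 1 ≥ 1` clauses; the
entry `s h` (with `h = 0, …, l - 1`) is the pair `(s_{2(h+1)}, s_{2(h+1)+1})` of the
sequence `(s_2, s_3, …, s_{2l+1})` of `2l` signs. -/
abbrev SignPattern : Type := Σ r : ℕ, (Fin (r + 1) → ℤˣ × ℤˣ)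

/-- The half-length `l` of the sign pattern. -/
def SignPattern.half (s : SignPattern) : ℕ := s.1 + 1

/-- The family of slots `((i_2, j_2), (i_3, j_3)), …, ((i_{2l}, j_{2l}), (i_{2l+1}, j_{2l+1}))`, where
`p h = ((i_{2(h+1)}, j_{2(h+1)}), (i_{2(h+1)+1}, j_{2(h+1)+1}))`, is a cycle with sign pattern `s`.
Below, `h + 1` is taken modulo `l`. -/
structure IsCycle {n m d k : ℕ} (Φ : Formula n m d k) (s : SignPattern)
    (p : Fin (s.1 + 1) → (Fin m × Fin k) × (Fin m × Fin k)) : Prop where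
  /-- the cycle starts at its clause of smallest index -/
  start_min : ∀ h, (p 0).1.1 ≤ (p h).1.1
  /-- the clauses `i_2, i_4, …, i_{2l}` are distinct -/
  clause_inj : Function.Injective fun h => (p h).1.1
  /-- `i_{t+1} = i_t` for odd `t`, and `i_{2l+1} = i_2` -/
  same_clause : ∀ h, (p (h + 1)).1.1 = (p h).2.1
  /-- `∂(i_t, j_t) = ∂(i_{t+1}, j_{t+1})` for even `t` -/
  same_var : ∀ h, Φ.var (p h).1 = Φ.var (p h).2
  /-- the variables `∂(i_2, j_2), ∂(i_4, j_4), …, ∂(i_{2l}, j_{2l})` are distinct -/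
  var_inj : Function.Injective fun h => Φ.var (p h).1
  /-- `j_2 < j_{2l+1}` -/
  orient : (p 0).1.2 < (p (Fin.last s.1)).2.2
  /-- the signs along the cycle are as prescribed -/
  signs : ∀ h, (Φ.sgn (p h).1, Φ.sgn (p h).2) = s.2 h

/-- The number `C_s` of cycles with sign pattern `s`. -/
noncomputable def cycleCount {n m d k : ℕ} (s : SignPattern) (Φ : Formula n m d k) : ℕ :=
  open Classical in
  (Finset.univ.filter fun p : Fin (s.1 + 1) → (Fin m × Fin k) × (Fin m × Fin k) =>
    IsCycle Φ s p).card

/-- `λ_s = (1 / 2l) ((k - 1) / 2) ^ l (d - 1) ^ a d ^ (l - a)`, where `a` is the number of pairs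
`s_{2i}, s_{2i+1}` of equal signs. For `d ≥ 2` this is the formula of `lam_eq`, which is not defined
for `d = 1`. -/
noncomputable def lam (k d : ℕ) (s : SignPattern) : ℝ :=
  1 / (2 * (s.half : ℝ)) * (((k : ℝ) - 1) / 2) ^ s.half *
    ∏ h, if (s.2 h).1 * (s.2 h).2 = 1 then (d : ℝ) - 1 else (d : ℝ)

theorem lam_eq (k d : ℕ) (hd : 2 ≤ d) (s : SignPattern) :
    lam k d s = 1 / (2 * (s.half : ℝ)) * (((k : ℝ) - 1) / 2) ^ s.half *
      ((d : ℝ) * ((d : ℝ) - 1)) ^ ((s.half : ℝ) / 2) *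
      (((d : ℝ) - 1) / d) ^
        ((1 / 2 : ℝ) * ∑ h, (((s.2 h).1 * (s.2 h).2 : ℤˣ) : ℤ)) := by
  have hd2 : (2 : ℝ) ≤ d := by exact_mod_cast hd
  have h0 : (0 : ℝ) < d := by linarith
  have h1 : (0 : ℝ) < (d : ℝ) - 1 := by linarith
  have e1 : ((d : ℝ) * ((d : ℝ) - 1)) ^ ((s.half : ℝ) / 2) =
      ∏ _h : Fin (s.1 + 1), ((d : ℝ) * ((d : ℝ) - 1)) ^ (1 / 2 : ℝ) := by
    rw [Finset.prod_const, Finset.card_univ, Fintype.card_fin, ← Real.rpow_natCast,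
      ← Real.rpow_mul (by positivity)]
    congr 1
    simp only [SignPattern.half]
    ring
  have e2 : (((d : ℝ) - 1) / d) ^
        ((1 / 2 : ℝ) * ((∑ h, (((s.2 h).1 * (s.2 h).2 : ℤˣ) : ℤ) : ℤ) : ℝ)) =
      ∏ h, (((d : ℝ) - 1) / d) ^
        ((1 / 2 : ℝ) * ((((s.2 h).1 * (s.2 h).2 : ℤˣ) : ℤ) : ℝ)) := by
    rw [← Real.rpow_sum_of_pos (by positivity), ← Finset.mul_sum]
    push_cast
    rfl
  rw [lam, mul_assoc (1 / (2 * (s.half : ℝ)) * _)]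
  congr 1
  have e2' := e2
  push_cast at e2' ⊢
  rw [e1, e2', ← Finset.prod_mul_distrib]
  refine Finset.prod_congr rfl fun h _ => ?_
  rcases Int.units_eq_one_or ((s.2 h).1 * (s.2 h).2) with hs | hs
  · have hs' : (((s.2 h).1 : ℤ) : ℝ) * (((s.2 h).2 : ℤ) : ℝ) = 1 := by
      rw [← Int.cast_mul, ← Units.val_mul, hs]; simp
    rw [if_pos hs, hs', mul_one, ← Real.mul_rpow (by positivity) (by positivity),
      ← Real.sqrt_eq_rpow, show (d : ℝ) * ((d : ℝ) - 1) * (((d : ℝ) - 1) / d)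
        = ((d : ℝ) - 1) ^ 2 by field_simp, Real.sqrt_sq h1.le]
  · have hs' : (((s.2 h).1 : ℤ) : ℝ) * (((s.2 h).2 : ℤ) : ℝ) = -1 := by
      rw [← Int.cast_mul, ← Units.val_mul, hs]; simp
    have hne : ¬ ((s.2 h).1 * (s.2 h).2 = 1) := by rw [hs]; decide
    rw [if_neg hne, hs', mul_neg, mul_one, Real.rpow_neg (by positivity),
      ← Real.inv_rpow (by positivity), ← Real.mul_rpow (by positivity) (by positivity),
      ← Real.sqrt_eq_rpow, show (d : ℝ) * ((d : ℝ) - 1) * (((d : ℝ) - 1) / d)⁻¹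
        = (d : ℝ) ^ 2 by field_simp, Real.sqrt_sq h0.le]

/-- The matrices `M_1` and `M_{-1}`. -/
noncomputable def transfer (q : ℝ) (e : ℤˣ) : Matrix (Fin 2) (Fin 2) ℝ :=
  if e = 1 then (1 / q) • !![q ^ 2, (1 - q) ^ 2; q ^ 2, q ^ 2]
  else (1 / (1 - q)) • !![(1 - q) ^ 2, (1 - q) ^ 2; q ^ 2, (1 - q) ^ 2]

/-- `δ_s = -1 + tr ∏ M_{s_{2i} s_{2i+1}}`, the product being taken in order. -/
noncomputable def delta (q : ℝ) (s : SignPattern) : ℝ :=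
  -1 + (List.ofFn fun h => transfer q ((s.2 h).1 * (s.2 h).2)).prod.trace

/-- The probability that a Poisson variable with mean `x ≥ 0` equals `c`. -/
noncomputable def poissonProb (x : ℝ) (c : ℕ) : ℝ :=
  (ProbabilityTheory.poissonMeasure x.toNNReal).real {c}

end RegSAT

/-! Weighting the random formula by `Zmu` amounts to planting an assignment. Flipping the signs at
each variable according to τ turns signs into truth values, and it is a permutation of the formulas
because both literals of a variable have d clones. The pairs (Φ, τ) counted by `Zmu` therefore
correspond to pairs (Ψ, τ) in which τ is arbitrary and Ψ is any formula whose table of signs has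
profile μ (`sum_Zmu_mul`). So the quotient of expectations is a probability under which τ and Ψ are
independent and uniform, and the claim is a Poisson limit for cycle counts in this planted model.

The limit comes from factorial moments (`tendsto_prob_of_factorial_moments`). A joint factorial
moment counts families of distinct cycles (`prod_descFactorial_cycleCount`). If two members share a
clause or a variable, the union has more slots than vertices (`card_add_card_le_card_slotSet`),
which costs a factor 1/n (`sum_overlapCount_le`).

For vertex-disjoint families the expectation is computed from symmetry. Given the truth values in
the relevant slots, the clones there are uniform (`card_planted_mem_mul`); the clauses are
exchangeable and their truth value patterns become independent with law μ̄. Under μ̄ two positions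
of a clause carry values y, z with probability q/2 if y = z and (1-q)/2 otherwise
(`sum_muBar_two_marginal`), while passing through a variable multiplies the truth value by the
product of the two signs. Summing over the truth values around a cycle gives the trace of a product
of commuting two-by-two matrices with eigenvalues 1 and ±(2q-1), that is 1 + δ
(`sum_cycle_agreeWeight`, `delta_eq_prod`). The remaining factors combine to λ
(`moment_limit_value`).

The same eigenvalues give |δ| = |2q-1|^l < 1, so the series of λδ² is logarithmic. Its ratio is
(2d-1)(k-1)(2q-1)², and the density bound makes this less than 1 because (2q-1)² = (1-q)^(2k) is
exponentially small (`exists_forall_branching_lt_one`). -/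

namespace RegSAT

open Filter Topology

/-! ### Method of moments for Poisson vectors -/

section PoissonMoments
open scoped Nat

/-- Limits of factorial moments carry over to linear combinations of descending factorials. -/
theorem tendsto_prod_descFactorial_comb {ι κ : Type*} [Fintype κ] [DecidableEq κ] (F : Filter ι)
    (E : ι → ((κ → ℕ) → ℝ) →ₗ[ℝ] ℝ) (lm : κ → ℝ)
    (hmom : ∀ r : κ → ℕ, Tendsto (fun i => E i fun x => ∏ s, ((x s).descFactorial (r s) : ℝ)) F
      (𝓝 (∏ s, lm s ^ r s)))
    (J : Finset ℕ) (a : κ → ℕ → ℝ) (ex : κ → ℕ → ℕ) :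
    Tendsto (fun i => E i fun x => ∏ s, ∑ j ∈ J, a s j * ((x s).descFactorial (ex s j) : ℝ)) F
      (𝓝 (∏ s, ∑ j ∈ J, a s j * lm s ^ ex s j)) := by
  have h1 : (fun x : κ → ℕ => ∏ s, ∑ j ∈ J, a s j * ((x s).descFactorial (ex s j) : ℝ)) =
      ∑ p ∈ Fintype.piFinset fun _ : κ => J, (∏ s, a s (p s)) •
        fun x : κ → ℕ => ∏ s, ((x s).descFactorial (ex s (p s)) : ℝ) := by
    funext x
    rw [Finset.prod_univ_sum, Finset.sum_apply]
    refine Finset.sum_congr rfl fun p _ => ?_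
    simp [Finset.prod_mul_distrib]
  simp_rw [h1, map_sum, map_smul]
  rw [Finset.prod_univ_sum]
  refine tendsto_finsetSum _ fun p _ => ?_
  rw [Finset.prod_mul_distrib]
  exact (hmom fun s => ex s (p s)).const_mul _

/-- Bonferroni inequality for the event `x = c`. -/
theorem abs_indicator_sub_alternating_le (c R x : ℕ) :
    |(if x = c then (1 : ℝ) else 0) - ∑ j ∈ Finset.range (R + 1),
      ((-1) ^ j / ((c ! : ℝ) * j !)) * (x.descFactorial (c + j) : ℝ)| ≤
      1 / ((c ! : ℝ) * (R + 1)!) * (x.descFactorial (c + (R + 1)) : ℝ) := by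
  have hdf : ∀ j, (x.descFactorial (c + j) : ℝ) =
      (c ! : ℝ) * j ! * (x.choose c * (x - c).choose j) := by
    intro j
    have : x.descFactorial (c + j) = c ! * x.choose c * (j ! * (x - c).choose j) := by
      rw [← Nat.descFactorial_eq_factorial_mul_choose, ← Nat.descFactorial_eq_factorial_mul_choose,
        mul_comm, ← Nat.descFactorial_mul_descFactorial (Nat.le_add_right c j),
        Nat.add_sub_cancel_left]
    rw [this]; push_cast; ring
  have hf : ∀ j : ℕ, (j ! : ℝ) ≠ 0 := fun j => by positivity
  have h2 : ∀ j, ((-1 : ℝ) ^ j / ((c ! : ℝ) * j !)) * (x.descFactorial (c + j) : ℝ) =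
      x.choose c * ((-1) ^ j * (x - c).choose j) := by
    intro j
    rw [hdf]
    have := hf c
    have := hf j
    field_simp
  simp_rw [h2]
  rw [hdf, ← Finset.mul_sum]
  have h3 : 1 / ((c ! : ℝ) * (R + 1)!) * ((c ! : ℝ) * (R + 1)! *
      (x.choose c * (x - c).choose (R + 1))) = x.choose c * (x - c).choose (R + 1) := by
    have := hf c
    have := hf (R + 1)
    field_simp
  rw [h3]
  rcases lt_trichotomy x c with h | rfl | h
  · rw [if_neg h.ne, Nat.choose_eq_zero_of_lt h]; simp
  · rw [Finset.sum_range_succ']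
    simp
  · rw [if_neg h.ne']
    obtain ⟨y, hy⟩ : ∃ y, x - c = y + 1 := ⟨x - c - 1, by omega⟩
    rw [hy]
    have h4 := Int.alternating_sum_range_choose_eq_choose (n := y) (m := R)
    have h5 : ∑ j ∈ Finset.range (R + 1), ((-1 : ℝ) ^ j * ((y + 1).choose j : ℝ)) =
        (-1) ^ R * (y.choose R : ℝ) := by exact_mod_cast h4
    rw [h5, zero_sub, abs_neg, abs_mul, abs_mul, abs_pow, abs_neg, abs_one, one_pow, one_mul,
      Nat.abs_cast, Nat.abs_cast, Nat.choose_succ_succ]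
    push_cast
    gcongr
    exact le_add_of_nonneg_right (by positivity)

/-- Exchanging the factors one at a time. The form of the bound matters: with the Bonferroni errors
as `e`, its right-hand side is again a polynomial in descending factorials, so its expectation is
controlled by the moments. -/
theorem abs_prod_sub_prod_le {κ : Type*} (s : Finset κ) (a b e : κ → ℝ)
    (ha : ∀ i, |a i| ≤ 1) (hab : ∀ i, |a i - b i| ≤ e i) :
    |∏ i ∈ s, a i - ∏ i ∈ s, b i| ≤ ∏ i ∈ s, (1 + e i) - 1 := by
  classical
  have he : ∀ i, 0 ≤ e i := fun i => (abs_nonneg _).trans (hab i)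
  have hb : ∀ i, |b i| ≤ 1 + e i := fun i => by
    have := abs_sub_abs_le_abs_sub (b i) (a i)
    rw [abs_sub_comm] at this
    linarith [hab i, ha i]
  induction s using Finset.induction_on with
  | empty => simp
  | insert i s hi ih =>
    rw [Finset.prod_insert hi, Finset.prod_insert hi, Finset.prod_insert hi]
    have hB : |∏ j ∈ s, b j| ≤ ∏ j ∈ s, (1 + e j) := by
      rw [Finset.abs_prod]
      exact Finset.prod_le_prod (fun _ _ => abs_nonneg _) fun j _ => hb j
    have e1 : a i * ∏ j ∈ s, a j - b i * ∏ j ∈ s, b j =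
        a i * (∏ j ∈ s, a j - ∏ j ∈ s, b j) + (a i - b i) * ∏ j ∈ s, b j := by ring
    rw [e1]
    refine (abs_add_le _ _).trans ?_
    rw [abs_mul, abs_mul]
    have h1 : |a i| * |∏ j ∈ s, a j - ∏ j ∈ s, b j| ≤ 1 * (∏ j ∈ s, (1 + e j) - 1) :=
      mul_le_mul (ha i) ih (abs_nonneg _) zero_le_one
    have h2 : |a i - b i| * |∏ j ∈ s, b j| ≤ e i * ∏ j ∈ s, (1 + e j) :=
      mul_le_mul (hab i) hB (abs_nonneg _) (he i)
    linarith

theorem poissonProb_eq {x : ℝ} (hx : 0 ≤ x) (c : ℕ) :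
    poissonProb x c = Real.exp (-x) * x ^ c / c ! := by
  rw [poissonProb, ProbabilityTheory.poissonMeasure_real_singleton, Real.coe_toNNReal x hx]

/-- The method of moments for a vector of asymptotically independent Poisson variables. -/
theorem tendsto_prob_of_factorial_moments {ι κ : Type*} [Fintype κ] [DecidableEq κ] (F : Filter ι)
    (E : ι → ((κ → ℕ) → ℝ) →ₗ[ℝ] ℝ) (lm : κ → ℝ) (hlm : ∀ s, 0 ≤ lm s)
    (hmono : ∀ i f g, f ≤ g → E i f ≤ E i g)
    (hmom : ∀ r : κ → ℕ, Tendsto (fun i => E i fun x => ∏ s, ((x s).descFactorial (r s) : ℝ)) F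
      (𝓝 (∏ s, lm s ^ r s))) (c : κ → ℕ) :
    Tendsto (fun i => E i fun x => ∏ s, if x s = c s then (1 : ℝ) else 0) F
      (𝓝 (∏ s, poissonProb (lm s) (c s))) := by
  set T : ℕ → (κ → ℕ) → ℝ := fun R x => ∏ s, ∑ j ∈ Finset.range (R + 1),
    ((-1) ^ j / (((c s)! : ℝ) * j !)) * ((x s).descFactorial (c s + j) : ℝ) with hT
  -- This is ∏ (1 + Bonferroni error), with each factor written as a sum of two terms so that
  -- `tendsto_prod_descFactorial_comb` applies: `j = 0` gives 1 as a descending factorial of order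
  -- 0, `j = 1` gives the error.
  set G : ℕ → (κ → ℕ) → ℝ := fun R x => ∏ s, ∑ j ∈ Finset.range 2,
    (if j = 0 then 1 else 1 / (((c s)! : ℝ) * (R + 1)!)) *
      ((x s).descFactorial (if j = 0 then 0 else c s + (R + 1)) : ℝ) with hG
  have hTl := fun R => tendsto_prod_descFactorial_comb F E lm hmom (Finset.range (R + 1))
    (fun s j => (-1) ^ j / (((c s)! : ℝ) * j !)) (fun s j => c s + j)
  have hGl := fun R => tendsto_prod_descFactorial_comb F E lm hmom (Finset.range 2)
    (fun s j => if j = 0 then 1 else 1 / (((c s)! : ℝ) * (R + 1)!))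
    (fun s j => if j = 0 then 0 else c s + (R + 1))
  -- The functionals need not have total mass 1; the zeroth moment says that the mass tends to 1.
  have h1l := hmom 0
  have hbd : ∀ R x, |(∏ s, if x s = c s then (1 : ℝ) else 0) - T R x| ≤
      G R x - ∏ s, ((x s).descFactorial ((0 : κ → ℕ) s) : ℝ) := by
    intro R x
    have := abs_prod_sub_prod_le Finset.univ (fun s => if x s = c s then (1 : ℝ) else 0) _ _
      (fun s => by split_ifs <;> simp)
      (fun s => abs_indicator_sub_alternating_le (c s) R (x s))
    simpa [hG, hT, Finset.sum_range_succ] using this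
  have hEbd : ∀ R i, |E i (fun x => ∏ s, if x s = c s then (1 : ℝ) else 0) - E i (T R)| ≤
      E i (G R) - E i fun x => ∏ s, ((x s).descFactorial ((0 : κ → ℕ) s) : ℝ) := by
    intro R i
    rw [← map_sub, ← map_sub, abs_le]
    constructor
    · rw [← map_neg]
      exact hmono _ _ _ fun x => (abs_le.1 (hbd R x)).1
    · exact hmono _ _ _ fun x => (abs_le.1 (hbd R x)).2
  have hTlim : Tendsto (fun R => ∏ s, ∑ j ∈ Finset.range (R + 1),
      ((-1) ^ j / (((c s)! : ℝ) * j !)) * lm s ^ (c s + j)) atTop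
      (𝓝 (∏ s, poissonProb (lm s) (c s))) := by
    refine tendsto_finsetProd _ fun s _ => ?_
    have h : Tendsto (fun R => ∑ j ∈ Finset.range (R + 1), (-lm s) ^ j / (j ! : ℝ)) atTop
        (𝓝 (Real.exp (-lm s))) := by
      have := (NormedSpace.expSeries_div_hasSum_exp (-lm s)).tendsto_sum_nat
      rw [← Real.exp_eq_exp_ℝ] at this
      exact this.comp (tendsto_add_atTop_nat 1)
    have h2 := h.const_mul (lm s ^ c s / (c s)!)
    rw [poissonProb_eq (hlm s)]
    convert h2 using 2
    · rw [Finset.mul_sum]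
      refine Finset.sum_congr rfl fun j _ => ?_
      rw [pow_add, neg_pow (lm s)]
      field_simp
    · ring
  have hGlim : Tendsto (fun R => ∏ s, ∑ j ∈ Finset.range 2,
      (if j = 0 then 1 else 1 / (((c s)! : ℝ) * (R + 1)!)) *
        lm s ^ (if j = 0 then 0 else c s + (R + 1))) atTop (𝓝 1) := by
    have : ∀ s ∈ (Finset.univ : Finset κ), Tendsto (fun R : ℕ => ∑ j ∈ Finset.range 2,
      (if j = 0 then 1 else 1 / (((c s)! : ℝ) * (R + 1)!)) *
        lm s ^ (if j = 0 then 0 else c s + (R + 1))) atTop (𝓝 1) := by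
      intro s _
      have h := ((FloorSemiring.tendsto_pow_div_factorial_atTop (lm s)).comp
        (tendsto_add_atTop_nat 1)).const_mul (lm s ^ c s / (c s)!)
      have h2 := h.const_add 1
      rw [mul_zero, add_zero] at h2
      refine h2.congr fun R => ?_
      simp only [Function.comp, Finset.sum_range_succ, Finset.sum_range_zero, zero_add, if_true,
        pow_zero, mul_one, one_ne_zero, if_false]
      rw [pow_add]
      field_simp
      ring
    simpa using tendsto_finsetProd _ this
  rw [Metric.tendsto_nhds]
  intro ε hε
  -- The truncation level is fixed first, using only the limiting moments; the index `i` moves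
  -- afterwards.
  obtain ⟨R, hR1, hR2⟩ := ((Metric.tendsto_nhds.1 hTlim (ε / 4) (by positivity)).and
    (Metric.tendsto_nhds.1 hGlim (ε / 4) (by positivity))).exists
  filter_upwards [Metric.tendsto_nhds.1 (hTl R) (ε / 4) (by positivity),
    Metric.tendsto_nhds.1 ((hGl R).sub h1l) (ε / 4) (by positivity)] with i hi1 hi2
  rw [Real.dist_eq] at *
  have h1 := hEbd R i
  simp only [Pi.zero_apply, pow_zero, Finset.prod_const_one] at hi2
  simp only [Pi.zero_apply] at h1
  have h2 := abs_lt.1 hi2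
  have h3 := abs_lt.1 hR2
  have h4 : |E i (fun x => ∏ s, if x s = c s then (1 : ℝ) else 0) - E i (T R)| < ε / 2 := by
    refine lt_of_le_of_lt h1 ?_
    simp only [hG]
    linarith [h2.2, h3.2]
  have h4 := abs_lt.1 h4
  have h5 := abs_lt.1 hi1
  have h6 := abs_lt.1 hR1
  simp only [hT] at h4
  rw [abs_lt]
  constructor <;> linarith [h4.1, h4.2, h5.1, h5.2, h6.1, h6.2]

end PoissonMoments

/-! ### The parameters q, δ, λ and the logarithmic series -/

section Parameters

theorem IsMarginalParam.one_sub_pow {k : ℕ} {q : ℝ} (h : IsMarginalParam k q) :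
    (1 - q) ^ k = 1 - 2 * q := by linarith [h.2.2]

theorem IsMarginalParam.abs_lt_one {k : ℕ} {q : ℝ} (h : IsMarginalParam k q) :
    |2 * q - 1| < 1 := by
  rw [abs_lt]; constructor <;> linarith [h.1, h.2.1]

theorem abs_units_cast (e : ℤˣ) : |((e : ℤ) : ℝ)| = 1 := by
  rcases Int.units_eq_one_or e with rfl | rfl <;> simp

/-- The matrices `transfer q e` have common eigenvectors, with eigenvalues 1 and e(2q-1), so a
product of them depends only on the product of the second eigenvalues. -/
theorem prod_map_transfer {q : ℝ} (h0 : q ≠ 0) (h1 : 1 - q ≠ 0) (L : List ℤˣ) :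
    (L.map (transfer q)).prod =
      !![(1 + (L.map fun e : ℤˣ => ((e : ℤ) : ℝ) * (2 * q - 1)).prod) / 2,
          (1 - (L.map fun e : ℤˣ => ((e : ℤ) : ℝ) * (2 * q - 1)).prod) / 2 * ((1 - q) / q);
         (1 - (L.map fun e : ℤˣ => ((e : ℤ) : ℝ) * (2 * q - 1)).prod) / 2 * (q / (1 - q)),
          (1 + (L.map fun e : ℤˣ => ((e : ℤ) : ℝ) * (2 * q - 1)).prod) / 2] := by
  induction L with
  | nil => ext i j; fin_cases i <;> fin_cases j <;> simp
  | cons e L ih =>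
    rw [List.map_cons, List.prod_cons, ih, List.map_cons, List.prod_cons]
    set P := (L.map fun e : ℤˣ => ((e : ℤ) : ℝ) * (2 * q - 1)).prod
    rcases Int.units_eq_one_or e with rfl | rfl
    · ext i j
      fin_cases i <;> fin_cases j <;>
        simp [transfer, Matrix.mul_apply, Fin.sum_univ_two] <;> field_simp <;> ring
    · ext i j
      fin_cases i <;> fin_cases j <;>
        simp [transfer, Matrix.mul_apply, Fin.sum_univ_two] <;> field_simp <;> ring

theorem delta_eq_prod {k : ℕ} {q : ℝ} (h : IsMarginalParam k q) (s : SignPattern) :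
    delta q s = ∏ i, ((((s.2 i).1 * (s.2 i).2 : ℤˣ) : ℤ) : ℝ) * (2 * q - 1) := by
  have h0 : q ≠ 0 := h.1.ne'
  have h1 : 1 - q ≠ 0 := by linarith [h.2.1]
  have e1 : (List.ofFn fun i => transfer q ((s.2 i).1 * (s.2 i).2)) =
      (List.ofFn fun i => (s.2 i).1 * (s.2 i).2).map (transfer q) := by
    rw [List.map_ofFn]; rfl
  rw [delta, e1, prod_map_transfer h0 h1, List.map_ofFn, List.prod_ofFn, Matrix.trace_fin_two]
  simp only [Function.comp_def, Matrix.of_apply, Matrix.cons_val', Matrix.cons_val_zero,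
    Matrix.cons_val_one, Matrix.cons_val_fin_one]
  ring

theorem abs_delta {k : ℕ} {q : ℝ} (h : IsMarginalParam k q) (s : SignPattern) :
    |delta q s| = |2 * q - 1| ^ s.half := by
  rw [delta_eq_prod h, Finset.abs_prod]
  simp only [abs_mul, abs_units_cast, one_mul, Finset.prod_const, Finset.card_univ,
    Fintype.card_fin, SignPattern.half]

theorem neg_one_lt_delta {k : ℕ} {q : ℝ} (h : IsMarginalParam k q) (s : SignPattern) :
    -1 < delta q s := by
  have := abs_delta h s
  have h2 : |2 * q - 1| ^ s.half < 1 :=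
    pow_lt_one₀ (abs_nonneg _) h.abs_lt_one (Nat.succ_ne_zero _)
  rw [← this] at h2
  exact (abs_lt.1 h2).1

/-- By `abs_delta` the factor δ² is the same for all patterns of a given length, and the sum of λ
over these patterns factorises over the variables: each of the four sign pairs contributes d-1 or d,
in total 2(2d-1). -/
theorem sum_lam_mul_delta_sq {k : ℕ} {q : ℝ} (h : IsMarginalParam k q) (d r : ℕ) :
    ∑ s : Fin (r + 1) → ℤˣ × ℤˣ, lam k d ⟨r, s⟩ * delta q ⟨r, s⟩ ^ 2 =
      1 / 2 * (((2 * (d : ℝ) - 1) * ((k : ℝ) - 1) * (1 - 4 * q * (1 - q))) ^ (r + 1) /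
        ((r : ℝ) + 1)) := by
  have h1 : ∀ s : Fin (r + 1) → ℤˣ × ℤˣ, delta q ⟨r, s⟩ ^ 2 =
      (1 - 4 * q * (1 - q)) ^ (r + 1) := by
    intro s
    rw [← sq_abs, abs_delta h, ← pow_mul, mul_comm _ 2, pow_mul, sq_abs, SignPattern.half]
    congr 1
    ring
  simp_rw [h1, lam]
  simp only [SignPattern.half]
  rw [← Finset.sum_mul, ← Finset.mul_sum, ← Fintype.piFinset_univ,
    ← Finset.prod_univ_sum (fun _ : Fin (r + 1) => (Finset.univ : Finset (ℤˣ × ℤˣ)))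
      fun _ z => if z.1 * z.2 = 1 then (d : ℝ) - 1 else (d : ℝ)]
  have h2 : ∑ z : ℤˣ × ℤˣ, (if z.1 * z.2 = 1 then (d : ℝ) - 1 else (d : ℝ)) =
      2 * (2 * (d : ℝ) - 1) := by
    have : (Finset.univ : Finset (ℤˣ × ℤˣ)) = {(1, 1), (1, -1), (-1, 1), (-1, -1)} := by decide
    rw [this]
    rw [Finset.sum_insert (by decide), Finset.sum_insert (by decide),
      Finset.sum_insert (by decide), Finset.sum_singleton]
    simp
    ring
  rw [h2, Finset.prod_const, Finset.card_univ, Fintype.card_fin]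
  push_cast
  rw [mul_pow, mul_pow, mul_pow, div_pow]
  have : (r : ℝ) + 1 ≠ 0 := by positivity
  field_simp

theorem hasSum_lam_mul_delta_sq {k : ℕ} {q : ℝ} (h : IsMarginalParam k q) (d : ℕ)
    (hx : |(2 * (d : ℝ) - 1) * ((k : ℝ) - 1) * (1 - 4 * q * (1 - q))| < 1) :
    HasSum
      (fun r : ℕ => ∑ s : Fin (r + 1) → ℤˣ × ℤˣ, lam k d ⟨r, s⟩ * delta q ⟨r, s⟩ ^ 2)
      (-(1 / 2) * Real.log (1 - (2 * (d : ℝ) - 1) * ((k : ℝ) - 1) * (1 - 4 * q * (1 - q)))) := by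
  simp_rw [sum_lam_mul_delta_sq h]
  have := (Real.hasSum_pow_div_log_of_abs_lt_one hx).mul_left (1 / 2)
  rw [neg_mul, ← mul_neg]
  exact this

theorem IsMarginalParam.two_fifths_lt {k : ℕ} {q : ℝ} (h : IsMarginalParam k q) (hk : 4 ≤ k) :
    2 / 5 < q := by
  by_contra hq
  push Not at hq
  have h6 : (3 / 5 : ℝ) ^ k < 1 / 5 := by
    calc (3 / 5 : ℝ) ^ k ≤ (3 / 5) ^ 4 := pow_le_pow_of_le_one (by norm_num) (by norm_num) hk
      _ < 1 / 5 := by norm_num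
  -- If q ≤ 2/5, then 1-q lies between 3/5 and 1. The chord bound and (3/5)^k < 1/5 give (1-q)^k <
  -- 1-2q, against the equation for q.
  have hc := (convexOn_pow (𝕜 := ℝ) k).2 (show (3 / 5 : ℝ) ∈ Set.Ici 0 by simp; norm_num)
    (show (1 : ℝ) ∈ Set.Ici 0 by simp) (show 0 ≤ 5 / 2 * q by linarith [h.1])
    (show 0 ≤ 1 - 5 / 2 * q by linarith) (by ring)
  simp only [smul_eq_mul, one_pow, mul_one] at hc
  have e : 5 / 2 * q * (3 / 5) + (1 - 5 / 2 * q) = 1 - q := by ring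
  rw [e, h.one_sub_pow] at hc
  nlinarith [h.1]

/-- The density bound gives 2d ≤ k 2^k, and q > 2/5 gives (1-2q)² = (1-q)^(2k) ≤ (9/25)^k. The
product is at most k²(18/25)^k, which tends to 0. -/
theorem exists_forall_branching_lt_one : ∃ k₀ : ℕ, 4 ≤ k₀ ∧ ∀ k : ℕ, k₀ ≤ k → ∀ d : ℕ, 0 < d →
    2 * (d : ℝ) / k ≤ 2 ^ k * Real.log 2 - k * Real.log 2 / 2 - 4 →
    ∀ q : ℝ, IsMarginalParam k q →
      |(2 * (d : ℝ) - 1) * ((k : ℝ) - 1) * (1 - 4 * q * (1 - q))| < 1 := by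
  have h := tendsto_pow_const_mul_const_pow_of_abs_lt_one 2 (r := 18 / 25)
    (by rw [abs_lt]; constructor <;> norm_num)
  obtain ⟨N, hN⟩ := eventually_atTop.1 (h.eventually (gt_mem_nhds one_pos))
  refine ⟨max N 4, le_max_right _ _, fun k hk d hd hdk q hq => ?_⟩
  have hk4 : 4 ≤ k := (le_max_right _ _).trans hk
  have hlt := hN k ((le_max_left _ _).trans hk)
  have hk0 : (4 : ℝ) ≤ k := by exact_mod_cast hk4
  have hd0 : (1 : ℝ) ≤ d := by exact_mod_cast hd
  have hlog : Real.log 2 ≤ 1 := by linarith [Real.log_two_lt_d9]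
  have hlog0 : 0 ≤ Real.log 2 := Real.log_nonneg (by norm_num)
  have h2k : (0 : ℝ) < 2 ^ k := by positivity
  have hd2 : 2 * (d : ℝ) ≤ 2 ^ k * k := by
    rw [div_le_iff₀ (by linarith)] at hdk
    refine hdk.trans ?_
    refine mul_le_mul_of_nonneg_right ?_ (by linarith)
    nlinarith
  have h25 := hq.two_fifths_lt hk4
  have hx : 1 - 4 * q * (1 - q) = ((1 - q) ^ 2) ^ k := by
    rw [← pow_mul, mul_comm 2, pow_mul, hq.one_sub_pow]; ring
  have hx0 : (0 : ℝ) ≤ ((1 - q) ^ 2) ^ k := by positivity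
  have hx1 : ((1 - q) ^ 2) ^ k ≤ (9 / 25 : ℝ) ^ k := by
    refine pow_le_pow_left₀ (by positivity) ?_ k
    nlinarith [hq.2.1]
  rw [hx, abs_of_nonneg (by
    refine mul_nonneg (mul_nonneg ?_ ?_) hx0 <;> linarith)]
  calc (2 * (d : ℝ) - 1) * ((k : ℝ) - 1) * ((1 - q) ^ 2) ^ k
      ≤ (2 ^ k * k) * k * (9 / 25) ^ k := by
        refine mul_le_mul (mul_le_mul (by linarith) (by linarith) (by linarith) (by positivity))
          hx1 hx0 (by positivity)
    _ = (k : ℝ) ^ 2 * (18 / 25) ^ k := by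
        rw [show (18 / 25 : ℝ) = 2 * (9 / 25) by norm_num, mul_pow]; ring
    _ < 1 := hlt

end Parameters

/-! ### Sums of transition weights along paths and cycles -/

section CyclicSum

/-- The transition weight: `q` for equal truth values, `1 - q` for different ones. -/
noncomputable def agreeWeight (q : ℝ) (y z : ℤˣ) : ℝ := if y = z then q else 1 - q

theorem sum_units {M : Type*} [AddCommMonoid M] (f : ℤˣ → M) : ∑ e, f e = f 1 + f (-1) := by
  have : (Finset.univ : Finset ℤˣ) = {1, -1} := by decide
  rw [this, Finset.sum_pair (by decide)]

/-- A two-state chain whose steps are symmetric stochastic matrices with second eigenvalue e(2q-1):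
with both end values fixed, the path weight is (1 + P y z)/2, where P is the product of the second
eigenvalues. The arbitrary function `f` of the end values makes the induction go through and later
closes the path to a cycle. -/
theorem sum_path_agreeWeight (q : ℝ) : ∀ (r : ℕ) (e : Fin r → ℤˣ) (f : ℤˣ → ℤˣ → ℝ),
    ∑ x : Fin (r + 1) → ℤˣ,
        (∏ h : Fin r, agreeWeight q (x h.succ) (x h.castSucc * e h)) * f (x 0) (x (Fin.last r)) =
      ∑ y : ℤˣ, ∑ z : ℤˣ, (1 + (∏ h, ((e h : ℤ) : ℝ) * (2 * q - 1)) * ((y : ℤ) : ℝ) * ((z : ℤ) : ℝ)) / 2 *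
        f y z := by
  intro r
  induction r with
  | zero =>
    intro e f
    rw [← (Equiv.funUnique (Fin 1) ℤˣ).symm.sum_comp]
    simp
  | succ r ih =>
    intro e f
    rw [← (Fin.consEquiv fun _ : Fin (r + 2) => ℤˣ).sum_comp, Fintype.sum_prod_type]
    have key : ∀ y : ℤˣ, ∑ x : Fin (r + 1) → ℤˣ,
        (∏ h : Fin (r + 1), agreeWeight q ((Fin.consEquiv fun _ : Fin (r + 2) => ℤˣ) (y, x) h.succ)
          ((Fin.consEquiv fun _ : Fin (r + 2) => ℤˣ) (y, x) h.castSucc * e h)) *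
          f ((Fin.consEquiv fun _ : Fin (r + 2) => ℤˣ) (y, x) 0)
            ((Fin.consEquiv fun _ : Fin (r + 2) => ℤˣ) (y, x) (Fin.last (r + 1))) =
        ∑ x : Fin (r + 1) → ℤˣ, (∏ h : Fin r, agreeWeight q (x h.succ)
          (x h.castSucc * e h.succ)) *
          (fun a b => agreeWeight q a (y * e 0) * f y b) (x 0) (x (Fin.last r)) := by
      intro y
      refine Finset.sum_congr rfl fun x _ => ?_
      rw [Fin.prod_univ_succ]
      have e1 : (Fin.consEquiv fun _ : Fin (r + 2) => ℤˣ) (y, x) (Fin.last (r + 1)) =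
          x (Fin.last r) := by rw [← Fin.succ_last]; rfl
      have e2 : ∀ h : Fin r, (Fin.consEquiv fun _ : Fin (r + 2) => ℤˣ) (y, x) h.succ.castSucc =
          x h.castSucc := fun h => by rw [← Fin.succ_castSucc]; rfl
      simp only [e1, e2]
      simp only [Fin.consEquiv_apply, Fin.cons_succ, Fin.cons_zero, Fin.castSucc_zero]
      ring
    rw [Finset.sum_congr rfl fun y _ => (key y).trans (ih (fun h => e h.succ)
      fun a b => agreeWeight q a (y * e 0) * f y b)]
    rw [Fin.prod_univ_succ]
    set P := ∏ h : Fin r, ((e h.succ : ℤ) : ℝ) * (2 * q - 1)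
    simp only [sum_units, agreeWeight]
    rcases Int.units_eq_one_or (e 0) with h | h <;> rw [h] <;> simp <;> ring

theorem sum_cycle_agreeWeight (q : ℝ) (r : ℕ) (e : Fin (r + 1) → ℤˣ) :
    ∑ x : Fin (r + 1) → ℤˣ, ∏ h, agreeWeight q (x (h + 1)) (x h * e h) =
      1 + ∏ h, ((e h : ℤ) : ℝ) * (2 * q - 1) := by
  have := sum_path_agreeWeight q r (fun h => e h.castSucc)
    (fun a b => agreeWeight q a (b * e (Fin.last r)))
  rw [Fin.prod_univ_castSucc]
  simp_rw [Fin.prod_univ_castSucc, Fin.coeSucc_eq_succ, Fin.last_add_one]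
  rw [this]
  set P := ∏ h : Fin r, ((e h.castSucc : ℤ) : ℝ) * (2 * q - 1)
  simp only [sum_units, agreeWeight]
  rcases Int.units_eq_one_or (e (Fin.last r)) with h | h <;> rw [h] <;> simp <;> ring

end CyclicSum

/-! ### Two-point marginals of μ̄ -/

section Marginals

theorem muBar_eq_prod {k : ℕ} {q : ℝ} (h : IsMarginalParam k q) (σ : ClausePattern k) :
    muBar k q σ = (∏ j, if σ.1 j = 1 then q else 1 - q) / (2 * q) := by
  have h0 := h.1
  have h1 : 0 < 1 - q := by linarith [h.2.1]
  have e1 : (q * (1 - q)) ^ ((k : ℝ) / 2) = ∏ _j : Fin k, (q * (1 - q)) ^ (1 / 2 : ℝ) := by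
    rw [Finset.prod_const, Finset.card_univ, Fintype.card_fin, ← Real.rpow_natCast,
      ← Real.rpow_mul (by positivity)]
    congr 1
    ring
  have e2 : (q / (1 - q)) ^ ((1 / 2 : ℝ) * (entrySum σ.1 : ℝ)) =
      ∏ j, (q / (1 - q)) ^ ((1 / 2 : ℝ) * ((σ.1 j : ℤ) : ℝ)) := by
    rw [← Real.rpow_sum_of_pos (by positivity), ← Finset.mul_sum, entrySum]
    push_cast
    rfl
  rw [muBar, e1, e2, h.one_sub_pow, div_mul_eq_mul_div, ← Finset.prod_mul_distrib]
  congr 1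
  · refine Finset.prod_congr rfl fun j _ => ?_
    rcases Int.units_eq_one_or (σ.1 j) with hs | hs <;> rw [hs]
    · rw [if_pos rfl]
      simp only [Units.val_one, Int.cast_one, mul_one]
      rw [← Real.mul_rpow (by positivity) (by positivity), ← Real.sqrt_eq_rpow,
        show q * (1 - q) * (q / (1 - q)) = q ^ 2 by field_simp, Real.sqrt_sq h0.le]
    · rw [if_neg (by decide)]
      simp only [Units.val_neg, Units.val_one, Int.cast_neg, Int.cast_one, mul_neg, mul_one]
      rw [Real.rpow_neg (by positivity), ← Real.inv_rpow (by positivity),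
        ← Real.mul_rpow (by positivity) (by positivity), ← Real.sqrt_eq_rpow,
        show q * (1 - q) * (q / (1 - q))⁻¹ = (1 - q) ^ 2 by field_simp, Real.sqrt_sq h1.le]
  · ring

theorem sum_prod_two_marginal {k : ℕ} (q : ℝ) {i j : Fin k} (hij : i ≠ j) (y z : ℤˣ) :
    ∑ σ : Fin k → ℤˣ, (if σ i = y ∧ σ j = z then ∏ l, (if σ l = 1 then q else 1 - q) else 0) =
      (if y = 1 then q else 1 - q) * (if z = 1 then q else 1 - q) := by
  have h1 : ∀ σ : Fin k → ℤˣ,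
      (if σ i = y ∧ σ j = z then ∏ l, (if σ l = 1 then q else 1 - q) else 0) =
      ∏ l, if (l = i → σ l = y) ∧ (l = j → σ l = z) then (if σ l = 1 then q else 1 - q)
        else 0 := by
    intro σ
    split_ifs with h
    · refine Finset.prod_congr rfl fun l _ => ?_
      refine (if_pos ?_).symm
      exact ⟨fun hl => by rw [hl, h.1], fun hl => by rw [hl, h.2]⟩
    · by_cases hi : σ i = y
      · refine (Finset.prod_eq_zero (Finset.mem_univ j) ?_).symm
        rw [if_neg]
        exact fun h' => h ⟨hi, h'.2 rfl⟩
      · refine (Finset.prod_eq_zero (Finset.mem_univ i) ?_).symm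
        rw [if_neg]
        exact fun h' => hi (h'.1 rfl)
  simp_rw [h1]
  rw [← Fintype.piFinset_univ,
    ← Finset.prod_univ_sum (fun _ : Fin k => (Finset.univ : Finset ℤˣ))
      fun l s => if (l = i → s = y) ∧ (l = j → s = z) then (if s = 1 then q else 1 - q) else 0]
  have h2 : ∀ l : Fin k, (∑ s : ℤˣ,
      if (l = i → s = y) ∧ (l = j → s = z) then (if s = 1 then q else 1 - q) else 0) =
      (if l = i then (if y = 1 then q else 1 - q) else 1) *
        (if l = j then (if z = 1 then q else 1 - q) else 1) := by
    intro l
    by_cases hi : l = i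
    · subst hi
      simp only [hij, forall_const, false_implies, and_true, if_true, if_false, mul_one,
        Finset.sum_ite_eq', Finset.mem_univ]
    · by_cases hj : l = j
      · subst hj
        simp only [hi, forall_const, false_implies, true_and, if_true, if_false, one_mul,
          Finset.sum_ite_eq', Finset.mem_univ]
      · simp [hi, hj]
  simp_rw [h2]
  rw [Finset.prod_mul_distrib]
  simp

/-- The equation for q is what makes this symmetric: the all-false pattern removes mass (1-q)^k =
1-2q from the pair (-1, -1), and (1-q)² - (1-2q) = q² leaves the same weight as for (1, 1).
Normalising by 2q gives q/2, or (1-q)/2 for mixed pairs. -/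
theorem sum_muBar_two_marginal {k : ℕ} {q : ℝ} (h : IsMarginalParam k q) {i j : Fin k}
    (hij : i ≠ j) (y z : ℤˣ) :
    ∑ σ : ClausePattern k, (if σ.1 i = y ∧ σ.1 j = z then muBar k q σ else 0) =
      agreeWeight q y z / 2 := by
  classical
  have h0 := h.1.ne'
  have e1 := sum_prod_two_marginal q hij y z
  set f : (Fin k → ℤˣ) → ℝ := fun σ =>
    if σ i = y ∧ σ j = z then ∏ l, (if σ l = 1 then q else 1 - q) else 0 with hf
  have e2 : ∑ σ : ClausePattern k, (if σ.1 i = y ∧ σ.1 j = z then muBar k q σ else 0) =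
      (∑ σ : ClausePattern k, f σ.1) / (2 * q) := by
    rw [Finset.sum_div]
    refine Finset.sum_congr rfl fun σ _ => ?_
    simp only [hf]
    rw [muBar_eq_prod h]
    split_ifs <;> simp
  have e3 : ∑ σ : ClausePattern k, f σ.1 = ∑ σ, f σ - f fun _ => -1 := by
    rw [← Finset.add_sum_erase Finset.univ f (Finset.mem_univ fun _ => -1), add_sub_cancel_left]
    rw [← Finset.sum_subtype]
    simp
  have e4 : f (fun _ => -1) = if y = -1 ∧ z = -1 then 1 - 2 * q else 0 := by
    simp only [hf]
    rw [← h.one_sub_pow]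
    have hn : ¬ ((-1 : ℤˣ) = 1) := by decide
    rw [Finset.prod_congr rfl fun _ _ => if_neg hn]
    simp only [Finset.prod_const, Finset.card_univ, Fintype.card_fin,
      eq_comm (a := (-1 : ℤˣ))]
  rw [e2, e3, e1, e4, agreeWeight]
  have hn : ¬ ((-1 : ℤˣ) = 1) := by decide
  have hn' : ¬ ((1 : ℤˣ) = -1) := by decide
  rcases Int.units_eq_one_or y with rfl | rfl <;> rcases Int.units_eq_one_or z with rfl | rfl <;>
    simp [hn, hn'] <;> field_simp <;> ring

end Marginals

/-! ### Families of cycles: slots versus vertices -/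

section CycleFamilies

theorem fin_mk_add_one {r j : ℕ} (hj : j + 1 < r + 1) :
    (⟨j, by omega⟩ : Fin (r + 1)) + 1 = ⟨j + 1, hj⟩ :=
  Fin.coeSucc_eq_succ (a := (⟨j, by omega⟩ : Fin r))

/-- Cyclic induction: the step passes from the last index back to 0, so any starting point suffices.
-/
theorem fin_forall_of_add_one {r : ℕ} {P : Fin (r + 1) → Prop} {i₀ : Fin (r + 1)} (h0 : P i₀)
    (h : ∀ i, P i → P (i + 1)) (i : Fin (r + 1)) : P i := by
  have hs : ∀ j (hj : j + 1 < r + 1), P ⟨j, by omega⟩ → P ⟨j + 1, hj⟩ := by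
    intro j hj hP
    have := h _ hP
    rwa [fin_mk_add_one hj] at this
  have hl : ∀ j, i₀.val ≤ j → ∀ hj : j < r + 1, P ⟨j, hj⟩ := by
    intro j hj
    induction j, hj using Nat.le_induction with
    | base => intro _; exact h0
    | succ j _ ih => intro hj; exact hs j hj (ih (by omega))
  have h00 : P 0 := by
    have := h _ (hl r (by omega) (by omega))
    have e : (⟨r, by omega⟩ : Fin (r + 1)) = Fin.last r := rfl
    rwa [e, Fin.last_add_one] at this
  have hall : ∀ j (hj : j < r + 1), P ⟨j, hj⟩ := by
    intro j
    induction j with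
    | zero => intro _; exact h00
    | succ j ih => intro hj; exact hs j hj (ih (by omega))
  exact hall i.1 i.2

variable {T : Type*}

/-- The variable nodes (and clause nodes) of a family of cycles with sign patterns `s t`. -/
abbrev Node (s : T → SignPattern) : Type _ := Σ t, Fin ((s t).1 + 1)

/-- The successor of a node along its cycle. -/
def nxt (s : T → SignPattern) : Node s ≃ Node s :=
  Equiv.sigmaCongrRight fun _ => Equiv.addRight 1

@[simp] theorem nxt_mk (s : T → SignPattern) (t : T) (i : Fin ((s t).1 + 1)) :
    nxt s ⟨t, i⟩ = ⟨t, i + 1⟩ := rfl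

variable {n m d k : ℕ} {s : T → SignPattern}

/-- The slots of a family of closed walks, given by the clauses `c` of the walks and the two
positions `g` in each clause. -/
def slots (c : Node s → Fin m) (g : Node s → Fin k × Fin k) (h : Node s) :
    (Fin m × Fin k) × (Fin m × Fin k) :=
  ((c h, (g h).1), (c (nxt s h), (g (nxt s h)).2))

/-- All walks of the family are cycles. -/
def AllCycles (Φ : Formula n m d k) (c : Node s → Fin m) (g : Node s → Fin k × Fin k) : Prop :=
  ∀ t, IsCycle Φ (s t) fun i => slots c g ⟨t, i⟩

/-- No two walks of the family coincide. -/
def NoRepeat (c : Node s → Fin m) (g : Node s → Fin k × Fin k) : Prop :=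
  ∀ t t', t ≠ t' → ∀ hl : (s t).1 = (s t').1,
    ¬ ∀ i, slots c g ⟨t, i⟩ = slots c g ⟨t', Fin.cast (by rw [hl]) i⟩

/-- The set of all slots of a family. -/
def slotSet [Fintype T] (c : Node s → Fin m) (g : Node s → Fin k × Fin k) :
    Finset (Fin m × Fin k) :=
  Finset.univ.image (fun h => (slots c g h).1) ∪ Finset.univ.image fun h => (slots c g h).2

/-- The variables of a family. -/
def nodeVar (Φ : Formula n m d k) (c : Node s → Fin m) (g : Node s → Fin k × Fin k) (h : Node s) :
    Fin n := Φ.var (slots c g h).1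

/-- Degree counting: slots are edges and `f` maps an edge to its endpoint on one side. Every
endpoint has degree at least two, and in the case of equality exactly two. -/
theorem two_mul_card_image_le {α β : Type*} [DecidableEq α] [DecidableEq β] (U : Finset α)
    (f : α → β) (hU : ∀ x ∈ U, ∃ y ∈ U, x ≠ y ∧ f y = f x) :
    2 * (U.image f).card ≤ U.card ∧ (U.card ≤ 2 * (U.image f).card →
      ∀ x ∈ U, ∀ y ∈ U, ∀ z ∈ U, f y = f x → f z = f x → x ≠ y → x ≠ z → y = z) := by
  have h2 : ∀ b ∈ U.image f, 2 ≤ (U.filter fun x => f x = b).card := by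
    intro b hb
    obtain ⟨x, hx, rfl⟩ := Finset.mem_image.1 hb
    obtain ⟨y, hy, hxy, hf⟩ := hU x hx
    exact Finset.one_lt_card.2 ⟨x, by simp [hx], y, by simp [hy, hf], hxy⟩
  have hc := Finset.card_eq_sum_card_image f U
  have hle : ∑ b ∈ U.image f, 2 ≤ ∑ b ∈ U.image f, (U.filter fun x => f x = b).card :=
    Finset.sum_le_sum h2
  rw [Finset.sum_const, smul_eq_mul] at hle
  refine ⟨by omega, fun h x hx y hy z hz hyx hzx nxy nxz => ?_⟩
  have heq : ∑ b ∈ U.image f, 2 = ∑ b ∈ U.image f, (U.filter fun x => f x = b).card := by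
    rw [Finset.sum_const, smul_eq_mul]; omega
  have hf := (Finset.sum_eq_sum_iff_of_le h2).1 heq (f x) (Finset.mem_image_of_mem f hx)
  by_contra hyz
  have : 2 < (U.filter fun w => f w = f x).card :=
    Finset.two_lt_card.2 ⟨x, by simp [hx], y, by simp [hy, hyx], z, by simp [hz, hzx], nxy, nxz,
      hyz⟩
  omega

/-- Only cycles through a single clause have a node that is its own successor; for these, the strict
orientation condition is what separates the two slots. -/
theorem add_one_ne_self_of_slots {Φ : Formula n m d k} {c : Node s → Fin m}
    {g : Node s → Fin k × Fin k} (hc : AllCycles Φ c g) {h : Node s} (hh : nxt s h = h) :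
    (slots c g h).1 ≠ (slots c g h).2 := by
  obtain ⟨t, i⟩ := h
  have hi : i + 1 = i := by simpa using hh
  have hr : (s t).1 = 0 := by
    by_contra hr
    by_cases hj : i.1 + 1 < (s t).1 + 1
    · have := congrArg Fin.val (fin_mk_add_one hj ▸ hi : (⟨i.1 + 1, hj⟩ : Fin _) = i)
      simp at this
    · have hl : i = Fin.last _ := by ext; have := i.2; simp; omega
      rw [hl, Fin.last_add_one] at hi
      have := congrArg Fin.val hi
      simp at this
      omega
  have e0 : i = 0 := by ext; have := i.2; simp; omega
  have el : i = Fin.last _ := by ext; have := i.2; simp; omega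
  intro he
  have ho := (hc t).orient
  rw [← e0, ← el, he] at ho
  exact lt_irrefl _ ho

theorem slots_fst_ne_snd {Φ : Formula n m d k} {c : Node s → Fin m}
    {g : Node s → Fin k × Fin k} (hc : AllCycles Φ c g) (h : Node s) :
    (slots c g h).1 ≠ (slots c g h).2 := by
  intro he
  refine add_one_ne_self_of_slots hc ?_ he
  obtain ⟨t, i⟩ := h
  have := (hc t).clause_inj (a₁ := i + 1) (a₂ := i) (congrArg Prod.fst he).symm
  rw [nxt_mk, show i + 1 = i from this]

theorem slots_nxt_fst_ne_snd {Φ : Formula n m d k} {c : Node s → Fin m}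
    {g : Node s → Fin k × Fin k} (hc : AllCycles Φ c g) (h : Node s) :
    (slots c g (nxt s h)).1 ≠ (slots c g h).2 := by
  intro he
  have hh : nxt s h = h := by
    obtain ⟨t, i⟩ := h
    have h1 := congrArg Φ.var he
    rw [← (hc t).same_var i] at h1
    have : i + 1 = i := (hc t).var_inj h1
    rw [nxt_mk, this]
  rw [hh] at he
  exact add_one_ne_self_of_slots hc hh he

/-- The union of the cycles is a bipartite multigraph with the slots as edges and clauses and
variables as vertices. All degrees are at least two, so there are at least as many edges as
vertices. Equality forces all degrees to be two; then two walks that meet traverse the same cycle,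
and the conventions on starting clause and orientation make them identical, which `NoRepeat`
excludes. -/
theorem card_add_card_le_card_slotSet [Fintype T] {Φ : Formula n m d k}
    {c : Node s → Fin m} {g : Node s → Fin k × Fin k} (hc : AllCycles Φ c g)
    (hd : NoRepeat c g) :
    (Finset.univ.image c).card + (Finset.univ.image (nodeVar Φ c g)).card ≤ (slotSet c g).card ∧
    ((slotSet c g).card ≤
      (Finset.univ.image c).card + (Finset.univ.image (nodeVar Φ c g)).card →
      Function.Injective c ∧ Function.Injective (nodeVar Φ c g)) := by
  set a : Node s → Fin m × Fin k := fun h => (slots c g h).1 with ha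
  set b : Node s → Fin m × Fin k := fun h => (slots c g h).2 with hb
  have haU : ∀ h, a h ∈ slotSet c g := fun h =>
    Finset.mem_union_left _ (Finset.mem_image_of_mem _ (Finset.mem_univ h))
  have hbU : ∀ h, b h ∈ slotSet c g := fun h =>
    Finset.mem_union_right _ (Finset.mem_image_of_mem _ (Finset.mem_univ h))
  have hU : ∀ x ∈ slotSet c g, (∃ h, a h = x) ∨ ∃ h, b h = x := by
    intro x hx
    simpa [slotSet] using hx
  have hab : ∀ h, a h ≠ b h := slots_fst_ne_snd hc
  have hba : ∀ h, a (nxt s h) ≠ b h := slots_nxt_fst_ne_snd hc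
  have hv : ∀ h, Φ.var (a h) = Φ.var (b h) := fun h => (hc h.1).same_var h.2
  have hcl : ∀ h, (a (nxt s h)).1 = (b h).1 := fun h => rfl
  have iv : (slotSet c g).image Φ.var = Finset.univ.image (nodeVar Φ c g) := by
    ext x
    simp only [Finset.mem_image, Finset.mem_univ, true_and]
    constructor
    · rintro ⟨y, hy, rfl⟩
      rcases hU y hy with ⟨h, rfl⟩ | ⟨h, rfl⟩
      · exact ⟨h, rfl⟩
      · exact ⟨h, hv h⟩
    · rintro ⟨h, rfl⟩
      exact ⟨_, haU h, rfl⟩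
  have ic : (slotSet c g).image Prod.fst = Finset.univ.image c := by
    ext x
    simp only [Finset.mem_image, Finset.mem_univ, true_and]
    constructor
    · rintro ⟨y, hy, rfl⟩
      rcases hU y hy with ⟨h, rfl⟩ | ⟨h, rfl⟩
      · exact ⟨h, rfl⟩
      · exact ⟨nxt s h, rfl⟩
    · rintro ⟨h, rfl⟩
      exact ⟨_, haU h, rfl⟩
  obtain ⟨lv, pv⟩ := two_mul_card_image_le (slotSet c g) Φ.var (by
    intro x hx
    rcases hU x hx with ⟨h, rfl⟩ | ⟨h, rfl⟩
    · exact ⟨b h, hbU h, hab h, (hv h).symm⟩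
    · exact ⟨a h, haU h, (hab h).symm, hv h⟩)
  obtain ⟨lc, pc⟩ := two_mul_card_image_le (slotSet c g) Prod.fst (by
    intro x hx
    rcases hU x hx with ⟨h, rfl⟩ | ⟨h, rfl⟩
    · obtain ⟨p, rfl⟩ := (nxt s).surjective h
      exact ⟨b p, hbU p, hba p, rfl⟩
    · exact ⟨a (nxt s h), haU _, (hba h).symm, rfl⟩)
  rw [iv] at lv pv
  rw [ic] at lc pc
  refine ⟨by omega, fun hle => ?_⟩
  replace pv := pv (by omega)
  replace pc := pc (by omega)
  -- With all degrees equal to two, the slot by which a walk leaves a vertex is determined by the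
  -- slot by which it enters. So a common slot propagates along both walks, either in the same
  -- direction (`same_v`, `same_nxt`) or in opposite directions (`rev_v`, `rev_nxt`).
  have same_v : ∀ h h', a h = a h' → b h = b h' := fun h h' e =>
    pv (a h) (haU _) (b h) (hbU _) (b h') (hbU _) (hv h).symm (by rw [e]; exact (hv h').symm)
      (hab h) (by rw [e]; exact hab h')
  have same_nxt : ∀ h h', a h = a h' → a (nxt s h) = a (nxt s h') := fun h h' e =>
    pc (b h) (hbU _) _ (haU _) _ (haU _) (hcl h) (by rw [same_v h h' e]; exact hcl h')
      (hba h).symm (by rw [same_v h h' e]; exact (hba h').symm)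
  have rev_v : ∀ h h', a h = b h' → b h = a h' := fun h h' e =>
    pv (a h) (haU _) _ (hbU _) _ (haU _) (hv h).symm (by rw [e]; exact hv h') (hab h)
      (by rw [e]; exact (hab h').symm)
  have rev_nxt : ∀ h h', a h = b (nxt s h') → a (nxt s h) = b h' := fun h h' e =>
    pc (b h) (hbU _) _ (haU _) _ (hbU _) (hcl h) (by rw [rev_v _ _ e]; exact (hcl h').symm)
      (hba h).symm
      (by rw [rev_v _ _ e]; exact hba h')
  have min_t : ∀ t i, c ⟨t, 0⟩ ≤ c ⟨t, i⟩ := fun t i => (hc t).start_min i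
  have inj_t : ∀ t i j, c ⟨t, i⟩ = c ⟨t, j⟩ → i = j := fun t i j e => (hc t).clause_inj e
  have ca : ∀ h h', a h = a h' → c h = c h' := fun h h' e => congrArg Prod.fst e
  have cab : ∀ t i h', a ⟨t, i⟩ = b h' → c ⟨t, i⟩ = c (nxt s h') := fun t i h' e =>
    congrArg Prod.fst e
  -- Same direction: each walk covers the other, so both have the same smallest clause and start at
  -- the same slot. They then agree step by step and close up after the same number of steps.
  have no_same : ∀ t t', t ≠ t' → ∀ i i', a ⟨t, i⟩ ≠ a ⟨t', i'⟩ := by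
    intro t t' ht i i' e
    have reach : ∀ t t' i i', a ⟨t, i⟩ = a ⟨t', i'⟩ → ∀ j, ∃ j', a ⟨t, j⟩ = a ⟨t', j'⟩ := by
      intro t t' i i' e
      refine fin_forall_of_add_one (i₀ := i) ⟨i', e⟩ ?_
      rintro j ⟨j', e'⟩
      exact ⟨j' + 1, same_nxt _ _ e'⟩
    obtain ⟨j', e1⟩ := reach t t' i i' e 0
    obtain ⟨j, e2⟩ := reach t' t i' i e.symm 0
    have hj : j' = 0 := by
      refine inj_t t' _ _ (le_antisymm ?_ (min_t t' j'))
      rw [← ca _ _ e1, ca _ _ e2]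
      exact min_t t j
    subst hj
    have walk : ∀ t t', a ⟨t, 0⟩ = a ⟨t', 0⟩ → (s t).1 ≤ (s t').1 → ∀ j (h1 : j < (s t).1 + 1)
        (h2 : j < (s t').1 + 1), a ⟨t, ⟨j, h1⟩⟩ = a ⟨t', ⟨j, h2⟩⟩ := by
      intro t t' e0 hl j
      induction j with
      | zero => intro _ _; exact e0
      | succ j ih =>
        intro h1 h2
        have := same_nxt _ _ (ih (by omega) (by omega))
        rwa [nxt_mk, nxt_mk, fin_mk_add_one h1, fin_mk_add_one h2] at this
    have len : ∀ t t', a ⟨t, 0⟩ = a ⟨t', 0⟩ → (s t').1 ≤ (s t).1 := by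
      intro t t' e0
      by_contra hl
      push Not at hl
      have := same_nxt _ _ (walk t t' e0 hl.le (s t).1 (by omega) (by omega))
      have f1 : (⟨(s t).1, by omega⟩ : Fin ((s t).1 + 1)) + 1 = 0 := Fin.last_add_one _
      rw [nxt_mk, nxt_mk, f1, e0, fin_mk_add_one (by omega)] at this
      have h0 := congrArg Fin.val (inj_t t' _ _ (ca _ _ this))
      simp at h0
    have hl : (s t).1 = (s t').1 := le_antisymm (len t' t e1.symm) (len t t' e1)
    refine hd t t' ht hl fun i => ?_
    have ei := walk t t' e1 hl.le i.1 i.2 (by have := i.2; omega)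
    exact Prod.ext ei (same_v _ _ ei)
  -- Opposite directions: the starting clauses coincide again, but the first slot of each walk is
  -- the last slot of the other, so the two orientation conditions contradict each other.
  have no_rev : ∀ t t', ∀ i i', a ⟨t, i⟩ ≠ b ⟨t', i'⟩ := by
    intro t t' i i' e
    have reach : ∀ t t' i i', a ⟨t, i⟩ = b ⟨t', i'⟩ → ∀ j, ∃ j', a ⟨t, j⟩ = b ⟨t', j'⟩ := by
      intro t t' i i' e
      refine fin_forall_of_add_one (i₀ := i) ⟨i', e⟩ ?_
      rintro j ⟨j', e'⟩
      refine ⟨j' - 1, rev_nxt ⟨t, j⟩ ⟨t', j' - 1⟩ ?_⟩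
      rw [nxt_mk, sub_add_cancel]
      exact e'
    obtain ⟨j', e1⟩ := reach t t' i i' e 0
    obtain ⟨j, e2⟩ := reach t' t i' i (rev_v _ _ e).symm 0
    have hj' : j' + 1 = 0 := by
      refine inj_t t' _ _ (le_antisymm ?_ (min_t t' _))
      have := cab _ _ _ e1
      rw [nxt_mk] at this
      rw [← this, cab _ _ _ e2]
      exact min_t t _
    have hj : j + 1 = 0 := by
      refine inj_t t _ _ (le_antisymm ?_ (min_t t _))
      have := cab _ _ _ e2
      rw [nxt_mk] at this
      rw [← this, cab _ _ _ e1]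
      exact min_t t' _
    have l1 : j' = Fin.last _ := by
      rw [← Fin.last_add_one] at hj'
      exact add_right_cancel hj'
    have l2 : j = Fin.last _ := by
      rw [← Fin.last_add_one] at hj
      exact add_right_cancel hj
    have o1 : (a ⟨t, 0⟩).2 < (b ⟨t, Fin.last _⟩).2 := (hc t).orient
    have o2 : (a ⟨t', 0⟩).2 < (b ⟨t', Fin.last _⟩).2 := (hc t').orient
    rw [← l2, ← e2] at o1
    rw [← l1, ← e1] at o2
    exact lt_asymm o1 o2
  have no_v : ∀ h h' : Node s, h.1 ≠ h'.1 → nodeVar Φ c g h ≠ nodeVar Φ c g h' := by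
    intro h h' ht e
    have e' : Φ.var (a h) = Φ.var (a h') := e
    by_cases h1 : a h = a h'
    · exact no_same _ _ ht _ _ h1
    -- The variable has just the two slots `a h` and `b h`, so a walk meeting it in another way runs
    -- through it in reverse.
    · have := pv (a h) (haU _) _ (hbU h) _ (haU h') (hv h).symm e'.symm (hab h) h1
      exact no_rev h'.1 h.1 h'.2 h.2 this.symm
  have no_c : ∀ h h' : Node s, h.1 ≠ h'.1 → c h ≠ c h' := by
    intro h h' ht e
    by_cases h1 : a h = a h'
    · exact no_same _ _ ht _ _ h1
    · obtain ⟨p', rfl⟩ := (nxt s).surjective h'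
      have := pc (a (nxt s p')) (haU _) _ (haU h) _ (hbU p') e (hcl p').symm (Ne.symm h1) (hba p')
      exact no_rev h.1 p'.1 h.2 p'.2 this
  constructor
  · rintro ⟨t, i⟩ ⟨t', i'⟩ e
    by_cases ht : t = t'
    · subst ht
      rw [inj_t t i i' e]
    · exact absurd e (no_c _ _ ht)
  · rintro ⟨t, i⟩ ⟨t', i'⟩ e
    by_cases ht : t = t'
    · subst ht
      rw [(hc t).var_inj (a₁ := i) (a₂ := i') e]
    · exact absurd e (no_v _ _ ht)

end CycleFamilies

/-! ### Factorial moments as numbers of families of distinct cycles -/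

section FactorialMoments
open scoped Classical

/-- The index set of a family with `r x` cycles for each sign pattern `x` in `S`. -/
abbrev CycleIndex {S : Finset SignPattern} (r : S → ℕ) : Type := Σ x : S, Fin (r x)

/-- The sign pattern of a member of the family. -/
abbrev indexPattern {S : Finset SignPattern} (r : S → ℕ) (t : CycleIndex r) : SignPattern := t.1.1

theorem slots_injective {T : Type*} {s : T → SignPattern} {m k : ℕ} {c c' : Node s → Fin m}
    {g g' : Node s → Fin k × Fin k} (h : ∀ x, slots c g x = slots c' g' x) :
    c = c' ∧ g = g' := by
  constructor
  · funext x
    exact congrArg (fun z => z.1.1) (h x)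
  · funext x
    refine Prod.ext (congrArg (fun z => z.1.2) (h x)) ?_
    obtain ⟨y, rfl⟩ := (nxt s).surjective x
    exact congrArg (fun z => z.2.2) (h y)

/-- The families of distinct cycles with sign patterns `s`. -/
noncomputable def cycleFamilies {T : Type*} [Fintype T] [DecidableEq T] (s : T → SignPattern)
    {n m d k : ℕ} (Φ : Formula n m d k) :
    Finset ((Node s → Fin m) × (Node s → Fin k × Fin k)) :=
  Finset.univ.filter fun cg => AllCycles Φ cg.1 cg.2 ∧ NoRepeat cg.1 cg.2

theorem mem_cycleFamilies {T : Type*} [Fintype T] [DecidableEq T] {s : T → SignPattern}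
    {n m d k : ℕ} {Φ : Formula n m d k} {cg : (Node s → Fin m) × (Node s → Fin k × Fin k)} :
    cg ∈ cycleFamilies s Φ ↔ AllCycles Φ cg.1 cg.2 ∧ NoRepeat cg.1 cg.2 := by
  simp [cycleFamilies]

/-- A descending factorial counts injections of `Fin (r x)` into the set of cycles with pattern x.
Such tuples are encoded by clauses and positions at the nodes, which builds the condition
`same_clause` into the encoding. -/
theorem prod_descFactorial_cycleCount {n m d k : ℕ} {S : Finset SignPattern} (r : S → ℕ)
    (Φ : Formula n m d k) :
    ∏ x : S, (cycleCount x.1 Φ).descFactorial (r x) = (cycleFamilies (indexPattern r) Φ).card := by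
  have h1 : ∏ x : S, (cycleCount x.1 Φ).descFactorial (r x) =
      Fintype.card (∀ x : S, Fin (r x) ↪
        {p : Fin (x.1.1 + 1) → (Fin m × Fin k) × (Fin m × Fin k) // IsCycle Φ x.1 p}) := by
    rw [Fintype.card_pi]
    refine Finset.prod_congr rfl fun x _ => ?_
    rw [Fintype.card_embedding_eq, Fintype.card_fin, Fintype.card_subtype]
    rfl
  have hmem : ∀ cg : cycleFamilies (indexPattern r) Φ,
      AllCycles Φ cg.1.1 cg.1.2 ∧ NoRepeat cg.1.1 cg.1.2 :=
    fun cg => mem_cycleFamilies.1 cg.2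
  rw [h1, ← Fintype.card_coe]
  symm
  refine Fintype.card_of_bijective (f := fun cg => fun x => ⟨fun i =>
    ⟨fun j => slots cg.1.1 cg.1.2 ⟨⟨x, i⟩, j⟩, (hmem cg).1 ⟨x, i⟩⟩, ?_⟩) ⟨?_, ?_⟩
  · intro i i' h
    by_contra hi
    refine (hmem cg).2 ⟨x, i⟩ ⟨x, i'⟩ (fun e => hi (by simpa using e)) rfl fun j => ?_
    exact congrFun (congrArg Subtype.val h) j
  · intro cg cg' h
    have h' : ∀ z, slots cg.1.1 cg.1.2 z = slots cg'.1.1 cg'.1.2 z := by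
      rintro ⟨⟨x, i⟩, j⟩
      have := congrFun h x
      have := congrArg (fun f => (f i).1 j) (this)
      exact this
    obtain ⟨h1, h2⟩ := slots_injective h'
    exact Subtype.ext (Prod.ext h1 h2)
  · intro f
    set P : Node (indexPattern r) → (Fin m × Fin k) × (Fin m × Fin k) :=
      fun h => (f h.1.1 h.1.2).1 h.2 with hP
    set c : Node (indexPattern r) → Fin m := fun h => (P h).1.1 with hc
    -- The second position in a clause belongs to the slot by which the walk arrives, hence to the
    -- preceding node.
    set g : Node (indexPattern r) → Fin k × Fin k :=
      fun h => ((P h).1.2, (P ((nxt _).symm h)).2.2) with hg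
    have hs : ∀ h, slots c g h = P h := by
      intro h
      refine Prod.ext rfl (Prod.ext ?_ ?_)
      · exact (f h.1.1 h.1.2).2.same_clause h.2
      · simp [slots, hg]
    have hs' : ∀ t, (fun i => slots c g ⟨t, i⟩) = (f t.1 t.2).1 := by
      intro t
      funext i
      rw [hs]
    refine ⟨⟨(c, g), mem_cycleFamilies.2 ⟨fun t => ?_, ?_⟩⟩, ?_⟩
    · rw [hs']
      exact (f t.1 t.2).2
    · rintro ⟨⟨⟨x, X⟩, hx⟩, i⟩ ⟨⟨⟨x', X'⟩, hx'⟩, i'⟩ ht hl he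
      have hl' : x = x' := hl
      subst hl'
      have he' : ∀ j, (f ⟨⟨x, X⟩, hx⟩ i).1 j = (f ⟨⟨x, X'⟩, hx'⟩ i').1 j := by
        intro j
        have := he j
        rw [hs, hs] at this
        exact this
      -- A cycle determines its sign pattern, so cycles with different patterns are automatically
      -- distinct.
      have hX : X = X' := by
        funext j
        have h1 := (f ⟨⟨x, X⟩, hx⟩ i).2.signs j
        have h2 := (f ⟨⟨x, X'⟩, hx'⟩ i').2.signs j
        rw [he' j] at h1
        exact h1.symm.trans h2
      subst hX
      refine ht ?_
      have : i = i' := (f ⟨⟨x, X⟩, hx⟩).injective (Subtype.ext (funext he'))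
      rw [this]
    · funext x
      ext i : 1
      exact Subtype.ext (hs' ⟨x, i⟩)

end FactorialMoments

/-! ### The planted model -/

section Planted
open scoped Classical

variable {n m d k : ℕ}

/-- The signs of a clause. -/
def row (Ψ : Formula n m d k) (i : Fin m) (j : Fin k) : ℤˣ := Ψ.sgn (i, j)

/-- The formulas whose signs, read as truth values, have the profile `μ`. -/
noncomputable def planted (n m d k : ℕ) (μ : ClausePattern k → ℝ) : Finset (Formula n m d k) :=
  Finset.univ.filter fun Ψ => ∀ σ : ClausePattern k,
    ((Finset.univ.filter fun i => row Ψ i = σ.1).card : ℝ) = m * μ σ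

/-- Multiplication of the signs of each variable by a truth assignment. -/
def gauge (d : ℕ) (τ : Fin n → ℤˣ) : Fin n × Fin d × ℤˣ ≃ Fin n × Fin d × ℤˣ where
  toFun y := (y.1, y.2.1, y.2.2 * τ y.1)
  invFun y := (y.1, y.2.1, y.2.2 * τ y.1)
  left_inv y := by simp [mul_assoc]
  right_inv y := by simp [mul_assoc]

/-- The formula obtained from a table of truth values and a truth assignment. -/
def twist (τ : Fin n → ℤˣ) (Ψ : Formula n m d k) : Formula n m d k := Ψ.trans (gauge d τ)

theorem twist_twist (τ : Fin n → ℤˣ) (Ψ : Formula n m d k) : twist τ (twist τ Ψ) = Ψ := by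
  ext x <;> simp [twist, gauge, mul_assoc]

@[simp] theorem sgn_twist (τ : Fin n → ℤˣ) (Ψ : Formula n m d k) (p : Fin m × Fin k) :
    (twist τ Ψ).sgn p = Ψ.sgn p * τ (Ψ.var p) := rfl

/-- For fixed τ, twisting is an involution on formulas that carries those for which τ has profile μ
to the planted ones. The planted set does not depend on τ, so the two sums on the right are
independent. -/
theorem sum_Zmu_mul (hm : 0 < m) (μ : ClausePattern k → ℝ) (F : Formula n m d k → ℝ) :
    ∑ Φ, (Zmu μ Φ : ℝ) * F Φ = ∑ τ : Fin n → ℤˣ, ∑ Ψ ∈ planted n m d k μ, F (twist τ Ψ) := by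
  have h1 : ∀ Φ : Formula n m d k, (Zmu μ Φ : ℝ) =
      ∑ τ : Fin n → ℤˣ, if twist τ Φ ∈ planted n m d k μ then 1 else 0 := by
    intro Φ
    rw [Zmu, Finset.card_filter]
    push_cast
    refine Finset.sum_congr rfl fun τ _ => ?_
    congr 1
    simp only [planted, Finset.mem_filter, Finset.mem_univ, true_and, eq_iff_iff]
    refine forall_congr' fun σ => ?_
    have h2 : ∑ i : Fin m, ∏ j : Fin k,
        (if Φ.sgn (i, j) * τ (Φ.var (i, j)) = σ.1 j then (1 : ℝ) else 0) =
        ((Finset.univ.filter fun i => row (twist τ Φ) i = σ.1).card : ℝ) := by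
      rw [Finset.card_filter]
      push_cast
      refine Finset.sum_congr rfl fun i _ => ?_
      rw [Finset.prod_ite_zero]
      simp [funext_iff, row]
    rw [h2]
    have : (m : ℝ) ≠ 0 := by positivity
    constructor
    · intro h; rw [h]; field_simp
    · intro h; rw [h]; field_simp
  simp_rw [h1, Finset.sum_mul]
  rw [Finset.sum_comm]
  refine Finset.sum_congr rfl fun τ _ => ?_
  rw [← Finset.sum_filter_add_sum_filter_not Finset.univ fun Φ => twist τ Φ ∈ planted n m d k μ]
  rw [Finset.sum_congr rfl (g := fun Φ => F Φ) (by intro Φ hΦ; simp [(Finset.mem_filter.1 hΦ).2]),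
    Finset.sum_eq_zero (s := Finset.univ.filter fun Φ => ¬ twist τ Φ ∈ planted n m d k μ)
      (by intro Φ hΦ; simp [(Finset.mem_filter.1 hΦ).2]), add_zero]
  refine Finset.sum_nbij' (fun Φ => twist τ Φ) (fun Φ => twist τ Φ) ?_ ?_ ?_ ?_ ?_
  · intro Φ hΦ; exact (Finset.mem_filter.1 hΦ).2
  · intro Ψ hΨ; simp [twist_twist, hΨ]
  · intro Φ _; exact twist_twist τ Φ
  · intro Φ _; exact twist_twist τ Φ
  · intro Φ _; rw [twist_twist]

theorem expectation_Zmu_div (hm : 0 < m) (μ : ClausePattern k → ℝ) (F : Formula n m d k → ℝ)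
    (hP : (planted n m d k μ).Nonempty) :
    expectation (fun Φ : Formula n m d k => (Zmu μ Φ : ℝ) * F Φ) /
        expectation (fun Φ : Formula n m d k => (Zmu μ Φ : ℝ)) =
      (∑ τ : Fin n → ℤˣ, ∑ Ψ ∈ planted n m d k μ, F (twist τ Ψ)) /
        (2 ^ n * (planted n m d k μ).card) := by
  have h1 := sum_Zmu_mul (d := d) (n := n) hm μ fun _ => 1
  simp only [mul_one, Finset.sum_const, nsmul_eq_mul, Finset.card_univ, Fintype.card_pi,
    Fintype.card_units_int, Finset.prod_const, Fintype.card_fin] at h1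
  obtain ⟨Ψ, _⟩ := hP
  have : Nonempty (Formula n m d k) := ⟨Ψ⟩
  have hc : (Fintype.card (Formula n m d k) : ℝ) ≠ 0 := by
    exact_mod_cast Fintype.card_ne_zero
  rw [expectation, expectation, h1, sum_Zmu_mul hm, div_div_div_cancel_right₀ hc]
  push_cast
  rfl

end Planted

/-! ### Symmetries of the planted model -/

section Symmetry
open scoped Classical

theorem exists_perm_extend {E α : Type*} [Fintype α] {f f' : E → α} (hf : Function.Injective f)
    (hf' : Function.Injective f') : ∃ π : Equiv.Perm α, ∀ e, π (f e) = f' e := by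
  let e₀ : {x // x ∈ Set.range f} ≃ {x // x ∈ Set.range f'} :=
    (Equiv.ofInjective f hf).symm.trans (Equiv.ofInjective f' hf')
  refine ⟨e₀.extendSubtype, fun e => ?_⟩
  rw [e₀.extendSubtype_apply_of_mem _ ⟨e, rfl⟩]
  have : (⟨f e, ⟨e, rfl⟩⟩ : {x // x ∈ Set.range f}) = Equiv.ofInjective f hf e := rfl
  simp only [e₀, Equiv.trans_apply]
  rw [this, Equiv.symm_apply_apply]
  rfl

/-- A permutation of the clones that preserves the signs. -/
def signPerm {n d : ℕ} (π : ℤˣ → Equiv.Perm (Fin n × Fin d)) :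
    Fin n × Fin d × ℤˣ ≃ Fin n × Fin d × ℤˣ where
  toFun y := ((π y.2.2 (y.1, y.2.1)).1, (π y.2.2 (y.1, y.2.1)).2, y.2.2)
  invFun y := (((π y.2.2).symm (y.1, y.2.1)).1, ((π y.2.2).symm (y.1, y.2.1)).2, y.2.2)
  left_inv y := by simp
  right_inv y := by simp

/-- Permutations of the clones within each sign class leave the sign table, hence the planted set,
unchanged. They act transitively on injective choices of clones with given signs. -/
theorem exists_signPerm_extend {E : Type*} {n d : ℕ} {y y' : E → Fin n × Fin d × ℤˣ}
    (hy : Function.Injective y) (hy' : Function.Injective y')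
    (h : ∀ e, (y e).2.2 = (y' e).2.2) :
    ∃ π : ℤˣ → Equiv.Perm (Fin n × Fin d), ∀ e, signPerm π (y e) = y' e := by
  have key : ∀ z : ℤˣ, ∃ π : Equiv.Perm (Fin n × Fin d), ∀ e : {e // (y e).2.2 = z},
      π ((y e).1, (y e).2.1) = ((y' e).1, (y' e).2.1) := by
    intro z
    refine exists_perm_extend (f := fun e : {e // (y e).2.2 = z} => ((y e).1, (y e).2.1))
      (f' := fun e : {e // (y e).2.2 = z} => ((y' e).1, (y' e).2.1)) ?_ ?_
    · intro a b hab
      have h2 : (y a).2.2 = (y b).2.2 := a.2.trans b.2.symm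
      simp only [Prod.mk.injEq] at hab
      exact Subtype.ext (hy (Prod.ext hab.1 (Prod.ext hab.2 h2)))
    · intro a b hab
      have h2 : (y' a).2.2 = (y' b).2.2 := by rw [← h, ← h]; exact a.2.trans b.2.symm
      simp only [Prod.mk.injEq] at hab
      exact Subtype.ext (hy' (Prod.ext hab.1 (Prod.ext hab.2 h2)))
  choose π hπ using key
  refine ⟨π, fun e => ?_⟩
  have := hπ (y e).2.2 ⟨e, rfl⟩
  have h1 := congrArg Prod.fst this
  have h2 := congrArg Prod.snd this
  exact Prod.ext h1 (Prod.ext h2 (h e))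

variable {n m d k : ℕ} {μ : ClausePattern k → ℝ}

theorem mem_planted {Ψ : Formula n m d k} : Ψ ∈ planted n m d k μ ↔ ∀ σ : ClausePattern k,
    ((Finset.univ.filter fun i => row Ψ i = σ.1).card : ℝ) = m * μ σ := by
  simp [planted]

theorem trans_signPerm_mem_planted {Ψ : Formula n m d k}
    (π : ℤˣ → Equiv.Perm (Fin n × Fin d)) (h : Ψ ∈ planted n m d k μ) :
    (Ψ.trans (signPerm π) : Formula n m d k) ∈ planted n m d k μ := by
  rw [mem_planted] at h ⊢
  exact h

theorem card_planted_fill_le {E : Type*} [Fintype E] {u : E → Fin m × Fin k}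
    {y y' : E → Fin n × Fin d × ℤˣ} (hy : Function.Injective y) (hy' : Function.Injective y')
    (h : ∀ e, (y e).2.2 = (y' e).2.2) :
    ((planted n m d k μ).filter fun Ψ => ∀ e, Ψ (u e) = y e).card ≤
      ((planted n m d k μ).filter fun Ψ => ∀ e, Ψ (u e) = y' e).card := by
  obtain ⟨π, hπ⟩ := exists_signPerm_extend hy hy' h
  refine Finset.card_le_card_of_injOn (fun Ψ => Ψ.trans (signPerm π)) ?_ ?_
  · intro Ψ hΨ
    simp only [Finset.mem_coe, Finset.mem_filter] at hΨ ⊢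
    refine ⟨trans_signPerm_mem_planted π hΨ.1, fun e => ?_⟩
    rw [← hπ e, ← hΨ.2 e]
    rfl
  · intro Ψ _ Ψ' _ he
    have := congrArg (fun X : Formula n m d k => X.trans (signPerm π).symm) he
    simpa [Equiv.trans_assoc] using this

/-- The injective choices of clones with prescribed signs. -/
noncomputable def cloneFill {E : Type*} [Fintype E] (n d : ℕ) (X : E → ℤˣ) :
    Finset (E → Fin n × Fin d × ℤˣ) :=
  Finset.univ.filter fun y => Function.Injective y ∧ ∀ e, (y e).2.2 = X e

theorem mem_cloneFill {E : Type*} [Fintype E] {X : E → ℤˣ} {y : E → Fin n × Fin d × ℤˣ} :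
    y ∈ cloneFill n d X ↔ Function.Injective y ∧ ∀ e, (y e).2.2 = X e := by
  simp [cloneFill]

theorem card_cloneFill_le {E : Type*} [Fintype E] (X : E → ℤˣ) :
    (cloneFill n d X).card ≤ (n * d) ^ Fintype.card E := by
  have : Fintype.card (E → Fin n × Fin d) = (n * d) ^ Fintype.card E := by simp
  rw [← this, ← Finset.card_univ]
  refine Finset.card_le_card_of_injOn (fun y e => ((y e).1, (y e).2.1)) (by simp) ?_
  intro y hy y' hy' h
  have h1 := (mem_cloneFill.1 hy).2
  have h2 := (mem_cloneFill.1 hy').2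
  funext e
  have := congrFun h e
  simp only [Prod.mk.injEq] at this
  exact Prod.ext this.1 (Prod.ext this.2 ((h1 e).trans (h2 e).symm))

theorem descFactorial_le_card_cloneFill {E : Type*} [Fintype E] (X : E → ℤˣ) :
    (n * d).descFactorial (Fintype.card E) ≤ (cloneFill n d X).card := by
  have : Fintype.card (E ↪ Fin n × Fin d) = (n * d).descFactorial (Fintype.card E) := by
    simp [Fintype.card_embedding_eq]
  rw [← this, ← Finset.card_univ]
  refine Finset.card_le_card_of_injOn (fun f e => ((f e).1, (f e).2, X e)) ?_ ?_
  · intro f _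
    rw [Finset.mem_coe, mem_cloneFill]
    refine ⟨fun e e' h => ?_, fun e => rfl⟩
    simp only [Prod.mk.injEq] at h
    exact f.injective (Prod.ext h.1 h.2.1)
  · intro f _ f' _ h
    ext e : 1
    have := congrFun h e
    simp only [Prod.mk.injEq] at this
    exact Prod.ext this.1 this.2.1

/-- Conditionally on the signs in the slots `u`, the clones placed there are uniform over
`cloneFill`. Stated without division, so that an empty `cloneFill` is harmless. -/
theorem card_planted_mem_mul {E : Type*} [Fintype E] {u : E → Fin m × Fin k}
    (hu : Function.Injective u) (X : E → ℤˣ) (Y : Finset (E → Fin n × Fin d × ℤˣ))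
    (hY : Y ⊆ cloneFill n d X) :
    ((planted n m d k μ).filter fun Ψ => (fun e => Ψ (u e)) ∈ Y).card * (cloneFill n d X).card =
      Y.card * ((planted n m d k μ).filter fun Ψ => ∀ e, Ψ.sgn (u e) = X e).card := by
  have hsum : ∀ Y : Finset (E → Fin n × Fin d × ℤˣ),
      ((planted n m d k μ).filter fun Ψ => (fun e => Ψ (u e)) ∈ Y).card =
      ∑ y ∈ Y, ((planted n m d k μ).filter fun Ψ => ∀ e, Ψ (u e) = y e).card := by
    intro Y
    rw [Finset.card_eq_sum_card_fiberwise (f := fun (Ψ : Formula n m d k) e => Ψ (u e)) (t := Y)]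
    · refine Finset.sum_congr rfl fun y hy => congrArg _ ?_
      ext Ψ
      simp only [Finset.mem_filter, funext_iff]
      constructor
      · rintro ⟨⟨h1, _⟩, h3⟩; exact ⟨h1, h3⟩
      · rintro ⟨h1, h3⟩
        refine ⟨⟨h1, ?_⟩, h3⟩
        rwa [show (fun e => Ψ (u e)) = y from funext h3]
    · intro Ψ hΨ
      exact (Finset.mem_filter.1 hΨ).2
  have hall : ((planted n m d k μ).filter fun Ψ => ∀ e, Ψ.sgn (u e) = X e) =
      (planted n m d k μ).filter fun Ψ => (fun e => Ψ (u e)) ∈ cloneFill n d X := by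
    ext Ψ
    simp only [Finset.mem_filter, mem_cloneFill]
    exact ⟨fun h => ⟨h.1, fun a b hab => hu (Ψ.injective hab), h.2⟩, fun h => ⟨h.1, h.2.2⟩⟩
  have hconst : ∀ y ∈ cloneFill n d X, ∀ y' ∈ cloneFill n d X,
      ((planted n m d k μ).filter fun Ψ => ∀ e, Ψ (u e) = y e).card =
      ((planted n m d k μ).filter fun Ψ => ∀ e, Ψ (u e) = y' e).card := by
    intro y hy y' hy'
    rw [mem_cloneFill] at hy hy'
    exact le_antisymm
      (card_planted_fill_le hy.1 hy'.1 fun e => (hy.2 e).trans (hy'.2 e).symm)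
      (card_planted_fill_le hy'.1 hy.1 fun e => (hy'.2 e).trans (hy.2 e).symm)
  rw [hall, hsum, hsum]
  rcases (cloneFill n d X).eq_empty_or_nonempty with he | ⟨y₀, hy₀⟩
  · rw [he] at hY ⊢
    simp
  · rw [Finset.sum_congr rfl fun y hy => hconst y (hY hy) y₀ hy₀,
      Finset.sum_congr rfl fun y hy => hconst y hy y₀ hy₀]
    simp only [Finset.sum_const, smul_eq_mul]
    ring

/-- The law of the rows at distinct clauses does not depend on the clauses. -/
theorem card_planted_rows_eq {H : Type*} [Fintype H] (Q : H → (Fin k → ℤˣ) → Prop) {c c' : H → Fin m}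
    (hc : Function.Injective c) (hc' : Function.Injective c') :
    ((planted n m d k μ).filter fun Ψ => ∀ h, Q h (row Ψ (c h))).card =
      ((planted n m d k μ).filter fun Ψ => ∀ h, Q h (row Ψ (c' h))).card := by
  have key : ∀ c c' : H → Fin m, Function.Injective c → Function.Injective c' →
      ((planted n m d k μ).filter fun Ψ => ∀ h, Q h (row Ψ (c h))).card ≤
        ((planted n m d k μ).filter fun Ψ => ∀ h, Q h (row Ψ (c' h))).card := by
    intro c c' hc hc'
    obtain ⟨π, hπ⟩ := exists_perm_extend hc' hc
    have hrow : ∀ (Ψ : Formula n m d k) i,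
        row ((π.prodCongr (Equiv.refl (Fin k))).trans Ψ : Formula n m d k) i = row Ψ (π i) :=
      fun Ψ i => rfl
    refine Finset.card_le_card_of_injOn
      (fun Ψ => ((π.prodCongr (Equiv.refl (Fin k))).trans Ψ : Formula n m d k)) ?_ ?_
    · intro Ψ hΨ
      simp only [Finset.mem_coe, Finset.mem_filter] at hΨ ⊢
      refine ⟨?_, fun h => ?_⟩
      · rw [mem_planted] at hΨ ⊢
        intro σ
        rw [← hΨ.1 σ]
        congr 1
        refine Finset.card_bij (fun i _ => π i) ?_ ?_ ?_
        · intro i hi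
          simpa [hrow] using hi
        · intro i _ j _ h
          exact π.injective h
        · intro i hi
          exact ⟨π.symm i, by simpa [hrow] using hi, by simp⟩
      · rw [hrow, hπ]
        exact hΨ.2 h
    · intro Ψ _ Ψ' _ he
      refine Equiv.ext fun p => ?_
      have := congrArg (fun X : Formula n m d k => X (π.symm p.1, p.2)) he
      simpa using this
  exact le_antisymm (key c c' hc hc') (key c' c hc' hc)

/-- For each choice of signs, prescribing the variables leaves at most d clones per slot, while at
least `(n * d).descFactorial U.card` placements are equally likely; summing over the signs gives the
bound. -/
theorem card_planted_var_le (U : Finset (Fin m × Fin k)) (w : Fin m × Fin k → Fin n) :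
    ((planted n m d k μ).filter fun Ψ => ∀ p ∈ U, Ψ.var p = w p).card *
      (n * d).descFactorial U.card ≤ d ^ U.card * (planted n m d k μ).card := by
  have h1 : ∀ X : U → ℤˣ,
      ((planted n m d k μ).filter fun Ψ => (∀ p ∈ U, Ψ.var p = w p) ∧
        ∀ e : U, Ψ.sgn e = X e).card * (n * d).descFactorial U.card ≤
      d ^ U.card * ((planted n m d k μ).filter fun Ψ => ∀ e : U, Ψ.sgn e = X e).card := by
    intro X
    set Y := (cloneFill n d X).filter fun y => ∀ e : U, (y e).1 = w e with hY
    have hYc : Y.card ≤ d ^ U.card := by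
      have : Fintype.card (U → Fin d) = d ^ U.card := by simp
      rw [← this, ← Finset.card_univ]
      refine Finset.card_le_card_of_injOn (fun y e => (y e).2.1) (by simp) ?_
      intro y hy y' hy' h
      rw [Finset.mem_coe, Finset.mem_filter, mem_cloneFill] at hy hy'
      funext e
      exact Prod.ext ((hy.2 e).trans (hy'.2 e).symm)
        (Prod.ext (congrFun h e) ((hy.1.2 e).trans (hy'.1.2 e).symm))
    have h2 := card_planted_mem_mul (μ := μ) (u := fun e : U => e.1) Subtype.val_injective X Y
      (Finset.filter_subset _ _)
    have h3 : ((planted n m d k μ).filter fun Ψ => (fun e : U => Ψ e.1) ∈ Y) =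
        (planted n m d k μ).filter fun Ψ => (∀ p ∈ U, Ψ.var p = w p) ∧
        ∀ e : U, Ψ.sgn e = X e := by
      ext Ψ
      simp only [Finset.mem_filter, hY, mem_cloneFill]
      constructor
      · rintro ⟨h1, ⟨_, h2⟩, h3⟩
        exact ⟨h1, fun p hp => h3 ⟨p, hp⟩, h2⟩
      · rintro ⟨h1, h3, h2⟩
        exact ⟨h1, ⟨fun a b hab => Subtype.ext (Ψ.injective hab), h2⟩, fun e => h3 e e.2⟩
    rw [h3] at h2
    have h4 := descFactorial_le_card_cloneFill (n := n) (d := d) X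
    rw [Fintype.card_coe] at h4
    exact (Nat.mul_le_mul_left _ h4).trans (h2.le.trans (Nat.mul_le_mul_right _ hYc))
  have h5 : ∀ A : Formula n m d k → Prop, ((planted n m d k μ).filter A).card =
      ∑ X : U → ℤˣ, ((planted n m d k μ).filter fun Ψ => A Ψ ∧ ∀ e : U, Ψ.sgn e = X e).card := by
    intro A
    rw [Finset.card_eq_sum_card_fiberwise (f := fun (Ψ : Formula n m d k) (e : U) => Ψ.sgn e.1)
      (t := Finset.univ) (by simp [Set.MapsTo])]
    refine Finset.sum_congr rfl fun X _ => ?_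
    rw [Finset.filter_filter]
    simp only [funext_iff]
  have h6 := h5 fun _ => True
  simp only [Finset.filter_true, true_and] at h6
  have h7 : ((planted n m d k μ).filter fun Ψ => ∀ p ∈ U, Ψ.var p = w p).card =
      ∑ X : U → ℤˣ, ((planted n m d k μ).filter fun Ψ => (∀ p ∈ U, Ψ.var p = w p) ∧
        ∀ e : U, Ψ.sgn e = X e).card := by
    convert h5 fun Ψ => ∀ p ∈ U, Ψ.var p = w p
  rw [h7, h6, Finset.sum_mul, Finset.mul_sum]
  exact Finset.sum_le_sum fun X _ => h1 X

theorem card_assignments_mul {H : Type*} [Fintype H] {v : H → Fin n} (hv : Function.Injective v)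
    (z : H → ℤˣ) :
    (Finset.univ.filter fun τ : Fin n → ℤˣ => ∀ h, τ (v h) = z h).card * 2 ^ Fintype.card H =
      2 ^ n := by
  have h1 : ∀ z z' : H → ℤˣ, (Finset.univ.filter fun τ : Fin n → ℤˣ => ∀ h, τ (v h) = z h).card ≤
      (Finset.univ.filter fun τ : Fin n → ℤˣ => ∀ h, τ (v h) = z' h).card := by
    intro z z'
    -- Multiplication by `w` turns the prescribed values `z` into `z'`, so all prescriptions have
    -- equally many solutions.
    set w : Fin n → ℤˣ := Function.extend v (fun h => z h * z' h) 1
    have hw : ∀ h, w (v h) = z h * z' h := fun h => hv.extend_apply _ _ h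
    refine Finset.card_le_card_of_injOn (fun τ i => τ i * w i) ?_ ?_
    · intro τ hτ
      simp only [Finset.mem_coe, Finset.mem_filter, Finset.mem_univ, true_and] at hτ ⊢
      intro h
      rw [hτ h, hw, ← mul_assoc, Int.units_mul_self, one_mul]
    · intro τ _ τ' _ h
      funext i
      exact mul_right_cancel (congrFun h i)
  have h2 : 2 ^ n = ∑ z' : H → ℤˣ,
      (Finset.univ.filter fun τ : Fin n → ℤˣ => ∀ h, τ (v h) = z' h).card := by
    have : Fintype.card (Fin n → ℤˣ) = 2 ^ n := by simp
    rw [← this, ← Finset.card_univ,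
      Finset.card_eq_sum_card_fiberwise (f := fun (τ : Fin n → ℤˣ) h => τ (v h))
        (t := Finset.univ) (by simp [Set.MapsTo])]
    simp only [funext_iff]
  rw [h2, Finset.sum_congr rfl fun z' _ => le_antisymm (h1 z' z) (h1 z z')]
  simp [mul_comm]

end Symmetry

/-! ### Rotations and the smallest clause -/

section ClauseOrder
open scoped Classical

/-- For injective clauses, exactly one rotation of each cycle puts the smallest clause first. This
is the source of the factor 1/l in λ. -/
theorem card_injective_start_min {T : Type*} [Fintype T] [DecidableEq T] (s : T → SignPattern)
    (m : ℕ) :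
    (Finset.univ.filter fun c : Node s → Fin m => Function.Injective c ∧
        ∀ t i, c ⟨t, 0⟩ ≤ c ⟨t, i⟩).card * ∏ t, ((s t).1 + 1) =
      (Finset.univ.filter fun c : Node s → Fin m => Function.Injective c).card := by
  let rot : (∀ t, Fin ((s t).1 + 1)) → (Node s ≃ Node s) := fun ρ =>
    Equiv.sigmaCongrRight fun t => Equiv.addRight (ρ t)
  have hrot : ∀ ρ t i, rot ρ ⟨t, i⟩ = ⟨t, i + ρ t⟩ := fun _ _ _ => rfl
  have h1 : ∀ c : Node s → Fin m, Function.Injective c →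
      (Finset.univ.filter fun ρ : ∀ t, Fin ((s t).1 + 1) =>
        ∀ t i, c (rot ρ ⟨t, 0⟩) ≤ c (rot ρ ⟨t, i⟩)).card = 1 := by
    intro c hc
    rw [Finset.card_eq_one]
    have : ∀ t, ∃ i₀, ∀ i, c ⟨t, i₀⟩ ≤ c ⟨t, i⟩ := fun t => by
      obtain ⟨i₀, _, h⟩ := Finset.exists_min_image (Finset.univ : Finset (Fin ((s t).1 + 1)))
        (fun i => c ⟨t, i⟩) ⟨0, Finset.mem_univ _⟩
      exact ⟨i₀, fun i => h i (Finset.mem_univ i)⟩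
    choose ρ hρ using this
    refine ⟨ρ, ?_⟩
    ext ρ'
    simp only [Finset.mem_filter, Finset.mem_univ, true_and, Finset.mem_singleton, hrot, zero_add]
    constructor
    · intro h
      funext t
      have h2 := h t (ρ t - ρ' t)
      rw [sub_add_cancel] at h2
      have := hc (le_antisymm h2 (hρ t (ρ' t)))
      simpa using this
    · rintro rfl t i
      exact hρ t _
  have h2 : ∀ ρ, (Finset.univ.filter fun c : Node s → Fin m => Function.Injective c ∧
      ∀ t i, c (rot ρ ⟨t, 0⟩) ≤ c (rot ρ ⟨t, i⟩)).card =
      (Finset.univ.filter fun c : Node s → Fin m => Function.Injective c ∧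
        ∀ t i, c ⟨t, 0⟩ ≤ c ⟨t, i⟩).card := by
    intro ρ
    refine Finset.card_bij' (fun c _ => c ∘ rot ρ) (fun c _ => c ∘ (rot ρ).symm) ?_ ?_ ?_ ?_
    · intro c hc
      simp only [Finset.mem_filter, Finset.mem_univ, true_and] at hc ⊢
      exact ⟨hc.1.comp (rot ρ).injective, hc.2⟩
    · intro c hc
      simp only [Finset.mem_filter, Finset.mem_univ, true_and] at hc ⊢
      exact ⟨hc.1.comp (rot ρ).symm.injective, by simpa using hc.2⟩
    · intro c _; funext x; simp
    · intro c _; funext x; simp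
  have h3 : (Finset.univ.filter fun c : Node s → Fin m => Function.Injective c).card =
      ∑ c ∈ Finset.univ.filter fun c : Node s → Fin m => Function.Injective c,
        (Finset.univ.filter fun ρ : ∀ t, Fin ((s t).1 + 1) =>
          ∀ t i, c (rot ρ ⟨t, 0⟩) ≤ c (rot ρ ⟨t, i⟩)).card := by
    rw [Finset.sum_congr rfl fun c hc => h1 c (Finset.mem_filter.1 hc).2]
    simp
  rw [h3]
  simp_rw [Finset.card_filter (fun ρ : ∀ t, Fin ((s t).1 + 1) => _)]
  rw [Finset.sum_comm]
  simp_rw [← Finset.card_filter, Finset.filter_filter, h2]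
  simp [mul_comm]

end ClauseOrder

/-! ### Truth value patterns of the clauses in the planted model -/

section PlantedRows
open scoped Classical

variable {n m d k : ℕ} {μ : ClausePattern k → ℝ}

/-- Integrality provides a table of clauses with profile μ. Balance makes both signs occur equally
often in it, hence n d times each, so the slots of each sign can be matched with the clones of that
sign. -/
theorem planted_nonempty (hμ : IsClauseMarginal m μ) (hmk : m * k = 2 * d * n) :
    (planted n m d k μ).Nonempty := by
  have hz : ∀ σ, ∃ z : ℕ, (m : ℝ) * μ σ = z := by
    intro σ
    obtain ⟨z, hz⟩ := hμ.integral σ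
    have h0 : (0 : ℝ) ≤ z := by rw [← hz]; exact mul_nonneg (by positivity) (hμ.nonneg σ)
    have h1 : 0 ≤ z := by exact_mod_cast h0
    refine ⟨z.toNat, ?_⟩
    rw [hz]
    exact_mod_cast (Int.toNat_of_nonneg h1).symm
  choose z hz using hz
  have hsum : ∑ σ, z σ = m := by
    have : (∑ σ, (z σ : ℝ)) = m := by
      simp_rw [← hz, ← Finset.mul_sum, hμ.sum_eq_one, mul_one]
    exact_mod_cast this
  have hbal : ∑ σ : ClausePattern k, (z σ : ℤ) * entrySum σ.1 = 0 := by
    have : ∑ σ : ClausePattern k, (z σ : ℝ) * (entrySum σ.1 : ℝ) = 0 := by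
      simp_rw [← hz, mul_assoc, ← Finset.mul_sum, hμ.balanced, mul_zero]
    exact_mod_cast this
  let e : Fin m ≃ Σ σ : ClausePattern k, Fin (z σ) :=
    (Fintype.equivFinOfCardEq (by simp [hsum])).symm
  let A : Fin m × Fin k → ℤˣ := fun p => (e p.1).1.1 p.2
  have hA0 : ∑ p, ((A p : ℤˣ) : ℤ) = 0 := by
    rw [Fintype.sum_prod_type, ← e.symm.sum_comp, Fintype.sum_sigma]
    simp only [A, Equiv.apply_symm_apply]
    simpa [entrySum] using hbal
  have hcard : ∀ y : ℤˣ, Fintype.card {p // A p = y} = Fintype.card (Fin n × Fin d) := by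
    have h1 : (∑ p, ((A p : ℤˣ) : ℤ)) = (Fintype.card {p // A p = 1} : ℤ) -
        Fintype.card {p // A p = -1} := by
      rw [Fintype.card_subtype, Fintype.card_subtype, Finset.card_filter, Finset.card_filter]
      push_cast
      rw [← Finset.sum_sub_distrib]
      refine Finset.sum_congr rfl fun p _ => ?_
      rcases Int.units_eq_one_or (A p) with h | h <;> rw [h] <;> decide
    have h2 : Fintype.card {p // A p = 1} + Fintype.card {p // A p = -1} = 2 * d * n := by
      rw [← hmk, Fintype.card_subtype, Fintype.card_subtype, Finset.card_filter,
        Finset.card_filter, ← Finset.sum_add_distrib]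
      have : Fintype.card (Fin m × Fin k) = m * k := by simp
      rw [← this, ← Finset.card_univ, Finset.card_eq_sum_ones]
      refine Finset.sum_congr rfl fun p _ => ?_
      rcases Int.units_eq_one_or (A p) with h | h <;> rw [h] <;> decide
    rw [hA0] at h1
    have h3 : Fintype.card (Fin n × Fin d) = n * d := by simp
    have h4 : 2 * d * n = 2 * (n * d) := by ring
    intro y
    rw [h3]
    rcases Int.units_eq_one_or y with h | h <;> rw [h] <;> omega
  let f : ∀ y : ℤˣ, {p // A p = y} ≃ Fin n × Fin d := fun y => Fintype.equivOfCardEq (hcard y)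
  let w : (Σ _ : ℤˣ, Fin n × Fin d) ≃ Fin n × Fin d × ℤˣ :=
    { toFun := fun y => (y.2.1, y.2.2, y.1)
      invFun := fun y => ⟨y.2.2, y.1, y.2.1⟩
      left_inv := fun _ => rfl
      right_inv := fun _ => rfl }
  let Ψ : Formula n m d k :=
    (Equiv.sigmaFiberEquiv A).symm.trans ((Equiv.sigmaCongrRight f).trans w)
  have hrow : ∀ i, row Ψ i = (e i).1.1 := fun i => rfl
  refine ⟨Ψ, mem_planted.2 fun σ => ?_⟩
  rw [hz]
  congr 1
  have h5 : (Finset.univ : Finset (Fin (z σ))).card =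
      (Finset.univ.filter fun i => row Ψ i = σ.1).card := by
    refine Finset.card_bij (fun j _ => e.symm ⟨σ, j⟩) ?_ ?_ ?_
    · intro j _
      simp only [Finset.mem_filter, Finset.mem_univ, true_and, hrow, Equiv.apply_symm_apply]
    · intro j _ j' _ h
      simpa using h
    · intro i hi
      simp only [Finset.mem_filter, Finset.mem_univ, true_and, hrow] at hi
      have h' : (e i).1 = σ := Subtype.ext hi
      subst h'
      exact ⟨(e i).2, Finset.mem_univ _, e.symm_apply_apply i⟩
  rw [← h5, Finset.card_univ, Fintype.card_fin]

theorem card_rows_eq {Ψ : Formula n m d k} (hμ : ∑ σ, μ σ = 1) (hΨ : Ψ ∈ planted n m d k μ)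
    (Q : (Fin k → ℤˣ) → Prop) :
    ((Finset.univ.filter fun i => Q (row Ψ i)).card : ℝ) =
      m * ∑ σ : ClausePattern k, if Q σ.1 then μ σ else 0 := by
  rw [mem_planted] at hΨ
  have hdec : ∀ P : (Fin k → ℤˣ) → Prop, (Finset.univ.filter fun i => P (row Ψ i)).card =
      ∑ σ : Fin k → ℤˣ, if P σ then (Finset.univ.filter fun i => row Ψ i = σ).card else 0 := by
    intro P
    rw [Finset.card_eq_sum_card_fiberwise (f := row Ψ) (t := Finset.univ)
      (by simp [Set.MapsTo])]
    refine Finset.sum_congr rfl fun σ _ => ?_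
    rw [Finset.filter_filter]
    split_ifs with h
    · congr 1
      ext i
      simp only [Finset.mem_filter, Finset.mem_univ, true_and]
      exact ⟨fun hi => hi.2, fun hi => ⟨hi ▸ h, hi⟩⟩
    · rw [Finset.card_eq_zero, Finset.filter_eq_empty_iff]
      rintro i _ ⟨h1, h2⟩
      exact h (h2 ▸ h1)
  have hsplit : ∀ P : (Fin k → ℤˣ) → Prop,
      ((Finset.univ.filter fun i => P (row Ψ i)).card : ℝ) =
      m * (∑ σ : ClausePattern k, if P σ.1 then μ σ else 0) +
        if P (fun _ => -1) then
          ((Finset.univ.filter fun i => row Ψ i = fun _ => -1).card : ℝ) else 0 := by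
    intro P
    rw [hdec P]
    push_cast
    rw [← Finset.add_sum_erase Finset.univ _ (Finset.mem_univ (fun _ => (-1 : ℤˣ))), add_comm]
    congr 1
    have hsub : ∀ F : (Fin k → ℤˣ) → ℝ, ∑ σ ∈ Finset.univ.erase (fun _ => (-1 : ℤˣ)), F σ =
        ∑ σ : ClausePattern k, F σ.1 := fun F => Finset.sum_subtype _ (by simp) F
    rw [hsub, Finset.mul_sum]
    refine Finset.sum_congr rfl fun σ _ => ?_
    split_ifs
    · exact hΨ σ
    · simp
  -- The satisfying patterns already account for all m clauses, so the profile excludes the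
  -- all-false row without requiring it explicitly.
  have h0 : (Finset.univ.filter fun i => row Ψ i = fun _ => -1).card = 0 := by
    have := hsplit fun _ => True
    simp only [Finset.filter_true, Finset.card_univ, Fintype.card_fin, if_true, hμ, mul_one] at this
    have h1 : ((Finset.univ.filter fun i => row Ψ i = fun _ => -1).card : ℝ) = 0 := by linarith
    exact_mod_cast h1
  rw [hsplit Q, h0]
  simp

/-- Without injectivity the number of clause tuples is exactly the product; the error is at most the
number of non-injective tuples. -/
theorem card_clauses_rows_bounds {H : Type*} [Fintype H] [DecidableEq H] {Ψ : Formula n m d k}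
    (hμ : ∑ σ, μ σ = 1) (hΨ : Ψ ∈ planted n m d k μ) (Q : H → (Fin k → ℤˣ) → Prop) :
    (m : ℝ) ^ Fintype.card H * ∏ h, (∑ σ : ClausePattern k, if Q h σ.1 then μ σ else 0) -
        ((m : ℝ) ^ Fintype.card H - m.descFactorial (Fintype.card H)) ≤
      ((Finset.univ.filter fun c : H → Fin m =>
        Function.Injective c ∧ ∀ h, Q h (row Ψ (c h))).card : ℝ) ∧
    ((Finset.univ.filter fun c : H → Fin m =>
        Function.Injective c ∧ ∀ h, Q h (row Ψ (c h))).card : ℝ) ≤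
      (m : ℝ) ^ Fintype.card H * ∏ h, (∑ σ : ClausePattern k, if Q h σ.1 then μ σ else 0) := by
  have h1 : ((Finset.univ.filter fun c : H → Fin m => ∀ h, Q h (row Ψ (c h))).card : ℝ) =
      (m : ℝ) ^ Fintype.card H *
        ∏ h, (∑ σ : ClausePattern k, if Q h σ.1 then μ σ else 0) := by
    have : (Finset.univ.filter fun c : H → Fin m => ∀ h, Q h (row Ψ (c h))) =
        Fintype.piFinset fun h => Finset.univ.filter fun i => Q h (row Ψ i) := by
      ext c; simp
    rw [this, Fintype.card_piFinset]
    push_cast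
    simp_rw [card_rows_eq hμ hΨ, Finset.prod_mul_distrib]
    simp
  have h2 : (Finset.univ.filter fun c : H → Fin m => Function.Injective c).card =
      m.descFactorial (Fintype.card H) := by
    have : Fintype.card (H ↪ Fin m) = m.descFactorial (Fintype.card H) := by
      simp [Fintype.card_embedding_eq]
    rw [← this, ← Fintype.card_subtype]
    exact Fintype.card_congr (Equiv.subtypeInjectiveEquivEmbedding H (Fin m))
  have h3 : (Finset.univ.filter fun c : H → Fin m => ¬ Function.Injective c).card +
      m.descFactorial (Fintype.card H) = m ^ Fintype.card H := by
    have := Finset.card_filter_add_card_filter_not (s := (Finset.univ : Finset (H → Fin m)))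
      (fun c => Function.Injective c)
    rw [h2] at this
    simp only [Finset.card_univ, Fintype.card_fun, Fintype.card_fin] at this
    omega
  have h3' : ((Finset.univ.filter fun c : H → Fin m => ¬ Function.Injective c).card : ℝ) +
      m.descFactorial (Fintype.card H) = (m : ℝ) ^ Fintype.card H := by exact_mod_cast h3
  rw [← h1]
  constructor
  · have h4 : (Finset.univ.filter fun c : H → Fin m => ∀ h, Q h (row Ψ (c h))).card ≤
        (Finset.univ.filter fun c : H → Fin m =>
          Function.Injective c ∧ ∀ h, Q h (row Ψ (c h))).card +
        (Finset.univ.filter fun c : H → Fin m => ¬ Function.Injective c).card := by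
      refine (Finset.card_le_card ?_).trans (Finset.card_union_le _ _)
      intro c hc
      simp only [Finset.mem_filter, Finset.mem_univ, true_and, Finset.mem_union] at hc ⊢
      tauto
    have h4' : ((Finset.univ.filter fun c : H → Fin m => ∀ h, Q h (row Ψ (c h))).card : ℝ) ≤
        (Finset.univ.filter fun c : H → Fin m =>
          Function.Injective c ∧ ∀ h, Q h (row Ψ (c h))).card +
        (Finset.univ.filter fun c : H → Fin m => ¬ Function.Injective c).card := by
      exact_mod_cast h4
    linarith
  · refine Nat.cast_le.2 (Finset.card_le_card ?_)
    intro c hc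
    simp only [Finset.mem_filter, Finset.mem_univ, true_and] at hc ⊢
    exact hc.2

end PlantedRows

/-! ### Placing clones along a cycle -/

section CycleFill
open scoped Classical

/-- The truth values of the two slots of each variable node. -/
def pairSigns {H : Type*} (x e : H → ℤˣ) (p : H × Bool) : ℤˣ :=
  if p.2 then x p.1 * e p.1 else x p.1

/-- The choices of clones for which the two slots of each node carry the same variable, and
different nodes different variables. -/
noncomputable def cycleFill {H : Type*} [Fintype H] (n d : ℕ) (x e : H → ℤˣ) :
    Finset (H × Bool → Fin n × Fin d × ℤˣ) :=
  (cloneFill n d (pairSigns x e)).filter fun y =>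
    (∀ h, (y (h, false)).1 = (y (h, true)).1) ∧ Function.Injective fun h => (y (h, false)).1

/-- The variables are chosen injectively. If `e h = 1`, both slots use the same literal and need
different clones, d(d-1) choices; otherwise they use opposite literals, d² choices. -/
theorem card_cycleFill {H : Type*} [Fintype H] [DecidableEq H] (n d : ℕ) (x e : H → ℤˣ) :
    (cycleFill n d x e).card =
      n.descFactorial (Fintype.card H) * ∏ h, if e h = 1 then d * d - d else d * d := by
  have h1 : ∀ h, Fintype.card {z : Fin d × Fin d // e h = 1 → z.1 ≠ z.2} =
      if e h = 1 then d * d - d else d * d := by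
    intro h
    rw [Fintype.card_subtype]
    split_ifs with he
    · have : (Finset.univ.filter fun z : Fin d × Fin d => e h = 1 → z.1 ≠ z.2) =
          (Finset.univ : Finset (Fin d)).offDiag := by
        ext z; simp [he]
      rw [this, Finset.offDiag_card]
      simp
    · simp [he]
  have h2 : Fintype.card ((H ↪ Fin n) × (∀ h, {z : Fin d × Fin d // e h = 1 → z.1 ≠ z.2})) =
      n.descFactorial (Fintype.card H) * ∏ h, if e h = 1 then d * d - d else d * d := by
    rw [Fintype.card_prod, Fintype.card_embedding_eq, Fintype.card_pi, Fintype.card_fin]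
    simp_rw [h1]
  rw [← h2, ← Finset.card_univ]
  symm
  refine Finset.card_bij (fun fκ _ p => (fκ.1 p.1,
    (if p.2 then (fκ.2 p.1).1.2 else (fκ.2 p.1).1.1), pairSigns x e p)) ?_ ?_ ?_
  · rintro ⟨f, κ⟩ _
    rw [cycleFill, Finset.mem_filter, mem_cloneFill]
    refine ⟨⟨?_, fun p => rfl⟩, fun h => rfl, f.injective⟩
    rintro ⟨h, b⟩ ⟨h', b'⟩ hp
    simp only [Prod.mk.injEq] at hp
    obtain ⟨hf, hκ, hx⟩ := hp
    have := f.injective hf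
    subst this
    have key : x h = x h * e h → (κ h).1.1 ≠ (κ h).1.2 := fun hh => (κ h).2 (by simpa using hh)
    cases b <;> cases b' <;> simp [pairSigns] at hκ hx ⊢
    · exact key (by simp [hx]) hκ
    · exact key (by simp [hx]) hκ.symm
  · rintro ⟨f, κ⟩ _ ⟨f', κ'⟩ _ hh
    have hh' := fun p => congrFun hh p
    simp only [Prod.mk.injEq] at hh'
    refine Prod.ext ?_ ?_
    · ext h : 1
      exact (hh' (h, false)).1
    · funext h
      refine Subtype.ext (Prod.ext ?_ ?_)
      · simpa using (hh' (h, false)).2.1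
      · simpa using (hh' (h, true)).2.1
  · intro y hy
    rw [cycleFill, Finset.mem_filter, mem_cloneFill] at hy
    obtain ⟨⟨hy1, hy2⟩, hy3, hy4⟩ := hy
    refine ⟨(⟨_, hy4⟩, fun h => ⟨((y (h, false)).2.1, (y (h, true)).2.1), ?_⟩),
      Finset.mem_univ _, ?_⟩
    · intro he hne
      have : y (h, false) = y (h, true) := by
        refine Prod.ext (hy3 h) (Prod.ext hne ?_)
        rw [hy2, hy2]
        simp [pairSigns, he]
      simpa using hy1 this
    · funext p
      obtain ⟨h, b⟩ := p
      cases b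
      · refine Prod.ext rfl (Prod.ext ?_ (hy2 (h, false)).symm)
        simp
      · refine Prod.ext (hy3 h) (Prod.ext ?_ (hy2 (h, true)).symm)
        simp

end CycleFill

/-! ### Expected number of vertex-disjoint families -/

section DisjointFamilies
open scoped Classical

variable {T : Type*} {s : T → SignPattern}
variable {n m d k : ℕ} {μ : ClausePattern k → ℝ}

/-- The product of the two signs at a variable node. -/
def edgeSign (s : T → SignPattern) (h : Node s) : ℤˣ :=
  ((s h.1).2 h.2).1 * ((s h.1).2 h.2).2

/-- The two slots of each variable node. -/
def endSlot (c : Node s → Fin m) (g : Node s → Fin k × Fin k) (p : Node s × Bool) :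
    Fin m × Fin k := if p.2 then (slots c g p.1).2 else (slots c g p.1).1

/-- The truth values prescribed in the clause at node `h`. -/
def rowCond (x e : Node s → ℤˣ) (g : Node s → Fin k × Fin k) (h : Node s) (σ : Fin k → ℤˣ) :
    Prop := σ (g h).1 = x h ∧ σ (g h).2 = x ((nxt s).symm h) * e ((nxt s).symm h)

theorem endSlot_injective {c : Node s → Fin m} {g : Node s → Fin k × Fin k}
    (hc : Function.Injective c) (hg : ∀ h, (g h).1 ≠ (g h).2) :
    Function.Injective (endSlot c g) := by
  have key : ∀ h h', (slots c g h).1 ≠ (slots c g h').2 := by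
    intro h h' he
    have h1 : h = nxt s h' := hc (congrArg Prod.fst he)
    subst h1
    exact hg _ (congrArg Prod.snd he)
  rintro ⟨h, b⟩ ⟨h', b'⟩ he
  cases b <;> cases b' <;> simp only [endSlot, Bool.false_eq_true, if_true, if_false] at he
  · rw [hc (congrArg Prod.fst he)]
  · exact absurd he (key _ _)
  · exact absurd he.symm (key _ _)
  · rw [(nxt s).injective (hc (congrArg Prod.fst he))]

theorem forall_sgn_endSlot_iff (Ψ : Formula n m d k) (x e : Node s → ℤˣ) (c : Node s → Fin m)
    (g : Node s → Fin k × Fin k) :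
    (∀ p, Ψ.sgn (endSlot c g p) = pairSigns x e p) ↔ ∀ h, rowCond x e g h (row Ψ (c h)) := by
  constructor
  · intro h h'
    refine ⟨h (h', false), ?_⟩
    have := h ((nxt s).symm h', true)
    simp only [endSlot, pairSigns, slots, if_true, Equiv.apply_symm_apply] at this
    exact this
  · rintro h ⟨h', b⟩
    cases b
    · exact (h h').1
    · have := (h (nxt s h')).2
      rw [Equiv.symm_apply_apply] at this
      exact this

variable [Fintype T] [DecidableEq T]

/-- The admissible positions of a family of vertex-disjoint cycles. -/
noncomputable def goodPositions (s : T → SignPattern) (k : ℕ) : Finset (Node s → Fin k × Fin k) :=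
  Finset.univ.filter fun g => (∀ h, (g h).1 ≠ (g h).2) ∧ ∀ t, (g ⟨t, 0⟩).1 < (g ⟨t, 0⟩).2

theorem mem_goodPositions {g : Node s → Fin k × Fin k} : g ∈ goodPositions s k ↔
    (∀ h, (g h).1 ≠ (g h).2) ∧ ∀ t, (g ⟨t, 0⟩).1 < (g ⟨t, 0⟩).2 := by
  simp [goodPositions]

/-- Here `x` records the planted truth value in the first slot of each variable node. The product of
the two signs at a node is unaffected by twisting, which determines the second truth value; the
individual signs then determine τ there. This separates a condition on Ψ from one on τ. -/
theorem disjoint_cycles_twist_iff {c : Node s → Fin m} {g : Node s → Fin k × Fin k}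
    (hc : Function.Injective c) (hmin : ∀ t i, c ⟨t, 0⟩ ≤ c ⟨t, i⟩) (hg : g ∈ goodPositions s k)
    (τ : Fin n → ℤˣ) (Ψ : Formula n m d k) :
    (AllCycles (twist τ Ψ) c g ∧ Function.Injective (nodeVar (twist τ Ψ) c g)) ↔
      ∃ x : Node s → ℤˣ, (fun p => Ψ (endSlot c g p)) ∈ cycleFill n d x (edgeSign s) ∧
        ∀ h, τ (nodeVar Ψ c g h) = ((s h.1).2 h.2).1 * x h := by
  rw [mem_goodPositions] at hg
  constructor
  · rintro ⟨hall, hinj⟩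
    have hsv : ∀ h, Ψ.var (slots c g h).1 = Ψ.var (slots c g h).2 := fun h =>
      (hall h.1).same_var h.2
    have hs : ∀ h, (Ψ.sgn (slots c g h).1 * τ (nodeVar Ψ c g h),
        Ψ.sgn (slots c g h).2 * τ (nodeVar Ψ c g h)) = (s h.1).2 h.2 := by
      intro h
      have := (hall h.1).signs h.2
      rw [← this]
      simp only [sgn_twist, nodeVar, ← hsv]
    refine ⟨fun h => Ψ.sgn (slots c g h).1, ?_, ?_⟩
    · rw [cycleFill, Finset.mem_filter, mem_cloneFill]
      refine ⟨⟨fun p p' hp => endSlot_injective hc hg.1 (Ψ.injective hp), ?_⟩, hsv, hinj⟩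
      rintro ⟨h, b⟩
      cases b
      · rfl
      · have h1 : Ψ.sgn (slots c g h).2 =
            Ψ.sgn (slots c g h).1 * edgeSign s h := by
          rw [edgeSign, ← hs h]
          simp only
          rw [mul_mul_mul_comm, Int.units_mul_self, mul_one, ← mul_assoc, Int.units_mul_self,
            one_mul]
        exact h1
    · intro h
      rw [← hs h]
      simp only
      rw [mul_right_comm, Int.units_mul_self, one_mul]
  · rintro ⟨x, hx, hτ⟩
    rw [cycleFill, Finset.mem_filter, mem_cloneFill] at hx
    obtain ⟨⟨-, hx1⟩, hx2, hx3⟩ := hx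
    have hsv : ∀ h, Ψ.var (slots c g h).1 = Ψ.var (slots c g h).2 := hx2
    have ha : ∀ h, Ψ.sgn (slots c g h).1 = x h := fun h => hx1 (h, false)
    have hb : ∀ h, Ψ.sgn (slots c g h).2 = x h * edgeSign s h := fun h => hx1 (h, true)
    have hvinj : Function.Injective (nodeVar Ψ c g) := hx3
    refine ⟨fun t => ⟨fun i => hmin t i, ?_, fun i => rfl, fun i => hsv _, ?_, ?_, ?_⟩, hx3⟩
    · intro i j hij
      have := hc hij
      simpa using this
    · intro i j hij
      have := hvinj hij
      simpa using this
    · have := hg.2 t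
      simp only [slots, nxt_mk, Fin.last_add_one]
      exact this
    · intro i
      have h1 := hτ ⟨t, i⟩
      rw [sgn_twist, sgn_twist, ← hsv, ha, hb]
      change (x ⟨t, i⟩ * τ (nodeVar Ψ c g ⟨t, i⟩), x ⟨t, i⟩ * edgeSign s ⟨t, i⟩ *
        τ (nodeVar Ψ c g ⟨t, i⟩)) = _
      rw [h1, edgeSign]
      refine Prod.ext ?_ ?_
      · simp only
        rw [mul_left_comm, Int.units_mul_self, mul_one]
      · simp only
        have e1 : ∀ x a b : ℤˣ, x * (a * b) * (a * x) = (x * x) * (a * a) * b := by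
          intro x a b; ac_rfl
        rw [e1, Int.units_mul_self, Int.units_mul_self, one_mul, one_mul]

theorem card_twist_cycles_mul {c : Node s → Fin m} {g : Node s → Fin k × Fin k}
    (hc : Function.Injective c) (hmin : ∀ t i, c ⟨t, 0⟩ ≤ c ⟨t, i⟩) (hg : g ∈ goodPositions s k)
    (Ψ : Formula n m d k) :
    (Finset.univ.filter fun τ : Fin n → ℤˣ => AllCycles (twist τ Ψ) c g ∧
        Function.Injective (nodeVar (twist τ Ψ) c g)).card * 2 ^ Fintype.card (Node s) =
      2 ^ n * (Finset.univ.filter fun x : Node s → ℤˣ =>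
        (fun p => Ψ (endSlot c g p)) ∈ cycleFill n d x (edgeSign s)).card := by
  simp_rw [disjoint_cycles_twist_iff hc hmin hg]
  -- At most one `x` is possible for a given Ψ, so summing over `x` counts nothing twice.
  have huniq : ∀ x, (fun p => Ψ (endSlot c g p)) ∈ cycleFill n d x (edgeSign s) →
      x = fun h => Ψ.sgn (endSlot c g (h, false)) := by
    intro x hx
    rw [cycleFill, Finset.mem_filter, mem_cloneFill] at hx
    funext h
    exact (hx.1.2 (h, false)).symm
  by_cases hex : ∃ x, (fun p => Ψ (endSlot c g p)) ∈ cycleFill n d x (edgeSign s)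
  · obtain ⟨x, hx⟩ := hex
    have h1 : (Finset.univ.filter fun x : Node s → ℤˣ =>
        (fun p => Ψ (endSlot c g p)) ∈ cycleFill n d x (edgeSign s)) = {x} := by
      ext x'
      simp only [Finset.mem_filter, Finset.mem_univ, true_and, Finset.mem_singleton]
      exact ⟨fun h => (huniq x' h).trans (huniq x hx).symm, fun h => h ▸ hx⟩
    have h2 : (Finset.univ.filter fun τ : Fin n → ℤˣ => ∃ x : Node s → ℤˣ,
        (fun p => Ψ (endSlot c g p)) ∈ cycleFill n d x (edgeSign s) ∧
        ∀ h, τ (nodeVar Ψ c g h) = ((s h.1).2 h.2).1 * x h) =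
        Finset.univ.filter fun τ : Fin n → ℤˣ =>
          ∀ h, τ (nodeVar Ψ c g h) = ((s h.1).2 h.2).1 * x h := by
      ext τ
      simp only [Finset.mem_filter, Finset.mem_univ, true_and]
      constructor
      · rintro ⟨x', hx', h⟩
        rwa [(huniq x' hx').trans (huniq x hx).symm] at h
      · intro h
        exact ⟨x, hx, h⟩
    rw [h1, h2, Finset.card_singleton, mul_one]
    rw [cycleFill, Finset.mem_filter] at hx
    have := card_assignments_mul (v := nodeVar Ψ c g) hx.2.2
      (fun h => ((s h.1).2 h.2).1 * x h)
    convert this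
  · push Not at hex
    rw [Finset.filter_false_of_mem fun x _ => hex x, Finset.filter_false_of_mem]
    · simp
    · rintro τ _ ⟨x, hx, _⟩
      exact hex x hx

/-- The number of families of vertex-disjoint cycles. -/
noncomputable def disjointCount (s : T → SignPattern) (Φ : Formula n m d k) : ℕ :=
  ((cycleFamilies s Φ).filter fun cg =>
    Function.Injective cg.1 ∧ Function.Injective (nodeVar Φ cg.1 cg.2)).card

/-- The number of families of distinct cycles that are not vertex-disjoint. -/
noncomputable def overlapCount (s : T → SignPattern) (Φ : Formula n m d k) : ℕ :=
  ((cycleFamilies s Φ).filter fun cg =>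
    ¬ (Function.Injective cg.1 ∧ Function.Injective (nodeVar Φ cg.1 cg.2))).card

theorem disjointCount_add_overlapCount (s : T → SignPattern) (Φ : Formula n m d k) :
    disjointCount s Φ + overlapCount s Φ = (cycleFamilies s Φ).card :=
  Finset.card_filter_add_card_filter_not _

theorem disjointCount_eq (s : T → SignPattern) (Φ : Formula n m d k) :
    disjointCount s Φ = ∑ g ∈ goodPositions s k,
      ∑ c ∈ Finset.univ.filter fun c : Node s → Fin m => Function.Injective c ∧
        ∀ t i, c ⟨t, 0⟩ ≤ c ⟨t, i⟩,
        if AllCycles Φ c g ∧ Function.Injective (nodeVar Φ c g) then 1 else 0 := by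
  rw [← Finset.sum_product', ← Finset.card_filter, disjointCount]
  refine Finset.card_bij (fun cg _ => (cg.2, cg.1)) ?_ ?_ ?_
  · rintro ⟨c, g⟩ h
    simp only [Finset.mem_filter, mem_cycleFamilies, Finset.mem_product, Finset.mem_univ, true_and,
      mem_goodPositions] at h ⊢
    obtain ⟨⟨h1, -⟩, h3, h4⟩ := h
    refine ⟨⟨⟨fun h => ?_, fun t => ?_⟩, h3, fun t i => (h1 t).start_min i⟩, h1, h4⟩
    · obtain ⟨p, rfl⟩ := (nxt s).surjective h
      intro he
      exact slots_nxt_fst_ne_snd h1 p (Prod.ext rfl he)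
    · have := (h1 t).orient
      simpa only [slots, nxt_mk, Fin.last_add_one] using this
  · rintro ⟨c, g⟩ _ ⟨c', g'⟩ _ h
    simp only [Prod.mk.injEq] at h
    exact Prod.ext h.2 h.1
  · rintro ⟨g, c⟩ h
    simp only [Finset.mem_filter, Finset.mem_product, Finset.mem_univ, true_and] at h
    obtain ⟨⟨-, h2, -⟩, h3, h4⟩ := h
    refine ⟨(c, g), ?_, rfl⟩
    simp only [Finset.mem_filter, mem_cycleFamilies]
    refine ⟨⟨h3, ?_⟩, h2, h4⟩
    intro t t' ht hl he
    -- Walks with disjoint clauses cannot coincide, so `NoRepeat` is automatic here.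
    have h5 := h2 (congrArg (fun z => z.1.1) (he 0))
    exact ht (congrArg Sigma.fst h5)

theorem card_cloneFill_ne_zero {E : Type*} [Fintype E] (hnd : Fintype.card E ≤ n * d)
    (X : E → ℤˣ) : ((cloneFill n d X).card : ℝ) ≠ 0 := by
  have h1 := descFactorial_le_card_cloneFill (n := n) (d := d) X
  have h2 : 0 < (n * d).descFactorial (Fintype.card E) := by
    rw [Nat.pos_iff_ne_zero, Ne, Nat.descFactorial_eq_zero_iff_lt]
    omega
  exact_mod_cast (lt_of_lt_of_le h2 h1).ne'

theorem sum_twist_indicator {c : Node s → Fin m} {g : Node s → Fin k × Fin k}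
    (hnd : Fintype.card (Node s × Bool) ≤ n * d)
    (hinj : Function.Injective c) (hmin : ∀ t i, c ⟨t, 0⟩ ≤ c ⟨t, i⟩)
    (hg : g ∈ goodPositions s k) (μ : ClausePattern k → ℝ) :
    (∑ τ : Fin n → ℤˣ, ∑ Ψ ∈ planted n m d k μ, if AllCycles (twist τ Ψ) c g ∧
        Function.Injective (nodeVar (twist τ Ψ) c g) then (1 : ℝ) else 0) =
      2 ^ n * ∑ x : Node s → ℤˣ, ((cycleFill n d x (edgeSign s)).card : ℝ) /
        ((cloneFill n d (pairSigns x (edgeSign s))).card * 2 ^ Fintype.card (Node s)) *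
        (((planted n m d k μ).filter fun Ψ =>
          ∀ h, rowCond x (edgeSign s) g h (row Ψ (c h))).card : ℝ) := by
  have h2H : (2 : ℝ) ^ Fintype.card (Node s) ≠ 0 := by positivity
  rw [Finset.sum_comm]
  have e1 : ∀ Ψ : Formula n m d k, (∑ τ : Fin n → ℤˣ, if AllCycles (twist τ Ψ) c g ∧
      Function.Injective (nodeVar (twist τ Ψ) c g) then (1 : ℝ) else 0) =
      2 ^ n / 2 ^ Fintype.card (Node s) * ∑ x : Node s → ℤˣ,
        if (fun p => Ψ (endSlot c g p)) ∈ cycleFill n d x (edgeSign s) then (1 : ℝ) else 0 := by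
    intro Ψ
    have h' := congrArg (Nat.cast (R := ℝ)) (card_twist_cycles_mul (n := n) hinj hmin hg Ψ)
    push_cast at h'
    rw [Finset.sum_boole, Finset.sum_boole, div_mul_eq_mul_div, eq_div_iff h2H]
    exact h'
  rw [Finset.sum_congr rfl fun Ψ _ => e1 Ψ, ← Finset.mul_sum, Finset.sum_comm]
  simp_rw [Finset.sum_boole]
  rw [div_mul_eq_mul_div, mul_div_assoc, Finset.sum_div]
  congr 1
  refine Finset.sum_congr rfl fun x _ => ?_
  have h3 := card_planted_mem_mul (μ := μ) (d := d) (endSlot_injective hinj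
    (mem_goodPositions.1 hg).1) (pairSigns x (edgeSign s)) (cycleFill n d x (edgeSign s))
    (Finset.filter_subset _ _)
  simp_rw [forall_sgn_endSlot_iff] at h3
  have h3' := congrArg (Nat.cast (R := ℝ)) h3
  push_cast at h3'
  have := card_cloneFill_ne_zero hnd (pairSigns x (edgeSign s))
  rw [div_mul_eq_mul_div, div_eq_div_iff h2H (mul_ne_zero this h2H)]
  linear_combination (2 : ℝ) ^ Fintype.card (Node s) * h3'

/-- By exchangeability each injective choice of clauses contributes equally. The restriction to
choices starting at the minimum therefore only divides the sum by the product of the cycle lengths.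
-/
theorem sum_start_min_rows (s : T → SignPattern) (μ : ClausePattern k → ℝ)
    (Q : Node s → (Fin k → ℤˣ) → Prop) :
    (∑ c ∈ Finset.univ.filter fun c : Node s → Fin m => Function.Injective c ∧
        ∀ t i, c ⟨t, 0⟩ ≤ c ⟨t, i⟩, (((planted n m d k μ).filter fun Ψ =>
        ∀ h, Q h (row Ψ (c h))).card : ℝ)) * ∏ t, (((s t).1 : ℝ) + 1) =
      ∑ Ψ ∈ planted n m d k μ, ((Finset.univ.filter fun c : Node s → Fin m =>
          Function.Injective c ∧ ∀ h, Q h (row Ψ (c h))).card : ℝ) := by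
  have e1 : ∑ Ψ ∈ planted n m d k μ, ((Finset.univ.filter fun c : Node s → Fin m =>
        Function.Injective c ∧ ∀ h, Q h (row Ψ (c h))).card : ℝ) =
      ∑ c ∈ Finset.univ.filter fun c : Node s → Fin m => Function.Injective c,
        (((planted n m d k μ).filter fun Ψ => ∀ h, Q h (row Ψ (c h))).card : ℝ) := by
    simp_rw [← Finset.filter_filter, ← Finset.sum_boole]
    rw [Finset.sum_comm]
  rw [e1]
  rcases (Finset.univ.filter fun c : Node s → Fin m => Function.Injective c).eq_empty_or_nonempty
    with he | ⟨c₀, hc₀⟩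
  · rw [← Finset.filter_filter, he]
    simp
  · have hc₀' := (Finset.mem_filter.1 hc₀).2
    have hW : ∀ c : Node s → Fin m, Function.Injective c →
        (((planted n m d k μ).filter fun Ψ => ∀ h, Q h (row Ψ (c h))).card : ℝ) =
        (((planted n m d k μ).filter fun Ψ => ∀ h, Q h (row Ψ (c₀ h))).card : ℝ) :=
      fun c hc => congrArg _ (card_planted_rows_eq Q hc hc₀')
    have hcnt := congrArg (Nat.cast (R := ℝ)) (card_injective_start_min s m)
    push_cast at hcnt
    rw [Finset.sum_congr rfl fun c hc => hW c (Finset.mem_filter.1 hc).2.1,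
      Finset.sum_congr rfl fun c hc => hW c (Finset.mem_filter.1 hc).2]
    simp only [Finset.sum_const, nsmul_eq_mul]
    rw [← hcnt]
    ring

theorem sum_disjointCount (s : T → SignPattern) (hnd : Fintype.card (Node s × Bool) ≤ n * d)
    (μ : ClausePattern k → ℝ) :
    (∑ τ : Fin n → ℤˣ, ∑ Ψ ∈ planted n m d k μ, (disjointCount s (twist τ Ψ) : ℝ)) /
        (2 ^ n * (planted n m d k μ).card) =
      ∑ g ∈ goodPositions s k, ∑ x : Node s → ℤˣ,
        ((cycleFill n d x (edgeSign s)).card : ℝ) /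
          ((cloneFill n d (pairSigns x (edgeSign s))).card * 2 ^ Fintype.card (Node s) *
            ∏ t, (((s t).1 : ℝ) + 1)) *
        ((∑ Ψ ∈ planted n m d k μ, ((Finset.univ.filter fun c : Node s → Fin m =>
          Function.Injective c ∧ ∀ h, rowCond x (edgeSign s) g h (row Ψ (c h))).card : ℝ)) /
          (planted n m d k μ).card) := by
  have hL : (∏ t, (((s t).1 : ℝ) + 1)) ≠ 0 := by positivity
  have h2n : (2 : ℝ) ^ n ≠ 0 := by positivity
  have total : (∑ τ : Fin n → ℤˣ, ∑ Ψ ∈ planted n m d k μ,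
        (disjointCount s (twist τ Ψ) : ℝ)) =
      ∑ g ∈ goodPositions s k, ∑ c ∈ Finset.univ.filter fun c : Node s → Fin m =>
        Function.Injective c ∧ ∀ t i, c ⟨t, 0⟩ ≤ c ⟨t, i⟩,
        ∑ τ : Fin n → ℤˣ, ∑ Ψ ∈ planted n m d k μ,
        if AllCycles (twist τ Ψ) c g ∧
        Function.Injective (nodeVar (twist τ Ψ) c g) then (1 : ℝ) else 0 := by
    simp_rw [disjointCount_eq]
    push_cast
    rw [Finset.sum_congr rfl fun τ _ => Finset.sum_comm, Finset.sum_comm]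
    refine Finset.sum_congr rfl fun g _ => ?_
    rw [Finset.sum_congr rfl fun τ _ => Finset.sum_comm, Finset.sum_comm]
  rw [total, Finset.sum_congr rfl fun g hg => Finset.sum_congr rfl fun c hc =>
    sum_twist_indicator hnd (Finset.mem_filter.1 hc).2.1 (Finset.mem_filter.1 hc).2.2 hg μ]
  simp_rw [← Finset.mul_sum]
  rw [mul_div_mul_left _ _ h2n, Finset.sum_div]
  refine Finset.sum_congr rfl fun g _ => ?_
  rw [Finset.sum_comm, Finset.sum_div]
  refine Finset.sum_congr rfl fun x _ => ?_
  rw [← Finset.mul_sum, ← sum_start_min_rows s μ (rowCond x (edgeSign s) g),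
    ← div_div _ _ (∏ t, (((s t).1 : ℝ) + 1))]
  field_simp

end DisjointFamilies

/-! ### Overlapping families are negligible -/

section OverlapBound
open scoped Classical

theorem pow_le_two_mul_descFactorial {M e : ℕ} (h : 2 * e ^ 2 ≤ M) :
    (M : ℝ) ^ e ≤ 2 * M.descFactorial e := by
  rcases Nat.eq_zero_or_pos e with rfl | he
  · simp
  have heM : e ≤ M := by nlinarith
  have hM : (0 : ℝ) < M := by exact_mod_cast lt_of_lt_of_le he heM
  have h1 : ((M + 1 - e : ℕ) : ℝ) ^ e ≤ M.descFactorial e := by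
    exact_mod_cast Nat.pow_sub_le_descFactorial M e
  have h2 : (M : ℝ) - e ≤ ((M + 1 - e : ℕ) : ℝ) := by
    rw [Nat.cast_sub (by omega)]
    push_cast
    linarith
  have heM' : (e : ℝ) ≤ M := by exact_mod_cast heM
  have h3 : ((M : ℝ) - e) ^ e ≤ M.descFactorial e :=
    (pow_le_pow_left₀ (by linarith) h2 e).trans h1
  -- Bernoulli's inequality: (1 - e/M)^e ≥ 1 - e²/M ≥ 1/2.
  have h4 := one_add_mul_le_pow (a := -(e : ℝ) / M) (by
    rw [le_div_iff₀ hM]; linarith) e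
  have h5 : 1 + -(e : ℝ) / M = (M - e) / M := by field_simp; ring
  rw [h5, div_pow, le_div_iff₀ (by positivity)] at h4
  have h6 : (1 : ℝ) / 2 ≤ 1 + e * (-(e : ℝ) / M) := by
    have : 2 * (e : ℝ) ^ 2 ≤ M := by exact_mod_cast h
    have h7 : (e : ℝ) * (-(e : ℝ) / M) = -((e : ℝ) ^ 2 / M) := by ring
    have h8 : (e : ℝ) ^ 2 / M ≤ 1 / 2 := by rw [div_le_iff₀ hM]; linarith
    linarith
  have h9 := mul_le_mul_of_nonneg_right h6 (show (0 : ℝ) ≤ (M : ℝ) ^ e by positivity)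
  linarith

theorem card_filter_card_image_le {A B : Type*} [Fintype A] [Fintype B] [DecidableEq A]
    [DecidableEq B] (a : ℕ) :
    (Finset.univ.filter fun c : A → B => (Finset.univ.image c).card = a).card ≤
      a ^ Fintype.card A * Fintype.card B ^ a := by
  have h1 : Fintype.card ((A → Fin a) × (Fin a → B)) = a ^ Fintype.card A * Fintype.card B ^ a := by
    simp
  rw [← h1, ← Finset.card_univ]
  refine Finset.card_le_card_of_surjOn (fun f => f.2 ∘ f.1) ?_
  intro c hc
  have hc' : (Finset.univ.image c).card = a := (Finset.mem_filter.1 hc).2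
  let ε := (Finset.univ.image c).equivFinOfCardEq hc'
  refine ⟨(fun x => ε ⟨c x, Finset.mem_image_of_mem _ (Finset.mem_univ x)⟩,
    fun j => (ε.symm j).1), by simp, ?_⟩
  funext x
  simp

/-- There are O(N^a) maps with an image of size a, which the weight N^(-a) compensates; the bound is
independent of N. -/
theorem sum_inv_pow_card_image_le {A B : Type*} [Fintype A] [Fintype B] [DecidableEq A]
    [DecidableEq B] {N C : ℝ} (hN : 0 < N) (hB : (Fintype.card B : ℝ) ≤ C * N) :
    ∑ c : A → B, N⁻¹ ^ (Finset.univ.image c).card ≤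
      ∑ a ∈ Finset.range (Fintype.card A + 1), (a : ℝ) ^ Fintype.card A * C ^ a := by
  rw [← Finset.sum_fiberwise_of_maps_to (s := Finset.univ)
    (t := Finset.range (Fintype.card A + 1)) (g := fun c : A → B => (Finset.univ.image c).card)
    (fun c _ => by
      have : (Finset.univ.image c).card ≤ Fintype.card A := Finset.card_image_le
      simp only [Finset.mem_range]; omega)]
  refine Finset.sum_le_sum fun a _ => ?_
  rw [Finset.sum_congr rfl (g := fun _ => N⁻¹ ^ a) (fun c hc => by
    rw [(Finset.mem_filter.1 hc).2]), Finset.sum_const, nsmul_eq_mul]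
  have h1 : ((Finset.univ.filter fun c : A → B => (Finset.univ.image c).card = a).card : ℝ) ≤
      (a : ℝ) ^ Fintype.card A * (Fintype.card B : ℝ) ^ a := by
    exact_mod_cast card_filter_card_image_le a
  have h2 : (Fintype.card B : ℝ) ^ a ≤ (C * N) ^ a := pow_le_pow_left₀ (by positivity) hB a
  calc _ ≤ ((a : ℝ) ^ Fintype.card A * (C * N) ^ a) * N⁻¹ ^ a := by gcongr; exact h1.trans (by gcongr)
    _ = _ := by
      rw [mul_assoc, ← mul_pow, mul_assoc, mul_inv_cancel₀ hN.ne', mul_one]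

variable {T : Type*} [Fintype T] {s : T → SignPattern}
variable {n m d k : ℕ} {μ : ClausePattern k → ℝ}

theorem card_slotSet_le (c : Node s → Fin m) (g : Node s → Fin k × Fin k) :
    (slotSet c g).card ≤ 2 * Fintype.card (Node s) := by
  have h1 := Finset.card_union_le (Finset.univ.image fun h => (slots c g h).1)
    (Finset.univ.image fun h => (slots c g h).2)
  have h2 : (Finset.univ.image fun h => (slots c g h).1).card ≤ Fintype.card (Node s) :=
    Finset.card_image_le
  have h3 : (Finset.univ.image fun h => (slots c g h).2).card ≤ Fintype.card (Node s) :=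
    Finset.card_image_le
  unfold slotSet
  omega

theorem card_planted_nodeVar_le (hn : 0 < n) (hd : 0 < d)
    (hnd : 8 * Fintype.card (Node s) ^ 2 ≤ n * d) (c : Node s → Fin m)
    (g : Node s → Fin k × Fin k) (v : Node s → Fin n) :
    (((planted n m d k μ).filter fun Ψ => ∀ h, Ψ.var (slots c g h).1 = v h ∧
      Ψ.var (slots c g h).2 = v h).card : ℝ) ≤
      2 * (planted n m d k μ).card * (n : ℝ)⁻¹ ^ (slotSet c g).card := by
  set W := (planted n m d k μ).filter fun Ψ => ∀ h, Ψ.var (slots c g h).1 = v h ∧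
      Ψ.var (slots c g h).2 = v h with hW
  rcases W.eq_empty_or_nonempty with he | ⟨Ψ₀, hΨ₀⟩
  -- Otherwise any member of the set supplies a consistent assignment of variables to slots, even
  -- where slots of several nodes coincide.
  · rw [he]; simp; positivity
  set e := (slotSet c g).card with he
  have h0 := (Finset.mem_filter.1 hΨ₀).2
  have h1 := card_planted_var_le (μ := μ) (d := d) (slotSet c g) Ψ₀.var
  have h2 : W.card ≤ ((planted n m d k μ).filter fun Ψ => ∀ p ∈ slotSet c g,
      Ψ.var p = Ψ₀.var p).card := by
    refine Finset.card_le_card fun Ψ hΨ => ?_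
    rw [Finset.mem_filter] at hΨ ⊢
    refine ⟨hΨ.1, fun p hp => ?_⟩
    rw [slotSet, Finset.mem_union, Finset.mem_image, Finset.mem_image] at hp
    rcases hp with ⟨h, _, rfl⟩ | ⟨h, _, rfl⟩
    · exact (hΨ.2 h).1.trans (h0 h).1.symm
    · exact (hΨ.2 h).2.trans (h0 h).2.symm
  have h3 : (W.card : ℝ) * (n * d).descFactorial e ≤ (d : ℝ) ^ e * (planted n m d k μ).card := by
    exact_mod_cast (Nat.mul_le_mul_right _ h2).trans h1
  have hle : e ≤ 2 * Fintype.card (Node s) := card_slotSet_le c g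
  have h4 := pow_le_two_mul_descFactorial (M := n * d) (e := e) (by nlinarith)
  have hn' : (0 : ℝ) < n := by exact_mod_cast hn
  have hd' : (0 : ℝ) < d := by exact_mod_cast hd
  push_cast at h4
  rw [mul_pow] at h4
  have h5 : (W.card : ℝ) * ((n : ℝ) ^ e * (d : ℝ) ^ e) ≤
      2 * ((d : ℝ) ^ e * (planted n m d k μ).card) := by
    calc (W.card : ℝ) * ((n : ℝ) ^ e * (d : ℝ) ^ e)
        ≤ W.card * (2 * (n * d).descFactorial e) := by gcongr
      _ = 2 * (W.card * (n * d).descFactorial e) := by ring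
      _ ≤ _ := by gcongr
  have hde : (0 : ℝ) < (d : ℝ) ^ e := by positivity
  have hne : (0 : ℝ) < (n : ℝ) ^ e := by positivity
  rw [inv_pow, ← div_eq_mul_inv, le_div_iff₀ hne]
  refine le_of_mul_le_mul_right ?_ hde
  linarith

variable [DecidableEq T]

/-- A union with a clauses, b variables and at least a + b + 1 slots has O(n^(a+b)) placements, each
of probability O(n^(-a-b-1)). Twisting does not change variables, so τ plays no role in the
estimate. -/
theorem sum_overlapCount_le (hn : 0 < n) (hd : 0 < d) (hk : 0 < k) (hmk : m * k = 2 * d * n)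
    (hnd : 8 * Fintype.card (Node s) ^ 2 ≤ n * d) :
    (∑ τ : Fin n → ℤˣ, ∑ Ψ ∈ planted n m d k μ, (overlapCount s (twist τ Ψ) : ℝ)) ≤
      (2 ^ n * (planted n m d k μ).card) *
      ((2 * Fintype.card (Node s → Fin k × Fin k) *
        (∑ a ∈ Finset.range (Fintype.card (Node s) + 1),
          (a : ℝ) ^ Fintype.card (Node s) * (2 * d : ℝ) ^ a) *
        (∑ a ∈ Finset.range (Fintype.card (Node s) + 1),
          (a : ℝ) ^ Fintype.card (Node s) * 1 ^ a)) * (n : ℝ)⁻¹) := by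
  have hn' : (0 : ℝ) < n := by exact_mod_cast hn
  have h1 : ∀ τ : Fin n → ℤˣ, ∀ Ψ : Formula n m d k, (overlapCount s (twist τ Ψ) : ℝ) ≤
      ∑ g : Node s → Fin k × Fin k, ∑ c : Node s → Fin m, ∑ v : Node s → Fin n,
        if (Finset.univ.image c).card + (Finset.univ.image v).card + 1 ≤ (slotSet c g).card ∧
          ∀ h, Ψ.var (slots c g h).1 = v h ∧ Ψ.var (slots c g h).2 = v h then (1 : ℝ) else 0 := by
    intro τ Ψ
    rw [← Finset.sum_product', ← Finset.sum_product', Finset.sum_boole]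
    refine Nat.cast_le.2 ?_
    refine Finset.card_le_card_of_injOn
      (fun cg => ((cg.2, cg.1), nodeVar Ψ cg.1 cg.2)) ?_ ?_
    · rintro ⟨c, g⟩ h
      rw [Finset.mem_coe, Finset.mem_filter, mem_cycleFamilies] at h
      obtain ⟨⟨h1, h2⟩, h3⟩ := h
      obtain ⟨h4, h5⟩ := card_add_card_le_card_slotSet h1 h2
      simp only [Finset.coe_filter, Finset.mem_product, Finset.mem_univ, true_and]
      refine ⟨?_, fun h => ⟨rfl, ((h1 h.1).same_var h.2).symm⟩⟩
      by_contra hlt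
      refine h3 (h5 ?_)
      change (slotSet c g).card ≤ (Finset.univ.image c).card +
        (Finset.univ.image (nodeVar Ψ c g)).card
      simp only at hlt
      omega
    · rintro ⟨c, g⟩ _ ⟨c', g'⟩ _ h
      simp only [Prod.mk.injEq] at h
      exact Prod.ext h.1.2 h.1.1
  have hone : ∀ (g : Node s → Fin k × Fin k) (c : Node s → Fin m) (v : Node s → Fin n),
      (∑ Ψ ∈ planted n m d k μ,
        if (Finset.univ.image c).card + (Finset.univ.image v).card + 1 ≤ (slotSet c g).card ∧
          ∀ h, Ψ.var (slots c g h).1 = v h ∧ Ψ.var (slots c g h).2 = v h then (1 : ℝ) else 0) ≤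
      2 * (planted n m d k μ).card * ((n : ℝ)⁻¹ ^ (Finset.univ.image c).card *
        (n : ℝ)⁻¹ ^ (Finset.univ.image v).card * (n : ℝ)⁻¹) := by
    intro g c v
    rw [Finset.sum_boole]
    by_cases hle : (Finset.univ.image c).card + (Finset.univ.image v).card + 1 ≤
        (slotSet c g).card
    · simp only [hle, true_and]
      refine (card_planted_nodeVar_le hn hd hnd c g v).trans ?_
      rw [← pow_add, ← pow_succ]
      refine mul_le_mul_of_nonneg_left ?_ (by positivity)
      refine pow_le_pow_of_le_one (by positivity) ?_ hle
      exact inv_le_one_of_one_le₀ (by exact_mod_cast hn)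
    · simp only [hle, false_and, Finset.filter_false, Finset.card_empty, Nat.cast_zero]
      positivity
  have hm : (Fintype.card (Fin m) : ℝ) ≤ (2 * d : ℝ) * n := by
    have : m ≤ 2 * d * n := by rw [← hmk]; exact Nat.le_mul_of_pos_right m hk
    rw [Fintype.card_fin]
    exact_mod_cast this
  have hc := sum_inv_pow_card_image_le (A := Node s) (B := Fin m) hn' hm
  have hv := sum_inv_pow_card_image_le (A := Node s) (B := Fin n) (C := 1) hn' (by simp)
  have h2 : ∀ τ : Fin n → ℤˣ, (∑ Ψ ∈ planted n m d k μ, (overlapCount s (twist τ Ψ) : ℝ)) ≤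
      (planted n m d k μ).card *
      ((2 * Fintype.card (Node s → Fin k × Fin k) *
        (∑ a ∈ Finset.range (Fintype.card (Node s) + 1),
          (a : ℝ) ^ Fintype.card (Node s) * (2 * d : ℝ) ^ a) *
        (∑ a ∈ Finset.range (Fintype.card (Node s) + 1),
          (a : ℝ) ^ Fintype.card (Node s) * 1 ^ a)) * (n : ℝ)⁻¹) := by
    intro τ
    refine (Finset.sum_le_sum fun Ψ _ => h1 τ Ψ).trans ?_
    rw [Finset.sum_comm]
    calc _ ≤ ∑ _g : Node s → Fin k × Fin k, 2 * ((planted n m d k μ).card : ℝ) *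
          ((∑ c : Node s → Fin m, (n : ℝ)⁻¹ ^ (Finset.univ.image c).card) *
          (∑ v : Node s → Fin n, (n : ℝ)⁻¹ ^ (Finset.univ.image v).card) * (n : ℝ)⁻¹) := by
          refine Finset.sum_le_sum fun g _ => ?_
          rw [Finset.sum_comm, Finset.sum_mul_sum, Finset.sum_mul, Finset.mul_sum]
          refine Finset.sum_le_sum fun c _ => ?_
          rw [Finset.sum_comm, Finset.sum_mul, Finset.mul_sum]
          exact Finset.sum_le_sum fun v _ => hone g c v
      _ ≤ ∑ _g : Node s → Fin k × Fin k, 2 * ((planted n m d k μ).card : ℝ) *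
          ((∑ a ∈ Finset.range (Fintype.card (Node s) + 1),
          (a : ℝ) ^ Fintype.card (Node s) * (2 * d : ℝ) ^ a) *
        (∑ a ∈ Finset.range (Fintype.card (Node s) + 1),
          (a : ℝ) ^ Fintype.card (Node s) * 1 ^ a) * (n : ℝ)⁻¹) := by
          refine Finset.sum_le_sum fun g _ => ?_
          refine mul_le_mul_of_nonneg_left ?_ (by positivity)
          refine mul_le_mul_of_nonneg_right ?_ (by positivity)
          exact mul_le_mul hc hv (Finset.sum_nonneg fun _ _ => by positivity)
            (Finset.sum_nonneg fun _ _ => by positivity)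
      _ = _ := by
          rw [Finset.sum_const, Finset.card_univ, nsmul_eq_mul]
          ring
  refine (Finset.sum_le_sum fun τ _ => h2 τ).trans (le_of_eq ?_)
  rw [Finset.sum_const, Finset.card_univ, nsmul_eq_mul, Fintype.card_fun, Fintype.card_fin,
    Fintype.card_units_int]
  push_cast
  ring

end OverlapBound

/-! ### Uniform limits over the profiles -/

section ProfileFilter

/-- The passage to the limit `n → ∞` along the admissible `(n, m, μ)`. -/
def profileFilter (k d : ℕ) (q ω : ℝ) : Filter (ℕ × ℕ × (ClausePattern k → ℝ)) :=
  -- Since μ ranges freely over the fibre, convergence along this filter is convergence uniform in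
  -- μ, as required for the maximum over the profiles.
  comap Prod.fst atTop ⊓ 𝓟 {i | i.2.1 * k = 2 * d * i.1 ∧ i.2.2 ∈ nearMarginals k i.2.1 q ω}

variable {k d : ℕ} {q ω : ℝ}

theorem tendsto_fst_profileFilter : Tendsto (fun i => i.1) (profileFilter k d q ω) atTop :=
  tendsto_comap.mono_left inf_le_left

theorem eventually_mem_profileFilter : ∀ᶠ i in profileFilter k d q ω,
    i.2.1 * k = 2 * d * i.1 ∧ i.2.2 ∈ nearMarginals k i.2.1 q ω :=
  eventually_inf_principal.2 (Eventually.of_forall fun _ h => h)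

theorem exists_forall_of_eventually_profileFilter {p : ℕ × ℕ × (ClausePattern k → ℝ) → Prop}
    (h : ∀ᶠ i in profileFilter k d q ω, p i) :
    ∃ N : ℕ, ∀ n m : ℕ, N ≤ n → m * k = 2 * d * n → ∀ μ ∈ nearMarginals k m q ω, p (n, m, μ) := by
  rw [profileFilter, eventually_inf_principal, eventually_comap] at h
  obtain ⟨N, hN⟩ := eventually_atTop.1 h
  exact ⟨N, fun n m hn hmk μ hμ => hN n hn (n, m, μ) rfl ⟨hmk, hμ⟩⟩

theorem tendsto_snd_profileFilter (hk : 0 < k) (hd : 0 < d) :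
    Tendsto (fun i => i.2.1) (profileFilter k d q ω) atTop := by
  rw [tendsto_atTop]
  intro b
  filter_upwards [eventually_mem_profileFilter,
    (tendsto_atTop.1 tendsto_fst_profileFilter) (b * k)] with i hi hn
  by_contra hlt
  push Not at hlt
  have h1 : i.2.1 * k < b * k := Nat.mul_lt_mul_of_pos_right hlt hk
  have h2 : 1 * i.1 ≤ 2 * d * i.1 := Nat.mul_le_mul_right _ (by omega)
  omega

theorem tendsto_profile (hk : 0 < k) (hd : 0 < d) (σ : ClausePattern k) :
    Tendsto (fun i => i.2.2 σ) (profileFilter k d q ω) (𝓝 (muBar k q σ)) := by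
  have h1 : Tendsto (fun i : ℕ × ℕ × (ClausePattern k → ℝ) => ω / √(i.2.1 : ℝ))
      (profileFilter k d q ω) (𝓝 0) :=
    (Real.tendsto_sqrt_atTop.comp
      (tendsto_natCast_atTop_atTop.comp (tendsto_snd_profileFilter hk hd))).const_div_atTop ω
  rw [tendsto_iff_norm_sub_tendsto_zero]
  refine squeeze_zero' (Eventually.of_forall fun _ => norm_nonneg _) ?_ h1
  filter_upwards [eventually_mem_profileFilter] with i hi
  refine le_trans ?_ hi.2.2
  rw [Real.norm_eq_abs, ← Real.sqrt_sq_eq_abs]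
  exact Real.sqrt_le_sqrt (Finset.single_le_sum
    (f := fun σ => (i.2.2 σ - muBar k q σ) ^ 2) (fun _ _ => sq_nonneg _) (Finset.mem_univ σ))

theorem tendsto_ratio_profileFilter (hk : 0 < k) :
    Tendsto (fun i => (i.2.1 : ℝ) / i.1) (profileFilter k d q ω) (𝓝 (2 * d / k)) := by
  refine (tendsto_const_nhds (x := (2 * d / k : ℝ))).congr' ?_
  filter_upwards [eventually_mem_profileFilter,
    (tendsto_atTop.1 tendsto_fst_profileFilter) 1] with i hi hn
  have h1 : (i.2.1 : ℝ) * k = 2 * d * i.1 := by exact_mod_cast hi.1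
  have h2 : (k : ℝ) ≠ 0 := by positivity
  have h3 : (i.1 : ℝ) ≠ 0 := by positivity
  rw [div_eq_div_iff h2 h3]
  linarith

theorem tendsto_descFactorial_div_pow (e : ℕ) :
    Tendsto (fun M : ℕ => (M.descFactorial e : ℝ) / (M : ℝ) ^ e) atTop (𝓝 1) := by
  have h1 : Tendsto (fun M : ℕ => (1 - (e : ℝ) / M) ^ e) atTop (𝓝 1) := by
    have := ((tendsto_const_div_atTop_nhds_zero_nat (e : ℝ)).const_sub 1).pow e
    simpa using this
  refine tendsto_of_tendsto_of_tendsto_of_le_of_le' h1 tendsto_const_nhds ?_ ?_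
  · filter_upwards [eventually_ge_atTop (e + 1)] with M hM
    have hM0 : (0 : ℝ) < M := by exact_mod_cast (by omega : 0 < M)
    have heM : (e : ℝ) ≤ M := by exact_mod_cast (by omega : e ≤ M)
    rw [le_div_iff₀ (by positivity), ← mul_pow]
    have h2 : (1 - (e : ℝ) / M) * M = M - e := by field_simp
    have h3 : (M : ℝ) - e ≤ ((M + 1 - e : ℕ) : ℝ) := by
      rw [Nat.cast_sub (by omega)]; push_cast; linarith
    rw [h2]
    refine (pow_le_pow_left₀ (by linarith) h3 e).trans ?_
    exact_mod_cast Nat.pow_sub_le_descFactorial M e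
  · filter_upwards [eventually_ge_atTop 1] with M hM
    refine div_le_one_of_le₀ ?_ (by positivity)
    exact_mod_cast Nat.descFactorial_le_pow M e

end ProfileFilter

/-! ### Limits of the factors of the moments -/

section MomentLimit
open scoped Classical

variable {T : Type*} [Fintype T] [DecidableEq T] {s : T → SignPattern}
variable {k d : ℕ} {q ω : ℝ}

/-- The average over the planted pairs. -/
noncomputable def plantedAvg {n m d k : ℕ} (μ : ClausePattern k → ℝ)
    (F : Formula n m d k → ℝ) : ℝ :=
  (∑ τ : Fin n → ℤˣ, ∑ Ψ ∈ planted n m d k μ, F (twist τ Ψ)) /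
    (2 ^ n * (planted n m d k μ).card)

theorem tendsto_plantedAvg_overlapCount (s : T → SignPattern) (hk : 0 < k) (hd : 0 < d) :
    Tendsto (fun i : ℕ × ℕ × (ClausePattern k → ℝ) => plantedAvg (n := i.1) (m := i.2.1) (d := d)
      i.2.2 fun Φ => (overlapCount s Φ : ℝ)) (profileFilter k d q ω) (𝓝 0) := by
  have hinv : Tendsto (fun i : ℕ × ℕ × (ClausePattern k → ℝ) => (i.1 : ℝ)⁻¹)
      (profileFilter k d q ω) (𝓝 0) :=
    tendsto_inv_atTop_zero.comp (tendsto_natCast_atTop_atTop.comp tendsto_fst_profileFilter)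
  have hlim := hinv.const_mul (2 * Fintype.card (Node s → Fin k × Fin k) *
        (∑ a ∈ Finset.range (Fintype.card (Node s) + 1),
          (a : ℝ) ^ Fintype.card (Node s) * (2 * d : ℝ) ^ a) *
        (∑ a ∈ Finset.range (Fintype.card (Node s) + 1),
          (a : ℝ) ^ Fintype.card (Node s) * 1 ^ a))
  rw [mul_zero] at hlim
  refine squeeze_zero' (Eventually.of_forall fun i => ?_) ?_ hlim
  · exact div_nonneg (Finset.sum_nonneg fun _ _ => Finset.sum_nonneg fun _ _ => by positivity)
      (by positivity)
  · filter_upwards [eventually_mem_profileFilter,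
      (tendsto_atTop.1 tendsto_fst_profileFilter) (8 * Fintype.card (Node s) ^ 2 + 1)] with i hi hn
    have hn0 : 0 < i.1 := by omega
    have h := sum_overlapCount_le (μ := i.2.2) (s := s) hn0 hd hk hi.1
      ((by omega : 8 * Fintype.card (Node s) ^ 2 ≤ i.1).trans (Nat.le_mul_of_pos_right _ hd))
    rw [plantedAvg]
    exact div_le_of_le_mul₀ (by positivity) (by positivity) (h.trans (le_of_eq (mul_comm _ _)))

/-- The bounds of `card_clauses_rows_bounds` hold for every planted Ψ, so they pass to the average;
non-injective clause tuples have vanishing proportion and μ tends to μ̄. -/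
theorem tendsto_rows_average {H : Type*} [Fintype H] [DecidableEq H] (hk : 0 < k) (hd : 0 < d)
    (Q : H → (Fin k → ℤˣ) → Prop) :
    Tendsto (fun i : ℕ × ℕ × (ClausePattern k → ℝ) =>
      (∑ Ψ ∈ planted i.1 i.2.1 d k i.2.2, ((Finset.univ.filter fun c : H → Fin i.2.1 =>
        Function.Injective c ∧ ∀ h, Q h (row Ψ (c h))).card : ℝ)) /
          (planted i.1 i.2.1 d k i.2.2).card / (i.2.1 : ℝ) ^ Fintype.card H)
      (profileFilter k d q ω)
      (𝓝 (∏ h, ∑ σ : ClausePattern k, if Q h σ.1 then muBar k q σ else 0)) := by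
  have hup : Tendsto (fun i : ℕ × ℕ × (ClausePattern k → ℝ) =>
      ∏ h, ∑ σ : ClausePattern k, if Q h σ.1 then i.2.2 σ else 0) (profileFilter k d q ω)
      (𝓝 (∏ h, ∑ σ : ClausePattern k, if Q h σ.1 then muBar k q σ else 0)) := by
    refine tendsto_finsetProd _ fun h _ => tendsto_finsetSum _ fun σ _ => ?_
    split_ifs
    · exact tendsto_profile hk hd σ
    · exact tendsto_const_nhds
  have hdf : Tendsto (fun i : ℕ × ℕ × (ClausePattern k → ℝ) =>
      1 - (i.2.1.descFactorial (Fintype.card H) : ℝ) / (i.2.1 : ℝ) ^ Fintype.card H)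
      (profileFilter k d q ω) (𝓝 0) := by
    have := ((tendsto_descFactorial_div_pow (Fintype.card H)).comp
      (tendsto_snd_profileFilter (q := q) (ω := ω) hk hd)).const_sub 1
    simpa using this
  have hlow := hup.sub hdf
  rw [sub_zero] at hlow
  have hev : ∀ᶠ i : ℕ × ℕ × (ClausePattern k → ℝ) in profileFilter k d q ω,
      0 < i.2.1 ∧ i.2.1 * k = 2 * d * i.1 ∧ IsClauseMarginal i.2.1 i.2.2 := by
    filter_upwards [eventually_mem_profileFilter,
      (tendsto_atTop.1 (tendsto_snd_profileFilter hk hd)) 1] with i hi hm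
    exact ⟨hm, hi.1, hi.2.1⟩
  refine tendsto_of_tendsto_of_tendsto_of_le_of_le' hlow hup ?_ ?_
  · filter_upwards [hev] with i hi
    obtain ⟨hm, hmk, hμ⟩ := hi
    have hm' : (0 : ℝ) < (i.2.1 : ℝ) ^ Fintype.card H := by positivity
    have hP : (0 : ℝ) < (planted i.1 i.2.1 d k i.2.2).card := by
      exact_mod_cast Finset.card_pos.2 (planted_nonempty hμ hmk)
    rw [le_div_iff₀ hm', le_div_iff₀ hP]
    have h := Finset.card_nsmul_le_sum (planted i.1 i.2.1 d k i.2.2) _ _ fun Ψ hΨ =>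
      (card_clauses_rows_bounds hμ.sum_eq_one hΨ Q).1
    rw [nsmul_eq_mul] at h
    refine le_trans (le_of_eq ?_) h
    field_simp
  · filter_upwards [hev] with i hi
    obtain ⟨hm, hmk, hμ⟩ := hi
    have hm' : (0 : ℝ) < (i.2.1 : ℝ) ^ Fintype.card H := by positivity
    have hP : (0 : ℝ) < (planted i.1 i.2.1 d k i.2.2).card := by
      exact_mod_cast Finset.card_pos.2 (planted_nonempty hμ hmk)
    rw [div_le_iff₀ hm', div_le_iff₀ hP]
    have h := Finset.sum_le_card_nsmul (planted i.1 i.2.1 d k i.2.2) _ _ fun Ψ hΨ =>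
      (card_clauses_rows_bounds hμ.sum_eq_one hΨ Q).2
    rw [nsmul_eq_mul] at h
    refine h.trans (le_of_eq ?_)
    ring

/-- The weight `d (d - 1)` or `d ^ 2` of a variable node. -/
noncomputable def cloneWeight (d : ℕ) (e : ℤˣ) : ℝ :=
  d * if e = 1 then (d : ℝ) - 1 else d

theorem tendsto_cycleFill_ratio (hk : 0 < k) (hd : 0 < d) (x : Node s → ℤˣ) :
    Tendsto (fun i : ℕ × ℕ × (ClausePattern k → ℝ) =>
      ((cycleFill i.1 d x (edgeSign s)).card : ℝ) /
          ((cloneFill i.1 d (pairSigns x (edgeSign s))).card * 2 ^ Fintype.card (Node s) *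
            ∏ t, (((s t).1 : ℝ) + 1)) * (i.2.1 : ℝ) ^ Fintype.card (Node s))
      (profileFilter k d q ω)
      (𝓝 ((∏ h, cloneWeight d (edgeSign s h)) / ((d : ℝ) ^ (2 * Fintype.card (Node s)) *
        2 ^ Fintype.card (Node s) * ∏ t, (((s t).1 : ℝ) + 1)) *
          (2 * d / k : ℝ) ^ Fintype.card (Node s))) := by
  set H := Fintype.card (Node s) with hH
  set Lp : ℝ := ∏ t, (((s t).1 : ℝ) + 1) with hLp
  have hL : 0 < Lp := Finset.prod_pos fun t _ => by positivity
  have hd' : (0 : ℝ) < d := by exact_mod_cast hd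
  have hE : Fintype.card (Node s × Bool) = 2 * H := by
    rw [Fintype.card_prod, Fintype.card_bool, mul_comm]
  have hndt : Tendsto (fun i : ℕ × ℕ × (ClausePattern k → ℝ) => i.1 * d)
      (profileFilter k d q ω) atTop :=
    tendsto_fst_profileFilter.atTop_mul_const' hd
  have t1 : Tendsto (fun i : ℕ × ℕ × (ClausePattern k → ℝ) =>
      ((cloneFill i.1 d (pairSigns x (edgeSign s))).card : ℝ) / ((i.1 * d : ℕ) : ℝ) ^ (2 * H))
      (profileFilter k d q ω) (𝓝 1) := by
    refine tendsto_of_tendsto_of_tendsto_of_le_of_le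
      ((tendsto_descFactorial_div_pow (2 * H)).comp hndt) tendsto_const_nhds ?_ ?_
    · intro i
      have := descFactorial_le_card_cloneFill (n := i.1) (d := d) (pairSigns x (edgeSign s))
      rw [hE] at this
      simp only [Function.comp]
      gcongr
    · intro i
      have := card_cloneFill_le (n := i.1) (d := d) (pairSigns x (edgeSign s))
      rw [hE] at this
      refine div_le_one_of_le₀ ?_ (by positivity)
      rw [← Nat.cast_pow]
      exact Nat.cast_le.2 this
  have t2 := (tendsto_descFactorial_div_pow H).comp
    (tendsto_fst_profileFilter (k := k) (d := d) (q := q) (ω := ω))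
  have t3 := (tendsto_ratio_profileFilter (d := d) (q := q) (ω := ω) hk).pow H
  have hK : ∀ n, ((cycleFill n d x (edgeSign s)).card : ℝ) =
      (n.descFactorial H : ℝ) * ∏ h, cloneWeight d (edgeSign s h) := by
    intro n
    rw [card_cycleFill]
    push_cast
    congr 1
    refine Finset.prod_congr rfl fun h _ => ?_
    rw [cloneWeight]
    split_ifs
    · rw [Nat.cast_sub (Nat.le_mul_self d)]; push_cast; ring
    · ring
  have t4 := ((t2.mul_const (∏ h, cloneWeight d (edgeSign s h))).div t1 one_ne_zero).mul
    (t3.mul_const (1 / ((d : ℝ) ^ (2 * H) * 2 ^ H * Lp)))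
  refine Tendsto.congr' ?_ (t4.trans (le_of_eq ?_))
  · filter_upwards [(tendsto_atTop.1 tendsto_fst_profileFilter) 1,
      (tendsto_atTop.1 hndt) (2 * H)] with i hn hnd
    have hn' : (0 : ℝ) < i.1 := by exact_mod_cast hn
    have hN := card_cloneFill_ne_zero (n := i.1) (d := d) (by rw [hE]; exact hnd)
      (pairSigns x (edgeSign s))
    simp only [Function.comp, Pi.div_apply]
    rw [hK]
    push_cast
    rw [mul_pow, pow_mul, pow_mul, div_pow]
    field_simp
    ring
  · congr 1
    rw [div_one, one_mul]
    ring

end MomentLimit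

/-! ### Evaluation of the limiting moment -/

section LimitValue
open scoped Classical

variable {T : Type*} [Fintype T] {k d : ℕ} {q ω : ℝ}

theorem pow_card_node (s : T → SignPattern) (y : ℝ) :
    y ^ Fintype.card (Node s) = ∏ t, y ^ ((s t).1 + 1) := by
  rw [Fintype.card_sigma, Finset.prod_pow_eq_pow_sum]
  simp

variable [DecidableEq T]

/-- The ordering required at the first clause of each cycle halves its number of choices; this is
the 1/2 in λ. -/
theorem card_goodPositions (s : T → SignPattern) (k : ℕ) :
    ((goodPositions s k).card : ℝ) = ∏ t, ((k : ℝ) * ((k : ℝ) - 1)) ^ ((s t).1 + 1) / 2 := by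
  set ne : Finset (Fin k × Fin k) := Finset.univ.filter fun z => z.1 ≠ z.2 with hne
  set lt : Finset (Fin k × Fin k) := Finset.univ.filter fun z => z.1 < z.2 with hlt
  have h1 : (ne.card : ℝ) = (k : ℝ) * ((k : ℝ) - 1) := by
    have : ne = (Finset.univ : Finset (Fin k)).offDiag := by ext z; simp [hne]
    rw [this, Finset.offDiag_card, Finset.card_univ, Fintype.card_fin,
      Nat.cast_sub (Nat.le_mul_self k)]
    push_cast
    ring
  have h2 : ne.card = lt.card + lt.card := by
    have hgt : lt.card = (Finset.univ.filter fun z : Fin k × Fin k => z.2 < z.1).card :=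
      Finset.card_bij (fun z _ => z.swap) (by simp [hlt])
        (fun a _ b _ h => Prod.swap_injective h)
        (fun z hz => ⟨z.swap, by simpa [hlt] using hz, by simp⟩)
    nth_rewrite 2 [hgt]
    rw [← Finset.card_union_of_disjoint]
    · congr 1
      ext z
      simp [hne, hlt]
    · rw [Finset.disjoint_filter]
      intro z _ h h'
      exact lt_asymm h h'
  have h3 : (lt.card : ℝ) = (k : ℝ) * ((k : ℝ) - 1) / 2 := by
    rw [← h1, h2]; push_cast; ring
  have h4 : goodPositions s k = Fintype.piFinset fun h : Node s => if h.2 = 0 then lt else ne := by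
    ext g
    rw [mem_goodPositions, Fintype.mem_piFinset]
    constructor
    · rintro ⟨hg1, hg2⟩ ⟨t, i⟩
      by_cases hi : i = 0
      · subst hi
        simpa [hlt] using hg2 t
      · simpa [hi, hne] using hg1 ⟨t, i⟩
    · intro h
      have hz : ∀ t, (g ⟨t, 0⟩).1 < (g ⟨t, 0⟩).2 := fun t => by
        simpa [hlt] using h ⟨t, 0⟩
      refine ⟨?_, hz⟩
      rintro ⟨t, i⟩
      by_cases hi : i = 0
      · subst hi
        exact (hz t).ne
      · simpa [hi, hne] using h ⟨t, i⟩
  rw [h4, Fintype.card_piFinset, Fintype.prod_sigma]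
  push_cast
  refine Finset.prod_congr rfl fun t _ => ?_
  rw [Fin.prod_univ_succ]
  simp only [if_true, Fin.succ_ne_zero, if_false, Finset.prod_const, Finset.card_univ,
    Fintype.card_fin]
  rw [h1, h3, pow_succ]
  ring

/-- The sum factorises over the cycles, and each factor is a cyclic sum, which equals 1 + δ by
comparing `sum_cycle_agreeWeight` with `delta_eq_prod`. -/
theorem sum_prod_agreeWeight (s : T → SignPattern) (h : IsMarginalParam k q) :
    ∑ x : Node s → ℤˣ, ∏ y, agreeWeight q (x y)
      (x ((nxt s).symm y) * edgeSign s ((nxt s).symm y)) = ∏ t, (1 + delta q (s t)) := by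
  have h1 : ∀ x : Node s → ℤˣ, ∏ y, agreeWeight q (x y)
      (x ((nxt s).symm y) * edgeSign s ((nxt s).symm y)) =
      ∏ t, ∏ i : Fin ((s t).1 + 1), agreeWeight q (x ⟨t, i + 1⟩)
        (x ⟨t, i⟩ * (((s t).2 i).1 * ((s t).2 i).2)) := by
    intro x
    rw [← (nxt s).prod_comp, Fintype.prod_sigma]
    simp only [Equiv.symm_apply_apply]
    rfl
  simp_rw [h1]
  rw [← (Equiv.piCurry fun (t : T) (_ : Fin ((s t).1 + 1)) => ℤˣ).symm.sum_comp]
  have h2 : ∀ t, 1 + delta q (s t) = ∑ x : Fin ((s t).1 + 1) → ℤˣ,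
      ∏ i, agreeWeight q (x (i + 1)) (x i * (((s t).2 i).1 * ((s t).2 i).2)) := by
    intro t
    rw [sum_cycle_agreeWeight, delta_eq_prod h]
  simp_rw [h2]
  rw [Finset.prod_univ_sum, Fintype.piFinset_univ]
  rfl

theorem moment_limit_value (s : T → SignPattern) (hk : 0 < k) (hd : 0 < d)
    (h : IsMarginalParam k q) :
    ∑ g ∈ goodPositions s k, ∑ x : Node s → ℤˣ,
      (∏ h, cloneWeight d (edgeSign s h)) / ((d : ℝ) ^ (2 * Fintype.card (Node s)) *
        2 ^ Fintype.card (Node s) * ∏ t, (((s t).1 : ℝ) + 1)) *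
          (2 * d / k : ℝ) ^ Fintype.card (Node s) *
        ∏ y, ∑ σ : ClausePattern k,
          (if rowCond x (edgeSign s) g y σ.1 then muBar k q σ else 0) =
      ∏ t, (1 + delta q (s t)) * lam k d (s t) := by
  have hk' : (k : ℝ) ≠ 0 := by positivity
  have hd' : (d : ℝ) ≠ 0 := by positivity
  have h1 : ∀ g ∈ goodPositions s k, ∀ x : Node s → ℤˣ, ∏ y, ∑ σ : ClausePattern k,
      (if rowCond x (edgeSign s) g y σ.1 then muBar k q σ else 0) =
      (∏ y, agreeWeight q (x y) (x ((nxt s).symm y) * edgeSign s ((nxt s).symm y))) /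
        2 ^ Fintype.card (Node s) := by
    intro g hg x
    rw [← Finset.card_univ, ← Finset.prod_const, ← Finset.prod_div_distrib]
    refine Finset.prod_congr rfl fun y _ => ?_
    rw [← sum_muBar_two_marginal h ((mem_goodPositions.1 hg).1 y)]
    exact Finset.sum_congr rfl fun σ _ => if_congr Iff.rfl rfl rfl
  rw [Finset.sum_congr rfl fun g hg => Finset.sum_congr rfl fun x _ => by rw [h1 g hg x]]
  simp_rw [← Finset.mul_sum, ← Finset.sum_div]
  rw [sum_prod_agreeWeight s h, Finset.sum_const, nsmul_eq_mul, card_goodPositions,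
    Fintype.prod_sigma, pow_mul, pow_card_node, pow_card_node, pow_card_node]
  simp only [← Finset.prod_mul_distrib, ← Finset.prod_div_distrib]
  refine Finset.prod_congr rfl fun t _ => ?_
  have h2 : ∏ i, cloneWeight d (edgeSign s ⟨t, i⟩) = (d : ℝ) ^ ((s t).1 + 1) *
      ∏ i, if ((s t).2 i).1 * ((s t).2 i).2 = 1 then (d : ℝ) - 1 else (d : ℝ) := by
    simp only [cloneWeight]
    rw [Finset.prod_mul_distrib, Finset.prod_const, Finset.card_univ, Fintype.card_fin]
    rfl
  rw [h2, lam]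
  have h3 : ((s t).1 : ℝ) + 1 ≠ 0 := by positivity
  simp only [SignPattern.half, Nat.cast_add, Nat.cast_one, div_pow, mul_pow]
  generalize ∏ i, (if ((s t).2 i).1 * ((s t).2 i).2 = 1 then (d : ℝ) - 1 else (d : ℝ)) = P
  rw [← pow_mul, mul_comm 2, pow_mul]
  have hk2 : (k : ℝ) ^ ((s t).1 + 1) ≠ 0 := pow_ne_zero _ hk'
  have hd2 : (d : ℝ) ^ ((s t).1 + 1) ≠ 0 := pow_ne_zero _ hd'
  have h22 : (2 : ℝ) ^ ((s t).1 + 1) ≠ 0 := pow_ne_zero _ two_ne_zero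
  generalize (k : ℝ) ^ ((s t).1 + 1) = K at *
  generalize (d : ℝ) ^ ((s t).1 + 1) = D at *
  generalize (2 : ℝ) ^ ((s t).1 + 1) = W at *
  generalize ((k : ℝ) - 1) ^ ((s t).1 + 1) = K' at *
  generalize ((s t).1 : ℝ) + 1 = l at *
  field_simp

theorem tendsto_plantedAvg_disjointCount (s : T → SignPattern) (hk : 0 < k) (hd : 0 < d)
    (h : IsMarginalParam k q) :
    Tendsto (fun i : ℕ × ℕ × (ClausePattern k → ℝ) => plantedAvg (n := i.1) (m := i.2.1) (d := d)
      i.2.2 fun Φ => (disjointCount s Φ : ℝ)) (profileFilter k d q ω)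
      (𝓝 (∏ t, (1 + delta q (s t)) * lam k d (s t))) := by
  rw [← moment_limit_value s hk hd h]
  have hlim : Tendsto (fun i : ℕ × ℕ × (ClausePattern k → ℝ) =>
      ∑ g ∈ goodPositions s k, ∑ x : Node s → ℤˣ,
        (((cycleFill i.1 d x (edgeSign s)).card : ℝ) /
          ((cloneFill i.1 d (pairSigns x (edgeSign s))).card * 2 ^ Fintype.card (Node s) *
            ∏ t, (((s t).1 : ℝ) + 1)) * (i.2.1 : ℝ) ^ Fintype.card (Node s)) *
        ((∑ Ψ ∈ planted i.1 i.2.1 d k i.2.2,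
          ((Finset.univ.filter fun c : Node s → Fin i.2.1 =>
          Function.Injective c ∧ ∀ h, rowCond x (edgeSign s) g h (row Ψ (c h))).card : ℝ)) /
          (planted i.1 i.2.1 d k i.2.2).card / (i.2.1 : ℝ) ^ Fintype.card (Node s)))
      (profileFilter k d q ω) _ :=
    tendsto_finsetSum _ fun g _ => tendsto_finsetSum _ fun x _ =>
      (tendsto_cycleFill_ratio hk hd x).mul
        (tendsto_rows_average hk hd (rowCond x (edgeSign s) g))
  refine hlim.congr' ?_
  filter_upwards [(tendsto_atTop.1 (tendsto_snd_profileFilter hk hd)) 1,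
    (tendsto_atTop.1 tendsto_fst_profileFilter) (Fintype.card (Node s × Bool))] with i hm hn
  have hm' : (i.2.1 : ℝ) ^ Fintype.card (Node s) ≠ 0 := by positivity
  rw [plantedAvg, sum_disjointCount s (hn.trans (Nat.le_mul_of_pos_right _ hd))]
  refine Finset.sum_congr rfl fun g _ => Finset.sum_congr rfl fun x _ => ?_
  -- The power of m was inserted to give both factors finite limits: the clone probability is of
  -- order n^(-H) and the number of clause tuples of order m^H, with H the number of nodes.
  rw [mul_assoc, mul_div_cancel₀ _ hm']

end LimitValue

/-! ### Poisson limit in the planted model -/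

section Final
open scoped Classical

theorem plantedAvg_add {n m d k : ℕ} (μ : ClausePattern k → ℝ) (F G : Formula n m d k → ℝ) :
    plantedAvg μ (fun Φ => F Φ + G Φ) = plantedAvg μ F + plantedAvg μ G := by
  simp only [plantedAvg, Finset.sum_add_distrib, add_div]

theorem plantedAvg_mono {n m d k : ℕ} (μ : ClausePattern k → ℝ) {F G : Formula n m d k → ℝ}
    (h : ∀ Φ, F Φ ≤ G Φ) : plantedAvg μ F ≤ plantedAvg μ G :=
  div_le_div_of_nonneg_right (Finset.sum_le_sum fun _ _ => Finset.sum_le_sum fun _ _ => h _)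
    (by positivity)

/-- The law of the cycle counts in the planted model, as a functional. -/
noncomputable def cycleLaw (S : Finset SignPattern) {n m d k : ℕ} (μ : ClausePattern k → ℝ) :
    ((S → ℕ) → ℝ) →ₗ[ℝ] ℝ where
  toFun f := plantedAvg (n := n) (m := m) (d := d) μ fun Φ => f fun x => cycleCount x.1 Φ
  map_add' f g := plantedAvg_add μ _ _
  map_smul' a f := by
    change plantedAvg μ (fun Φ => a * f _) = a * plantedAvg μ _
    simp only [plantedAvg, ← Finset.mul_sum, mul_div_assoc]

theorem cycleLaw_apply (S : Finset SignPattern) {n m d k : ℕ} (μ : ClausePattern k → ℝ)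
    (f : (S → ℕ) → ℝ) : cycleLaw S (n := n) (m := m) (d := d) μ f =
      plantedAvg (n := n) (m := m) (d := d) μ fun Φ => f fun x => cycleCount x.1 Φ := rfl

theorem prod_indexPattern {S : Finset SignPattern} (r : S → ℕ) (f : SignPattern → ℝ) :
    ∏ t, f (indexPattern r t) = ∏ s : S, f s.1 ^ r s := by
  rw [Fintype.prod_sigma]
  refine Finset.prod_congr rfl fun s _ => ?_
  change ∏ _y : Fin (r s), f s.1 = _
  simp

theorem cycleLaw_mono (S : Finset SignPattern) {n m d k : ℕ} (μ : ClausePattern k → ℝ)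
    {f g : (S → ℕ) → ℝ} (h : f ≤ g) :
    cycleLaw S (n := n) (m := m) (d := d) μ f ≤ cycleLaw S (n := n) (m := m) (d := d) μ g := by
  rw [cycleLaw_apply, cycleLaw_apply]
  exact plantedAvg_mono μ fun Φ => h _

theorem cycleLaw_descFactorial (S : Finset SignPattern) (r : S → ℕ) {n m d k : ℕ}
    (μ : ClausePattern k → ℝ) :
    cycleLaw S (n := n) (m := m) (d := d) μ
        (fun x => ∏ s, ((x s).descFactorial (r s) : ℝ)) =
      plantedAvg (n := n) (m := m) (d := d) μ
        (fun Φ => (disjointCount (indexPattern r) Φ : ℝ)) +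
      plantedAvg (n := n) (m := m) (d := d) μ
        (fun Φ => (overlapCount (indexPattern r) Φ : ℝ)) := by
  rw [← plantedAvg_add, cycleLaw_apply]
  congr 1
  funext Φ
  rw [← Nat.cast_add, disjointCount_add_overlapCount, ← prod_descFactorial_cycleCount,
    Nat.cast_prod]

theorem lam_nonneg {k d : ℕ} (hk : 0 < k) (hd : 0 < d) (s : SignPattern) : 0 ≤ lam k d s := by
  have h1 : (1 : ℝ) ≤ k := by exact_mod_cast hk
  have h2 : (1 : ℝ) ≤ d := by exact_mod_cast hd
  refine mul_nonneg (mul_nonneg (by positivity) (pow_nonneg (by linarith) _))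
    (Finset.prod_nonneg fun i _ => ?_)
  split_ifs <;> linarith

theorem tendsto_cycleLaw_moments {k d : ℕ} {q ω : ℝ} (hk : 0 < k) (hd : 0 < d)
    (h : IsMarginalParam k q) (S : Finset SignPattern) (r : S → ℕ) :
    Tendsto (fun i : ℕ × ℕ × (ClausePattern k → ℝ) =>
      cycleLaw S (n := i.1) (m := i.2.1) (d := d) i.2.2
        fun x => ∏ s, ((x s).descFactorial (r s) : ℝ)) (profileFilter k d q ω)
      (𝓝 (∏ s : S, ((1 + delta q s.1) * lam k d s.1) ^ r s)) := by
  have h1 : Tendsto (fun i : ℕ × ℕ × (ClausePattern k → ℝ) =>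
      plantedAvg (n := i.1) (m := i.2.1) (d := d) i.2.2
        (fun Φ => (disjointCount (indexPattern r) Φ : ℝ)) +
      plantedAvg (n := i.1) (m := i.2.1) (d := d) i.2.2
        (fun Φ => (overlapCount (indexPattern r) Φ : ℝ))) (profileFilter k d q ω)
      (𝓝 (∏ t, (1 + delta q (indexPattern r t)) * lam k d (indexPattern r t) + 0)) :=
    (tendsto_plantedAvg_disjointCount (indexPattern r) hk hd h).add
      (tendsto_plantedAvg_overlapCount (indexPattern r) hk hd)
  rw [add_zero, prod_indexPattern r fun s => (1 + delta q s) * lam k d s] at h1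
  refine h1.congr fun i => ?_
  exact (cycleLaw_descFactorial S r i.2.2).symm

theorem tendsto_cycleCount_prob {k d : ℕ} {q ω : ℝ} (hk : 0 < k) (hd : 0 < d)
    (h : IsMarginalParam k q) (S : Finset SignPattern) (c : SignPattern → ℕ) :
    Tendsto (fun i : ℕ × ℕ × (ClausePattern k → ℝ) =>
      expectation (fun Φ : Formula i.1 i.2.1 d k => (Zmu i.2.2 Φ : ℝ) *
          Set.indicator {Ψ : Formula i.1 i.2.1 d k | ∀ s ∈ S, cycleCount s Ψ = c s} 1 Φ) /
        expectation (fun Φ : Formula i.1 i.2.1 d k => (Zmu i.2.2 Φ : ℝ)))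
      (profileFilter k d q ω)
      (𝓝 (∏ s ∈ S, poissonProb ((1 + delta q s) * lam k d s) (c s))) := by
  have h1 := tendsto_prob_of_factorial_moments (profileFilter k d q ω)
    (fun i => cycleLaw S (n := i.1) (m := i.2.1) (d := d) i.2.2)
    (fun s : S => (1 + delta q s.1) * lam k d s.1)
    (fun s => mul_nonneg (by linarith [neg_one_lt_delta h s.1]) (lam_nonneg hk hd _))
    (fun i f g hfg => cycleLaw_mono S i.2.2 hfg)
    (fun r => tendsto_cycleLaw_moments hk hd h S r) (fun s => c s.1)
  rw [Finset.prod_coe_sort S fun s => poissonProb ((1 + delta q s) * lam k d s) (c s)] at h1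
  refine h1.congr' ?_
  filter_upwards [eventually_mem_profileFilter,
    (tendsto_atTop.1 (tendsto_snd_profileFilter hk hd)) 1] with i hi hm
  -- Nonemptiness of the planted set guarantees that the quotient of expectations is a genuine
  -- tilted expectation rather than a division by zero.
  rw [expectation_Zmu_div hm _ _ (planted_nonempty hi.2.1 hi.1)]
  rw [cycleLaw_apply, plantedAvg]
  congr 1
  refine Finset.sum_congr rfl fun τ _ => Finset.sum_congr rfl fun Ψ _ => ?_
  rw [Set.indicator_apply, Finset.prod_ite_zero]
  simp

end Final

end RegSAT

theorem mainTheorem4 :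
    ∃ k₀ : ℕ, ∀ k : ℕ, k₀ ≤ k → ∀ d : ℕ, 0 < d →
      2 * (d : ℝ) / k ≤ 2 ^ k * Real.log 2 - k * Real.log 2 / 2 - 4 →
      ∀ q : ℝ, RegSAT.IsMarginalParam k q →
        (∀ (S : Finset RegSAT.SignPattern) (c : RegSAT.SignPattern → ℕ) (ω : ℝ), 0 < ω →
          ∀ ε : ℝ, 0 < ε → ∃ N : ℕ, ∀ n m : ℕ, N ≤ n → m * k = 2 * d * n →
            ∀ μ ∈ RegSAT.nearMarginals k m q ω,
              |RegSAT.expectation (fun Φ : RegSAT.Formula n m d k =>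
                    (RegSAT.Zmu μ Φ : ℝ) *
                      Set.indicator {Ψ : RegSAT.Formula n m d k |
                        ∀ s ∈ S, RegSAT.cycleCount s Ψ = c s} 1 Φ) /
                  RegSAT.expectation (fun Φ : RegSAT.Formula n m d k => (RegSAT.Zmu μ Φ : ℝ)) -
                ∏ s ∈ S,
                  RegSAT.poissonProb ((1 + RegSAT.delta q s) * RegSAT.lam k d s) (c s)| < ε) ∧
        (∀ s : RegSAT.SignPattern, -1 < RegSAT.delta q s) ∧
        (2 * (d : ℝ) - 1) * ((k : ℝ) - 1) * (1 - 4 * q * (1 - q)) < 1 ∧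
        HasSum
          (fun r : ℕ => ∑ s : Fin (r + 1) → ℤˣ × ℤˣ,
            RegSAT.lam k d ⟨r, s⟩ * RegSAT.delta q ⟨r, s⟩ ^ 2)
          (-(1 / 2) * Real.log (1 - (2 * (d : ℝ) - 1) * ((k : ℝ) - 1) * (1 - 4 * q * (1 - q)))) := by
  obtain ⟨k₀, hk₀, hk⟩ := RegSAT.exists_forall_branching_lt_one
  refine ⟨k₀, fun k hkk d hd hdk q hq => ?_⟩
  have hx := hk k hkk d hd hdk q hq
  have hk0 : 0 < k := by omega
  refine ⟨fun S c ω _ ε hε => ?_, RegSAT.neg_one_lt_delta hq, (abs_lt.1 hx).2,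
    RegSAT.hasSum_lam_mul_delta_sq hq d hx⟩
  exact RegSAT.exists_forall_of_eventually_profileFilter
    (Metric.tendsto_nhds.1 (RegSAT.tendsto_cycleCount_prob (ω := ω) hk0 hd hq S c) ε hε)
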